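/- **Conventions.** Simplicial sets carry the Kan–Quillen weak equivalences. For a set $S$, an *$S$-sorted simplicial algebraic theory* $\mathcal{T}$ is a small simplicial category with finite (simplicially enriched) products whose objects are the finite words $\langle a_1,\dots,a_n\rangle$, $n\ge 0$, in $S$, such that the concatenation $\mathbf{a}\mathbf{b}$ of two words is a product $\mathbf{a}\times\mathbf{b}$. A *map* from an $S$-sorted theory $\mathcal{S}$ to an $S'$-sorted theory $\mathcal{T}$ is a product-preserving simplicial functor $f\colon\mathcal{S}\to\mathcal{T}$ together with a function $\varphi\colon S\to S'$ such that $f(\langle a\rangle)=\langle\varphi(a)\rangle$ for every $a\in S$. A simplicial functor $X\colon\mathcal{T}\to\mathrm{sSet}$ is a *weak model* for $\mathcal{T}$ if for every word $\mathbf{a}=\langle a_1,\dots,a_n\rangle$, $n\ge 0$, the map $$X(\mathbf{a})\longrightarrow X(\langle a_1\rangle)\times\dots\times X(\langle a_n\rangle)$$ induced by the projections $\mathbf{a}\to\langle a_i\rangle$ is a weak equivalence of simplicial sets. For a simplicial functor $f\colon\mathcal{C}\to\mathcal{D}$ between small simplicial categories and a simplicial functor $X\colon\mathcal{C}\to\mathrm{sSet}$,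 the *homotopy left Kan extension* $\tilde f_!(X)\colon\mathcal{D}\to\mathrm{sSet}$ sends $d$ to the diagonal of the two-sided bar construction $B(X,\mathcal{C},\mathcal{D}(f(-),d))$, so that $$\tilde f_!(X)(d)_n=\coprod_{c_0,\dots,c_n\in\mathcal{C}}X(c_0)_n\times\mathcal{C}(c_0,c_1)_n\times\dots\times\mathcal{C}(c_{n-1},c_n)_n\times\mathcal{D}(f(c_n),d)_n .$$ **Proposition.** Let $f\colon\mathcal{S}\to\mathcal{T}$ be a map of simplicial algebraic theories. If a simplicial functor $X\colon\mathcal{S}\to\mathrm{sSet}$ is a weak model for $\mathcal{S}$, then $\tilde f_!(X)$ is a weak model for $\mathcal{T}$. -/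

import Mathlib

open CategoryTheory MonoidalCategory Limits Opposite Simplicial

universe u

noncomputable section

namespace AlgTheory

/-! ### Weak equivalences of simplicial sets -/

/-- `[X, K]`: maps of simplicial sets modulo the equivalence relation generated by simplicial
homotopy (which is already an equivalence relation when `K` is a Kan complex). -/
def HomotopyClasses (X K : SSet.{u}) : Type u :=
  Quot (fun f g : X ⟶ K => Nonempty (SSet.Homotopy f g))

/-- Restriction of a simplicial homotopy along a map. -/
def homotopyPrecomp {X Y K : SSet.{u}} (f : X ⟶ Y) {g g' : Y ⟶ K} (H : SSet.Homotopy g g') :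
    SSet.Homotopy (f ≫ g) (f ≫ g') where
  h := f ▷ Δ[1] ≫ H.h
  rel := by
    ext _ ⟨⟨x, hx⟩, _⟩
    exact hx.elim

/-- The map `f^* : [Y, K] → [X, K]` induced by `f : X ⟶ Y`. -/
def HomotopyClasses.precomp {X Y : SSet.{u}} (f : X ⟶ Y) (K : SSet.{u}) :
    HomotopyClasses Y K → HomotopyClasses X K :=
  Quot.map (fun g => f ≫ g) (fun _ _ ⟨H⟩ => ⟨homotopyPrecomp f H⟩)

/-- Weak (homotopy) equivalences of simplicial sets, i.e. the weak equivalences of the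
Kan–Quillen model structure: the maps `f : X ⟶ Y` such that `f^* : [Y, K] → [X, K]` is bijective
for every Kan complex `K`. -/
def IsWeakEquivalence {X Y : SSet.{u}} (f : X ⟶ Y) : Prop :=
  ∀ (K : SSet.{u}), K.KanComplex → Function.Bijective (HomotopyClasses.precomp f K)

/-! ### Products in simplicial categories -/

section Products

variable {C D : Type u} [EnrichedCategory SSet.{u} C] [EnrichedCategory SSet.{u} D]

/-- A morphism `a ⟶ b` of (the underlying category of) a simplicial category. -/
abbrev Mor (a b : C) : Type u := 𝟙_ SSet.{u} ⟶ (a ⟶[SSet.{u}] b)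

/-- Postcomposition `C(c, a) ⟶ C(c, b)` with a morphism `p` from `a` to `b`. -/
def postcomp {a b : C} (p : Mor a b) (c : C) : (c ⟶[SSet.{u}] a) ⟶ (c ⟶[SSet.{u}] b) :=
  (ρ_ _).inv ≫ (_ ◁ p) ≫ eComp SSet.{u} c a b

/-- The family `p i : a ⟶ b i` exhibits `a` as the (simplicially enriched) product of the `b i`:
for every `c` the map `C(c, a) ⟶ ∏ i, C(c, b i)` is an isomorphism of simplicial sets. -/
def IsProduct {n : ℕ} {a : C} {b : Fin n → C} (p : ∀ i, Mor a (b i)) : Prop :=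
  ∀ c : C, IsIso (Pi.lift (fun i => postcomp (p i) c))

/-- The image of a morphism under a simplicial functor. -/
def mapMor (F : EnrichedFunctor SSet.{u} C D) {a b : C} (p : Mor a b) :
    Mor (F.obj a) (F.obj b) :=
  p ≫ F.map a b

/-- A simplicial functor is product preserving if it sends finite product cones to finite product
cones. -/
def PreservesProducts (F : EnrichedFunctor SSet.{u} C D) : Prop :=
  ∀ (n : ℕ) (a : C) (b : Fin n → C) (p : ∀ i, Mor a (b i)),
    IsProduct p → IsProduct (fun i => mapMor F (p i))

/-- For `X` in `sSet^C`, the map of simplicial sets `X(a) ⟶ X(b)` induced by a morphism `p` from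
`a` to `b`. -/
def evalMor (X : EnrichedFunctor SSet.{u} C SSet.{u}) {a b : C} (p : Mor a b) :
    X.obj a ⟶ X.obj b :=
  (eHomEquiv SSet.{u}).symm (p ≫ X.map a b)

end Products

/-! ### Simplicial algebraic theories and weak models -/

/-- An `S`-sorted simplicial algebraic theory: a small simplicial category with finite products,
whose objects are the finite words in `S`, such that the concatenation of two words is their
product. -/
structure SimplicialTheory (S : Type u) where
  /-- the simplicial category structure on words -/
  enriched : EnrichedCategory SSet.{u} (List S)
  exists_product : ∀ (n : ℕ) (b : Fin n → List S),
    ∃ (a : List S) (p : ∀ i, Mor a (b i)), IsProduct p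
  append_product : ∀ a b : List S,
    ∃ p : ∀ i, Mor (a ++ b) ((![a, b] : Fin 2 → List S) i), IsProduct p

/-- The objects of a theory, i.e. the words in its sorts. -/
def SimplicialTheory.Obj {S : Type u} (_ : SimplicialTheory S) : Type u := List S

instance {S : Type u} (T : SimplicialTheory S) : EnrichedCategory SSet.{u} T.Obj := T.enriched

/-- A word, seen as an object of a theory. -/
def SimplicialTheory.word {S : Type u} (T : SimplicialTheory S) (a : List S) : T.Obj := a

/-- A map of simplicial algebraic theories (with possibly different sets of sorts). -/
structure TheoryHom {S S' : Type u} (T : SimplicialTheory S) (T' : SimplicialTheory S') where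
  /-- the map on sorts -/
  sort : S → S'
  /-- the underlying simplicial functor -/
  functor : EnrichedFunctor SSet.{u} T.Obj T'.Obj
  obj_sort : ∀ s : S, functor.obj (T.word [s]) = T'.word [sort s]
  preservesProducts : PreservesProducts functor

/-- `X` in `sSet^T` is a weak model if `X(⟨a₁, …, aₙ⟩) ⟶ X(⟨a₁⟩) × ⋯ × X(⟨aₙ⟩)` is a weak
equivalence for every word `⟨a₁, …, aₙ⟩`, `n ≥ 0`. The projections `⟨a₁, …, aₙ⟩ ⟶ ⟨aᵢ⟩` are those
of any cone exhibiting the word as the product of its letters; any two such cones differ by an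
automorphism of the word. -/
def IsWeakModel {S : Type u} (T : SimplicialTheory S)
    (X : EnrichedFunctor SSet.{u} T.Obj SSet.{u}) : Prop :=
  ∀ (a : List S) (p : ∀ i : Fin a.length, Mor (T.word a) (T.word [a.get i])),
    IsProduct p → IsWeakEquivalence (Pi.lift (fun i => evalMor X (p i)))

/-! ### The ordinary categories of `m`-simplices of a simplicial category -/

/-- The category `C_m` with the objects of `C` and with morphisms the `m`-simplices of the mapping
spaces. -/
def Level (C : Type u) (_ : SimplexCategoryᵒᵖ) : Type u := C

section Level

variable {C D : Type u} [EnrichedCategory SSet.{u} C] [EnrichedCategory SSet.{u} D]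

instance (m : SimplexCategoryᵒᵖ) : Category.{u} (Level C m) where
  Hom a b := (EnrichedCategory.Hom (V := SSet.{u}) (C := C) a b).obj m
  id a := (eId SSet.{u} (C := C) a).app m PUnit.unit
  comp {a b c} f g := (eComp SSet.{u} (C := C) a b c).app m (f, g)
  id_comp {a b} f := by
    have := NatTrans.congr_app (e_id_comp SSet.{u} (C := C) a b) m
    exact ConcreteCategory.congr_hom this f
  comp_id {a b} f := by
    have := NatTrans.congr_app (e_comp_id SSet.{u} (C := C) a b) m
    exact ConcreteCategory.congr_hom this f
  assoc {a b c d} f g h := by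
    have := NatTrans.congr_app (e_assoc SSet.{u} (C := C) a b c d) m
    have h2 := ConcreteCategory.congr_hom this ⟨f, g, h⟩
    exact h2

/-- An object of `C` as an object of `C_m`. -/
def toLevel (m : SimplexCategoryᵒᵖ) (c : C) : Level C m := c

/-- The functor `C_m ⥤ C_m'` given by a simplicial operator. -/
def levelChange (C : Type u) [EnrichedCategory SSet.{u} C] {m m' : SimplexCategoryᵒᵖ}
    (s : m ⟶ m') : Level C m ⥤ Level C m' where
  obj c := c
  map {a b} f := (EnrichedCategory.Hom (V := SSet.{u}) (C := C) a b).map s f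
  map_id a := by
    have := (eId SSet.{u} (C := C) a).naturality s
    have h2 := ConcreteCategory.congr_hom this PUnit.unit
    exact h2.symm
  map_comp {a b c} f g := by
    have := (eComp SSet.{u} (C := C) a b c).naturality s
    have h2 := ConcreteCategory.congr_hom this ⟨f, g⟩
    exact h2.symm

/-- The functor `C_m ⥤ D_m` given by a simplicial functor `C ⟶ D`. -/
def levelFunctor (F : EnrichedFunctor SSet.{u} C D) (m : SimplexCategoryᵒᵖ) :
    Level C m ⥤ Level D m where
  obj c := F.obj c
  map {a b} f := (F.map a b).app m f
  map_id a := by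
    have := NatTrans.congr_app (F.map_id a) m
    have h2 := ConcreteCategory.congr_hom this PUnit.unit
    exact h2
  map_comp {a b c} f g := by
    have := NatTrans.congr_app (F.map_comp a b c) m
    have h2 := ConcreteCategory.congr_hom this ⟨f, g⟩
    exact h2

/-- The functor `X_m : C_m ⥤ Type` given by the `m`-simplices of the values of
a simplicial functor `X` in `sSet^C`. -/
def levelModule (X : EnrichedFunctor SSet.{u} C SSet.{u}) (m : SimplexCategoryᵒᵖ) :
    Level C m ⥤ Type u where
  obj c := (X.obj c).obj m
  map {a b} f := Functor.HomObj.app ((X.map a b).app m f) m (𝟙 m)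
  map_id a := by
    have := NatTrans.congr_app (X.map_id a) m
    have h2 := ConcreteCategory.congr_hom this PUnit.unit
    exact Functor.HomObj.congr_app h2 m (𝟙 m)
  map_comp {a b c} f g := by
    have := NatTrans.congr_app (X.map_comp a b c) m
    have h2 := ConcreteCategory.congr_hom this ⟨f, g⟩
    exact Functor.HomObj.congr_app h2 m (𝟙 m)

end Level

/-! ### The two-sided bar construction -/

/-- An `n`-simplex `(c | x; α; y)` of the two-sided bar construction of `X : E ⥤ Type` and
`Y : Eᵒᵖ ⥤ Type`: a chain `c₀ ⟶ ⋯ ⟶ cₙ` of `n` composable arrows `α` in `E`, an element `x` of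
`X(c₀)` and an element `y` of `Y(cₙ)`. -/
structure BarSimplex {E : Type u} [Category.{u} E] (X : E ⥤ Type u) (Y : Eᵒᵖ ⥤ Type u)
    (n : ℕ) : Type u where
  /-- the chain `c₀ ⟶ ⋯ ⟶ cₙ` -/
  chain : ComposableArrows E n
  /-- the element of `X(c₀)` -/
  x : X.obj (chain.obj 0)
  /-- the element of `Y(cₙ)` -/
  y : Y.obj (op (chain.obj (Fin.last n)))

section Bar

variable {E E' : Type u} [Category.{u} E] [Category.{u} E']

theorem BarSimplex.eq_of {X : E ⥤ Type u} {Y : Eᵒᵖ ⥤ Type u} {n : ℕ}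
    {s t : BarSimplex X Y n} (h : s.chain = t.chain) (hx : s.x ≍ t.x) (hy : s.y ≍ t.y) :
    s = t := by
  obtain ⟨F, x, y⟩ := s
  obtain ⟨G, x', y'⟩ := t
  subst h
  cases hx
  cases hy
  rfl

/-- The action of `θ : [m] ⟶ [n]`: the chain is reindexed along `θ`, the element `x` is pushed
forward along `c₀ ⟶ c_{θ(0)}` and `y` is pulled back along `c_{θ(m)} ⟶ cₙ`. -/
def BarSimplex.reindex {X : E ⥤ Type u} {Y : Eᵒᵖ ⥤ Type u} {m n : SimplexCategory}
    (θ : m ⟶ n) (s : BarSimplex X Y n.len) : BarSimplex X Y m.len where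
  chain := s.chain.whiskerLeft (SimplexCategory.toCat.map θ).toFunctor
  x := X.map (s.chain.map (homOfLE (Fin.zero_le (θ.toOrderHom 0)))) s.x
  y := Y.map (s.chain.map (homOfLE (Fin.le_last (θ.toOrderHom (Fin.last m.len))))).op s.y

/-- The two-sided bar construction, a simplicial set, of a covariant and a contravariant functor
to sets on an ordinary category. -/
def barSSet (X : E ⥤ Type u) (Y : Eᵒᵖ ⥤ Type u) : SSet.{u} where
  obj n := BarSimplex X Y n.unop.len
  map θ := ↾fun s => s.reindex θ.unop
  map_id n := by
    ext s
    refine BarSimplex.eq_of rfl (heq_of_eq ?_) (heq_of_eq ?_)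
    · exact ConcreteCategory.congr_hom ((congrArg X.map (s.chain.map_id 0)).trans (X.map_id _)) s.x
    · exact ConcreteCategory.congr_hom
        ((congrArg (fun t => Y.map (Quiver.Hom.op t)) (s.chain.map_id (Fin.last _))).trans
          (Y.map_id _)) s.y
  map_comp θ θ' := by
    ext s
    refine BarSimplex.eq_of rfl (heq_of_eq ?_) (heq_of_eq ?_)
    · exact ConcreteCategory.congr_hom
        ((congrArg X.map (s.chain.map_comp _ _)).trans (X.map_comp _ _)) s.x
    · exact ConcreteCategory.congr_hom
        ((congrArg (fun t => Y.map (Quiver.Hom.op t)) (s.chain.map_comp _ _)).trans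
          (Y.map_comp _ _)) s.y

/-- Functoriality of the two-sided bar construction. -/
def barMap {X : E ⥤ Type u} {Y : Eᵒᵖ ⥤ Type u} {X' : E' ⥤ Type u} {Y' : E'ᵒᵖ ⥤ Type u}
    (L : E ⥤ E') (η : X ⟶ L ⋙ X') (ε : Y ⟶ L.op ⋙ Y') : barSSet X Y ⟶ barSSet X' Y' where
  app n := ↾fun s =>
    { chain := s.chain ⋙ L
      x := η.app _ s.x
      y := ε.app _ s.y }
  naturality n n' θ := by
    ext s
    refine BarSimplex.eq_of rfl (heq_of_eq ?_) (heq_of_eq ?_)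
    · exact ConcreteCategory.congr_hom (η.naturality _) s.x
    · exact ConcreteCategory.congr_hom (ε.naturality _) s.y

end Bar

section KanExtension

variable {C D : Type u} [EnrichedCategory SSet.{u} C] [EnrichedCategory SSet.{u} D]

/-- The functor `C_m^op ⥤ Type` sending `c` to `D(f(c), d)_m`. -/
abbrev levelCorep (f : EnrichedFunctor SSet.{u} C D) (d : D) (m : SimplexCategoryᵒᵖ) :
    (Level C m)ᵒᵖ ⥤ Type u :=
  (levelFunctor f m).op ⋙ yoneda.obj (toLevel m d)

/-- The bisimplicial set `B(X, C, D(f(-), d))`. The outer variable `m` is the simplicial direction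
of the mapping spaces and of `X`, the inner variable is the bar direction. -/
def bar (f : EnrichedFunctor SSet.{u} C D) (X : EnrichedFunctor SSet.{u} C SSet.{u}) (d : D) :
    SimplexCategoryᵒᵖ ⥤ SSet.{u} where
  obj m := barSSet (levelModule X m) (levelCorep f d m)
  map {m m'} s := barMap (levelChange C s)
    { app := fun c => (X.obj c).map s
      naturality := fun a b g => by
        ext x
        have h1 := Functor.HomObj.naturality ((X.map a b).app m g) s (𝟙 m)
        have h2 := Functor.HomObj.congr_app
          (ConcreteCategory.congr_hom ((X.map a b).naturality s) g) m' (𝟙 m')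
        have h3 := ConcreteCategory.congr_hom h1 x
        refine Eq.symm (Eq.trans (Eq.trans (ConcreteCategory.congr_hom h2 _) ?_) h3)
        have h4 : s ≫ 𝟙 m' = 𝟙 m ≫ s := by simp
        exact ConcreteCategory.congr_hom
          (congrArg (Functor.HomObj.app ((X.map a b).app m g) m') h4) _ }
    { app := fun c => (EnrichedCategory.Hom (V := SSet.{u}) (f.obj c.unop) d).map s
      naturality := fun a b g => by
        ext y
        have h1 := (levelChange D s).map_comp (X := toLevel m (f.obj b.unop))
          (Y := toLevel m (f.obj a.unop)) (Z := toLevel m d) ((levelFunctor f m).map g.unop) y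
        have h2 := ConcreteCategory.congr_hom ((f.map b.unop a.unop).naturality s) g.unop
        refine Eq.trans h1 (Eq.symm ?_)
        exact congrArg (fun z : toLevel m' (f.obj b.unop) ⟶ toLevel m' (f.obj a.unop) =>
          z ≫ (show toLevel m' (f.obj a.unop) ⟶ toLevel m' d from
            (levelChange D s).map (X := toLevel m (f.obj a.unop)) (Y := toLevel m d) y)) h2 }
  map_id m := by
    ext n s
    refine BarSimplex.eq_of (CategoryTheory.Functor.hext (fun _ => rfl)
      fun a b g => heq_of_eq ?_) (heq_of_eq ?_) (heq_of_eq ?_)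
    · exact ConcreteCategory.congr_hom ((EnrichedCategory.Hom (V := SSet.{u}) (C := C)
        (s.chain.obj a) (s.chain.obj b)).map_id m) (s.chain.map g)
    · exact ConcreteCategory.congr_hom ((X.obj (s.chain.obj 0)).map_id m) s.x
    · exact ConcreteCategory.congr_hom ((EnrichedCategory.Hom (V := SSet.{u})
        (f.obj (s.chain.obj (Fin.last _))) d).map_id m) s.y
  map_comp t t' := by
    ext n s
    refine BarSimplex.eq_of (CategoryTheory.Functor.hext (fun _ => rfl)
      fun a b g => heq_of_eq ?_) (heq_of_eq ?_) (heq_of_eq ?_)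
    · exact ConcreteCategory.congr_hom ((EnrichedCategory.Hom (V := SSet.{u}) (C := C)
        (s.chain.obj a) (s.chain.obj b)).map_comp t t') (s.chain.map g)
    · exact ConcreteCategory.congr_hom ((X.obj (s.chain.obj 0)).map_comp t t') s.x
    · exact ConcreteCategory.congr_hom ((EnrichedCategory.Hom (V := SSet.{u})
        (f.obj (s.chain.obj (Fin.last _))) d).map_comp t t') s.y

/-- The map `B(X, C, D(f(-), d))_m ⟶ B(X, C, D(f(-), d'))_m` given by postcomposition with
an `m`-simplex `g` of `D(d, d')`. -/
def barPush (f : EnrichedFunctor SSet.{u} C D) (X : EnrichedFunctor SSet.{u} C SSet.{u})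
    {m : SimplexCategoryᵒᵖ} {d d' : D} (g : toLevel m d ⟶ toLevel m d') :
    (bar f X d).obj m ⟶ (bar f X d').obj m :=
  barMap (𝟭 _) (𝟙 _) (Functor.whiskerLeft (levelFunctor f m).op (yoneda.map g))

/-- The diagonal of a bisimplicial set. -/
def diagonal (B : SimplexCategoryᵒᵖ ⥤ SSet.{u}) : SSet.{u} where
  obj n := (B.obj n).obj n
  map s := (B.map s).app _ ≫ (B.obj _).map s
  map_id n := by simp
  map_comp s t := by simp

/-- The homotopy left Kan extension `f̃_!(X)` of `X` along `f`: the simplicial functor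
sending `d` to the diagonal of `B(X, C, D(f(-), d))`. -/
def homotopyLan (f : EnrichedFunctor SSet.{u} C D) (X : EnrichedFunctor SSet.{u} C SSet.{u}) :
    EnrichedFunctor SSet.{u} D SSet.{u} where
  obj d := diagonal (bar f X d)
  map d d' :=
    { app := fun n => ↾fun g =>
        { app := fun m φ => (barPush f X ((levelChange D φ).map (X := toLevel n d)
            (Y := toLevel n d') g)).app m
          naturality := fun {m m'} t φ => by
            ext s
            refine BarSimplex.eq_of rfl HEq.rfl (heq_of_eq ?_)
            have h1 : (EnrichedCategory.Hom (V := SSet.{u}) d d').map (φ ≫ t) g =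
                (levelChange D t).map (X := toLevel m d) (Y := toLevel m d')
                  ((levelChange D φ).map (X := toLevel n d) (Y := toLevel n d') g) :=
              ConcreteCategory.congr_hom
                ((EnrichedCategory.Hom (V := SSet.{u}) d d').map_comp φ t) g
            have h2 := (levelChange D t).map_comp (Z := toLevel m d')
              (show toLevel m (f.obj (s.chain.obj (Fin.last _))) ⟶ toLevel m d from s.y)
              ((levelChange D φ).map (X := toLevel n d) (Y := toLevel n d') g)
            refine Eq.trans (congrArg (fun z : toLevel m' d ⟶ toLevel m' d' => _ ≫ z) h1)
              (Eq.trans (Category.assoc _ _ _) (congrArg (fun z : toLevel m'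
                (f.obj (s.chain.obj (Fin.last _))) ⟶ toLevel m' d' =>
                  (levelFunctor f m').map ((levelChange C t).map (s.chain.map (homOfLE
                    (Fin.le_last (t.unop.toOrderHom (Fin.last _)))))) ≫ z) h2.symm)) }
      naturality := fun n n' t => by
        ext g
        refine Functor.functorHom_ext fun m φ => ?_
        ext s
        refine BarSimplex.eq_of rfl HEq.rfl (heq_of_eq ?_)
        have h1 := ConcreteCategory.congr_hom
          ((EnrichedCategory.Hom (V := SSet.{u}) d d').map_comp t φ) g
        exact congrArg (fun z : toLevel m d ⟶ toLevel m d' =>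
          (show toLevel m (f.obj (s.chain.obj (Fin.last _))) ⟶ toLevel m d from s.y) ≫ z) h1.symm }
  map_id d := by
    ext n g
    refine Functor.functorHom_ext fun m φ => ?_
    ext s
    refine BarSimplex.eq_of rfl HEq.rfl (heq_of_eq ?_)
    have h1 := (levelChange D φ).map_id (toLevel n d)
    have h2 := Category.comp_id
      (show toLevel m (f.obj (s.chain.obj (Fin.last _))) ⟶ toLevel m d from s.y)
    exact Eq.trans (congrArg (fun z : toLevel m d ⟶ toLevel m d =>
      (show toLevel m (f.obj (s.chain.obj (Fin.last _))) ⟶ toLevel m d from s.y) ≫ z) h1) h2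
  map_comp d d' d'' := by
    ext n g
    refine Functor.functorHom_ext fun m φ => ?_
    ext s
    refine BarSimplex.eq_of rfl HEq.rfl (heq_of_eq ?_)
    have h1 := (levelChange D φ).map_comp (X := toLevel n d) (Y := toLevel n d')
      (Z := toLevel n d'') g.1 g.2
    have h2 := Category.assoc
      (show toLevel m (f.obj (s.chain.obj (Fin.last _))) ⟶ toLevel m d from s.y)
      ((levelChange D φ).map (X := toLevel n d) (Y := toLevel n d') g.1)
      ((levelChange D φ).map (X := toLevel n d') (Y := toLevel n d'') g.2)
    refine Eq.trans (congrArg (fun z : toLevel m d ⟶ toLevel m d'' =>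
      (show toLevel m (f.obj (s.chain.obj (Fin.last _))) ⟶ toLevel m d from s.y) ≫ z) h1) h2.symm

end KanExtension

end AlgTheory

end

/-!
Let `p i : a ⟶ b i` exhibit a word `a` of the target theory as the product of its letters. The claim
is that `diag B(X, S, T(f(-), a)) ⟶ ∏ i, diag B(X, S, T(f(-), b i))` is a weak equivalence. Both
sides are compared with the diagonal of a third bisimplicial set, `familyBar`. Its simplices are
families of chains `c i`, one for each letter, together with maps from the images of their final
objects to the letters `b i`, and with an element of `X` at a product `w(c)` of the family of their
initial objects. The words `w(c)` are fixed in advance so that `X(w(c)) ⟶ ∏ i, X(c i)` is a weak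
equivalence; since concatenation of words is a product, they can be built one letter at a time from
the assumption that `X` is a weak model (`IsWeakModel.exists_product`).

* The source maps to `familyBar` by repeating the chain (`toFamilyBar`). A map backwards multiplies
  the chains, using that maps into `a` are families of maps into the `b i` (`ofFamilyBar`). The
  diagonals `c ⟶ w(c, …, c)` and the projections `w(c) ⟶ c i` are natural transformations, and natural
  transformations give homotopies of bar constructions (`barHomotopy`), so that the two maps are
  inverse homotopy equivalences (`isWeakEquivalence_diagonalMap_toFamilyBar`).
* The map from `familyBar` to the target pushes the element of `X(w(c))` forward along the
  projections. In each bar degree it is a coproduct, over the families `c` of initial objects, of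
  products of `X(w(c)) ⟶ ∏ i, X(c i)` with simplicial sets that do not involve `X`. So it is a weak
  equivalence in each bar degree, hence on diagonals
  (`isWeakEquivalence_diagonalMap_familyBarToProdBar`).

The last step is the realization lemma `IsWeakEquivalence.diagonalMap`: a map of bisimplicial sets
that is a weak equivalence in each degree of one direction is a weak equivalence on diagonals. Here
weak equivalences are the maps inducing bijections on homotopy classes of maps into Kan complexes.
Among the monomorphisms they are the maps with the left lifting property against the Kan
fibrations between Kan complexes (`IsWeakEquivalence.trivialCofibrations`,
`isWeakEquivalence_of_trivialCofibrations`), a class closed under pushouts, transfinite compositions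
and pushout-products with monomorphisms. For a degreewise monomorphism the realization lemma follows
from the filtration of the diagonal by skeleta. A general map `A ⟶ B` factors through the product of
`B` with a functorially contractible bisimplicial set containing `A`.
-/


noncomputable section

namespace AlgTheory

section

open HomotopicalAlgebra SSet.modelCategoryQuillen

/-! ### Simplicial homotopies -/

/-- Two maps of simplicial sets are homotopic if a single simplicial homotopy joins them. -/
def Homotopic {X Y : SSet.{u}} (f g : X ⟶ Y) : Prop :=
  ∃ h : X ⊗ Δ[1] ⟶ Y, SSet.ι₀ ≫ h = f ∧ SSet.ι₁ ≫ h = g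

theorem nonempty_homotopy_iff {X Y : SSet.{u}} (f g : X ⟶ Y) :
    Nonempty (SSet.Homotopy f g) ↔ Homotopic f g := by
  constructor
  · rintro ⟨H⟩
    exact ⟨H.h, H.h₀, H.h₁⟩
  · rintro ⟨h, h0, h1⟩
    refine ⟨{ h := h, h₀ := h0, h₁ := h1, rel := ?_ }⟩
    ext _ ⟨⟨x, hx⟩, _⟩
    exact hx.elim

/-- The face inclusions of `Δ[1]` are constant at a vertex: the face opposite to `j` is the other
vertex `i`. -/
theorem from_comp_δ {X : SSet.{u}} (i j : Fin 2) (h : i ≠ j) :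
    SSet.stdSimplex.isTerminalObj₀.from X ≫ SSet.stdSimplex.δ j =
      SSet.const (SSet.stdSimplex.obj₀Equiv.{u}.symm i) := by
  have e : SSet.stdSimplex.isTerminalObj₀.{u}.from X =
      SSet.const (SSet.stdSimplex.obj₀Equiv.{u}.symm 0) :=
    SSet.stdSimplex.isTerminalObj₀.hom_ext _ _
  rw [e, SSet.const_comp]
  congr 1
  apply SSet.stdSimplex.obj₀Equiv.injective
  rw [Equiv.apply_symm_apply]
  obtain ⟨rfl, rfl⟩ | ⟨rfl, rfl⟩ : (i = 0 ∧ j = 1) ∨ (i = 1 ∧ j = 0) := by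
    revert i j; decide
  · rfl
  · rfl

theorem ι₀_eq (X : SSet.{u}) :
    (SSet.ι₀ : X ⟶ X ⊗ Δ[1]) =
      CartesianMonoidalCategory.lift (𝟙 X) (SSet.stdSimplex.isTerminalObj₀.from X) ≫
        X ◁ SSet.stdSimplex.δ 1 := by
  rw [CartesianMonoidalCategory.lift_whiskerLeft, from_comp_δ 0 1 (by simp)]
  rfl

theorem ι₁_eq (X : SSet.{u}) :
    (SSet.ι₁ : X ⟶ X ⊗ Δ[1]) =
      CartesianMonoidalCategory.lift (𝟙 X) (SSet.stdSimplex.isTerminalObj₀.from X) ≫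
        X ◁ SSet.stdSimplex.δ 0 := by
  rw [CartesianMonoidalCategory.lift_whiskerLeft, from_comp_δ 1 0 (by simp)]
  rfl

theorem fst_lift_from (X : SSet.{u}) :
    CartesianMonoidalCategory.fst X Δ[0] ≫
      CartesianMonoidalCategory.lift (𝟙 X) (SSet.stdSimplex.isTerminalObj₀.from X) = 𝟙 _ := by
  ext : 1
  · simp
  · exact SSet.stdSimplex.isTerminalObj₀.hom_ext _ _

/-- A relative filling of the outer horn `Λ[2, 2]` parametrised by `X`. The faces opposite to `0` and
`1` are given as homotopies with the same end, and the third face is produced, over a given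
`2`-simplex `t` in the base. -/
theorem exists_fill {X E F : SSet.{u}} (p : E ⟶ F) [Fibration p] (h02 h12 : X ⊗ Δ[1] ⟶ E)
    (hc : SSet.ι₁ ≫ h02 = SSet.ι₁ ≫ h12) (t : X ⊗ Δ[2] ⟶ F)
    (t1 : X ◁ SSet.stdSimplex.δ 1 ≫ t = h02 ≫ p) (t0 : X ◁ SSet.stdSimplex.δ 0 ≫ t = h12 ≫ p) :
    ∃ h01 : X ⊗ Δ[1] ⟶ E, SSet.ι₀ ≫ h01 = SSet.ι₀ ≫ h02 ∧ SSet.ι₁ ≫ h01 = SSet.ι₀ ≫ h12 ∧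
      h01 ≫ p = X ◁ SSet.stdSimplex.δ 2 ≫ t := by
  have hc' : X ◁ SSet.stdSimplex.δ 0 ≫ h02 = X ◁ SSet.stdSimplex.δ 0 ≫ h12 := by
    have := congrArg (CartesianMonoidalCategory.fst X Δ[0] ≫ ·) hc
    simp only [ι₁_eq, Category.assoc] at this
    simpa only [← Category.assoc, fst_lift_from, Category.id_comp] using this
  let f : ∀ (j : Fin 3) (_ : j ≠ 2), Δ[1] ⟶ (ihom X).obj E := fun j _ =>
    if j = 0 then MonoidalClosed.curry h12 else MonoidalClosed.curry h02
  have hf : SSet.horn.IsCompatible (i := 2) f := by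
    rw [SSet.horn.isCompatible_iff]
    intro j k hj hk hjk
    obtain ⟨rfl, rfl⟩ : j = 0 ∧ k = 1 := by revert j k; decide
    simp only [f, if_true, one_ne_zero, if_false]
    rw [← MonoidalClosed.curry_natural_left, ← MonoidalClosed.curry_natural_left]
    exact congrArg _ hc'.symm
  obtain ⟨φ, h1, h2⟩ := hf.exists_lift ((ihom X).map p) (MonoidalClosed.curry t) (by
    intro j hj
    obtain rfl | rfl : j = 0 ∨ j = 1 := by revert j; decide
    · simp only [f, if_true]
      rw [← MonoidalClosed.curry_natural_left, t0, MonoidalClosed.curry_natural_right]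
    · simp only [f, one_ne_zero, if_false]
      rw [← MonoidalClosed.curry_natural_left, t1, MonoidalClosed.curry_natural_right])
  have k0 : X ◁ SSet.stdSimplex.δ 0 ≫ MonoidalClosed.uncurry φ = h12 := by
    rw [← MonoidalClosed.uncurry_natural_left, h1 0 (by simp)]
    simp [f]
  have k1 : X ◁ SSet.stdSimplex.δ 1 ≫ MonoidalClosed.uncurry φ = h02 := by
    rw [← MonoidalClosed.uncurry_natural_left, h1 1 (by simp)]
    simp [f]
  have k : MonoidalClosed.uncurry φ ≫ p = t := by
    rw [← MonoidalClosed.uncurry_natural_right, h2, MonoidalClosed.uncurry_curry]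
  refine ⟨X ◁ SSet.stdSimplex.δ 2 ≫ MonoidalClosed.uncurry φ, ?_, ?_, ?_⟩
  · rw [← k1, ι₀_eq, Category.assoc, Category.assoc, ← whiskerLeft_comp_assoc,
      ← whiskerLeft_comp_assoc]
    congr 3
    exact (SSet.stdSimplex.δ_comp_δ (n := 0) (i := 1) (j := 1) le_rfl)
  · rw [← k0, ι₀_eq, ι₁_eq, Category.assoc, Category.assoc, ← whiskerLeft_comp_assoc,
      ← whiskerLeft_comp_assoc]
    congr 3
    exact (SSet.stdSimplex.δ_comp_δ (n := 0) (i := 0) (j := 1) (by simp))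
  · rw [Category.assoc, k]

/-! ### Homotopies into Kan complexes -/

theorem Homotopic.refl {X Y : SSet.{u}} (f : X ⟶ Y) : Homotopic f f :=
  ⟨CartesianMonoidalCategory.fst _ _ ≫ f, by simp, by simp⟩

theorem Homotopic.precomp {W X Y : SSet.{u}} (e : W ⟶ X) {f g : X ⟶ Y} (h : Homotopic f g) :
    Homotopic (e ≫ f) (e ≫ g) := by
  obtain ⟨h, rfl, rfl⟩ := h
  exact ⟨e ▷ _ ≫ h, by simp, by simp⟩

theorem Homotopic.postcomp {X Y Z : SSet.{u}} {f g : X ⟶ Y} (h : Homotopic f g) (e : Y ⟶ Z) :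
    Homotopic (f ≫ e) (g ≫ e) := by
  obtain ⟨h, rfl, rfl⟩ := h
  exact ⟨h ≫ e, by simp, by simp⟩

/-- The homotopy relation into a Kan complex is Euclidean. With reflexivity this makes it an
equivalence relation, so only one kind of horn has to be filled. -/
theorem Homotopic.euclidean {X K : SSet.{u}} [K.KanComplex] {f g h : X ⟶ K}
    (h1 : Homotopic f h) (h2 : Homotopic g h) : Homotopic f g := by
  obtain ⟨a, rfl, ha⟩ := h1
  obtain ⟨b, rfl, hb⟩ := h2
  obtain ⟨c, hc0, hc1, -⟩ := exists_fill (terminal.from K) a b (ha.trans hb.symm)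
    (terminal.from _) (by simp) (by simp)
  exact ⟨c, hc0, hc1⟩

theorem Homotopic.symm {X K : SSet.{u}} [K.KanComplex] {f g : X ⟶ K} (h : Homotopic f g) :
    Homotopic g f :=
  (Homotopic.refl g).euclidean h

theorem Homotopic.trans {X K : SSet.{u}} [K.KanComplex] {f g h : X ⟶ K}
    (h1 : Homotopic f g) (h2 : Homotopic g h) : Homotopic f h :=
  h1.euclidean h2.symm

theorem homotopyClasses_mk_eq_iff {X K : SSet.{u}} [K.KanComplex] (f g : X ⟶ K) :
    (Quot.mk _ f : HomotopyClasses X K) = Quot.mk _ g ↔ Homotopic f g := by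
  have e : (fun f g : X ⟶ K => Nonempty (SSet.Homotopy f g)) = Homotopic := by
    ext f g
    exact nonempty_homotopy_iff f g
  have he : Equivalence (Homotopic : (X ⟶ K) → (X ⟶ K) → Prop) :=
    ⟨Homotopic.refl, Homotopic.symm, Homotopic.trans⟩
  rw [Quot.eq, e, he.eqvGen_iff]

/-- Bijectivity of `f^*` on homotopy classes, in terms of single homotopies. -/
theorem isWeakEquivalence_iff {X Y : SSet.{u}} (f : X ⟶ Y) :
    IsWeakEquivalence f ↔ ∀ (K : SSet.{u}), K.KanComplex →
      (∀ u : X ⟶ K, ∃ v : Y ⟶ K, Homotopic (f ≫ v) u) ∧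
      (∀ v v' : Y ⟶ K, Homotopic (f ≫ v) (f ≫ v') → Homotopic v v') := by
  refine forall_congr' fun K => forall_congr' fun hK => ?_
  rw [Function.Bijective, and_comm]
  refine and_congr ⟨fun h u => ?_, fun h => ?_⟩ ⟨fun h v v' hv => ?_, fun h => ?_⟩
  · obtain ⟨⟨v⟩, hv⟩ := h (Quot.mk _ u)
    exact ⟨v, (homotopyClasses_mk_eq_iff _ _).1 hv⟩
  · rintro ⟨u⟩
    obtain ⟨v, hv⟩ := h u
    exact ⟨Quot.mk _ v, (homotopyClasses_mk_eq_iff _ _).2 hv⟩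
  · exact (homotopyClasses_mk_eq_iff _ _).1 (h ((homotopyClasses_mk_eq_iff _ _).2 hv))
  · rintro ⟨v⟩ ⟨v'⟩ hv
    exact (homotopyClasses_mk_eq_iff _ _).2 (h v v' ((homotopyClasses_mk_eq_iff _ _).1 hv))

/-! ### Formal properties of weak equivalences -/

theorem HomotopyClasses.precomp_comp {X Y Z : SSet.{u}} (f : X ⟶ Y) (g : Y ⟶ Z) (K : SSet.{u}) :
    HomotopyClasses.precomp (f ≫ g) K =
      HomotopyClasses.precomp f K ∘ HomotopyClasses.precomp g K := by
  funext q
  induction q using Quot.ind with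
  | mk v => exact congrArg (Quot.mk _) (Category.assoc f g v)

theorem IsWeakEquivalence.comp {X Y Z : SSet.{u}} {f : X ⟶ Y} {g : Y ⟶ Z}
    (hf : IsWeakEquivalence f) (hg : IsWeakEquivalence g) : IsWeakEquivalence (f ≫ g) := by
  intro K hK
  rw [HomotopyClasses.precomp_comp]
  exact (hf K hK).comp (hg K hK)

theorem IsWeakEquivalence.of_comp_left {X Y Z : SSet.{u}} {f : X ⟶ Y} {g : Y ⟶ Z}
    (hf : IsWeakEquivalence f) (hfg : IsWeakEquivalence (f ≫ g)) : IsWeakEquivalence g := by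
  intro K hK
  have := hfg K hK
  rw [HomotopyClasses.precomp_comp] at this
  exact ((hf K hK).of_comp_iff' _).1 this

theorem IsWeakEquivalence.of_comp_right {X Y Z : SSet.{u}} {f : X ⟶ Y} {g : Y ⟶ Z}
    (hg : IsWeakEquivalence g) (hfg : IsWeakEquivalence (f ≫ g)) : IsWeakEquivalence f := by
  intro K hK
  have := hfg K hK
  rw [HomotopyClasses.precomp_comp] at this
  exact (Function.Bijective.of_comp_iff _ (hg K hK)).1 this

/-- Symmetric and transitive closures of the homotopy relation are allowed here because the
middle objects are not assumed to be Kan complexes. -/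
theorem IsWeakEquivalence.of_homotopyInverse {X Y : SSet.{u}} (f : X ⟶ Y) (g : Y ⟶ X)
    (h1 : Relation.EqvGen Homotopic (f ≫ g) (𝟙 X)) (h2 : Relation.EqvGen Homotopic (g ≫ f) (𝟙 Y)) :
    IsWeakEquivalence f := by
  have key : ∀ {A B K : SSet.{u}} (_ : K.KanComplex) {a b : A ⟶ B}
      (_ : Relation.EqvGen Homotopic a b) (v : B ⟶ K), Homotopic (a ≫ v) (b ≫ v) := by
    intro A B K _ a b h v
    induction h with
    | rel _ _ h => exact h.postcomp v
    | refl => exact Homotopic.refl _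
    | symm _ _ _ ih => exact ih.symm
    | trans _ _ _ _ _ ih1 ih2 => exact ih1.trans ih2
  rw [isWeakEquivalence_iff]
  refine fun K hK => ⟨fun u => ⟨g ≫ u, by simpa using key hK h1 u⟩, fun v v' h => ?_⟩
  have e1 := key hK h2 v
  have e2 := key hK h2 v'
  have e3 := h.precomp g
  simp only [Category.assoc, Category.id_comp] at e1 e2 e3
  exact e1.symm.trans (e3.trans e2)

theorem IsWeakEquivalence.of_isIso {X Y : SSet.{u}} (f : X ⟶ Y) [IsIso f] :
    IsWeakEquivalence f :=
  .of_homotopyInverse f (inv f) (by simpa using .refl _) (by simpa using .refl _)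

/-- Homotopies of maps out of a product correspond to homotopies of the curried maps. -/
theorem homotopic_curry_iff {A X K : SSet.{u}} (f g : A ⊗ X ⟶ K) :
    Homotopic (MonoidalClosed.curry f) (MonoidalClosed.curry g) ↔ Homotopic f g := by
  have e0 : A ◁ (SSet.ι₀ : X ⟶ _) = SSet.ι₀ ≫ (α_ A X Δ[1]).hom := rfl
  have e1 : A ◁ (SSet.ι₁ : X ⟶ _) = SSet.ι₁ ≫ (α_ A X Δ[1]).hom := rfl
  constructor
  · rintro ⟨h, h0, h1⟩
    refine ⟨(α_ _ _ _).hom ≫ MonoidalClosed.uncurry h, ?_, ?_⟩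
    · rw [← Category.assoc, ← e0, ← MonoidalClosed.uncurry_natural_left, h0,
        MonoidalClosed.uncurry_curry]
    · rw [← Category.assoc, ← e1, ← MonoidalClosed.uncurry_natural_left, h1,
        MonoidalClosed.uncurry_curry]
  · rintro ⟨h, rfl, rfl⟩
    refine ⟨MonoidalClosed.curry ((α_ _ _ _).inv ≫ h), ?_, ?_⟩
    · rw [← MonoidalClosed.curry_natural_left, e0]
      simp
    · rw [← MonoidalClosed.curry_natural_left, e1]
      simp

theorem IsWeakEquivalence.whiskerLeft {X Y : SSet.{u}} {f : X ⟶ Y} (hf : IsWeakEquivalence f)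
    (A : SSet.{u}) : IsWeakEquivalence (A ◁ f) := by
  rw [isWeakEquivalence_iff] at hf ⊢
  intro K hK
  obtain ⟨h1, h2⟩ := hf ((ihom A).obj K) inferInstance
  constructor
  · intro u
    obtain ⟨v, hv⟩ := h1 (MonoidalClosed.curry u)
    refine ⟨MonoidalClosed.uncurry v, ?_⟩
    rw [← homotopic_curry_iff, MonoidalClosed.curry_natural_left, MonoidalClosed.curry_uncurry]
    exact hv
  · intro v v' h
    rw [← homotopic_curry_iff] at h ⊢
    rw [MonoidalClosed.curry_natural_left, MonoidalClosed.curry_natural_left] at h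
    exact h2 _ _ h

theorem IsWeakEquivalence.whiskerRight {X Y : SSet.{u}} {f : X ⟶ Y} (hf : IsWeakEquivalence f)
    (A : SSet.{u}) : IsWeakEquivalence (f ▷ A) := by
  have e : f ▷ A = (β_ X A).hom ≫ A ◁ f ≫ (β_ A Y).hom := by simp
  rw [e]
  exact (IsWeakEquivalence.of_isIso _).comp
    ((hf.whiskerLeft A).comp (IsWeakEquivalence.of_isIso _))

/-! ### Coproducts of weak equivalences -/

/-- The coproduct of a family of simplicial sets, with the expected sets of simplices. -/
def sigmaSSet {I : Type u} (X : I → SSet.{u}) : SSet.{u} where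
  obj m := Σ i, (X i).obj m
  map s := ↾fun x => ⟨x.1, (X x.1).map s x.2⟩
  map_id m := by
    refine ConcreteCategory.hom_ext _ _ fun x => ?_
    exact congrArg (fun y => (⟨x.1, y⟩ : Σ i, (X i).obj m))
      (ConcreteCategory.congr_hom ((X x.1).map_id m) x.2)
  map_comp s t := by
    refine ConcreteCategory.hom_ext _ _ fun x => ?_
    exact congrArg (fun y => (⟨x.1, y⟩ : Σ i, (X i).obj _))
      (ConcreteCategory.congr_hom ((X x.1).map_comp s t) x.2)

/-- The inclusion of a summand. -/
def sigmaIncl {I : Type u} (X : I → SSet.{u}) (i : I) : X i ⟶ sigmaSSet X where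
  app m := ↾fun x => ⟨i, x⟩

/-- The map out of a coproduct given by its components. -/
def sigmaDesc {I : Type u} {X : I → SSet.{u}} {Y : SSet.{u}} (f : ∀ i, X i ⟶ Y) :
    sigmaSSet X ⟶ Y where
  app m := ↾fun x => (f x.1).app m x.2
  naturality m m' s := by
    ext x
    exact ConcreteCategory.congr_hom ((f x.1).naturality s) x.2

/-- The map of coproducts given by a family of maps. -/
def sigmaMap {I : Type u} {X Y : I → SSet.{u}} (f : ∀ i, X i ⟶ Y i) :
    sigmaSSet X ⟶ sigmaSSet Y :=
  sigmaDesc fun i => f i ≫ sigmaIncl Y i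

theorem homotopic_sigma {I : Type u} {X : I → SSet.{u}} {Y : SSet.{u}} {f g : sigmaSSet X ⟶ Y}
    (h : ∀ i, Homotopic (sigmaIncl X i ≫ f) (sigmaIncl X i ≫ g)) : Homotopic f g := by
  choose h h0 h1 using h
  let H : sigmaSSet X ⊗ Δ[1] ⟶ Y :=
    { app := fun m => ↾fun x => (h x.1.1).app m ⟨x.1.2, x.2⟩
      naturality := fun m m' s => by
        ext x
        exact ConcreteCategory.congr_hom ((h x.1.1).naturality s)
          (show (X x.1.1).obj m × (Δ[1] : SSet.{u}).obj m from ⟨x.1.2, x.2⟩) }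
  refine ⟨H, ?_, ?_⟩
  · ext m x
    exact ConcreteCategory.congr_hom (NatTrans.congr_app (h0 x.1) m) x.2
  · ext m x
    exact ConcreteCategory.congr_hom (NatTrans.congr_app (h1 x.1) m) x.2

theorem IsWeakEquivalence.sigmaMap {I : Type u} {X Y : I → SSet.{u}} {f : ∀ i, X i ⟶ Y i}
    (hf : ∀ i, IsWeakEquivalence (f i)) : IsWeakEquivalence (sigmaMap f) := by
  rw [isWeakEquivalence_iff]
  intro K hK
  have hf' := fun i => (isWeakEquivalence_iff _).1 (hf i) K hK
  constructor
  · intro u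
    choose v hv using fun i => (hf' i).1 (sigmaIncl X i ≫ u)
    exact ⟨sigmaDesc v, homotopic_sigma hv⟩
  · intro v v' h
    exact homotopic_sigma fun i => (hf' i).2 _ _ (h.precomp (sigmaIncl X i))

end

section

open HomotopicalAlgebra CartesianMonoidalCategory SSet.modelCategoryQuillen

/-! ### Lifting homotopies -/

/-- Homotopy extension and lifting: a homotopy `k` in the base of a Kan fibration, lifted over one
end of the cylinder and over a subobject, lifts. The face `δ j` is the end of the cylinder over which
`a` is given. -/
theorem exists_lift_homotopy {A X E F : SSet.{u}} (i : A ⟶ X) [Mono i] (p : E ⟶ F) [Fibration p]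
    (j : Fin 2) (a : X ⊗ Δ[0] ⟶ E) (k : X ⊗ Δ[1] ⟶ F) (l : A ⊗ Δ[1] ⟶ E)
    (hk : X ◁ SSet.stdSimplex.δ j ≫ k = a ≫ p)
    (hl : A ◁ SSet.stdSimplex.δ j ≫ l = i ▷ _ ≫ a) (hlk : l ≫ p = i ▷ _ ≫ k) :
    ∃ L : X ⊗ Δ[1] ⟶ E, X ◁ SSet.stdSimplex.δ j ≫ L = a ∧ i ▷ _ ≫ L = l ∧ L ≫ p = k := by
  let sq := Functor.PullbackObjObj.ofHasPullback MonoidalClosed.internalHom i p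
  let π : (ihom X).obj E ⟶ sq.pt := sq.π
  have hπ : Fibration π := SSet.fibration_pullbackObjObjπ sq
  have hπ1 : π ≫ sq.fst = (MonoidalClosed.pre i).app E := sq.π_fst
  have hπ2 : π ≫ sq.snd = (ihom X).map p := sq.π_snd
  -- The lifting problem is one for the pullback-power map `π` and an endpoint of `Δ[1]`.
  let b : Δ[1] ⟶ sq.pt := sq.isPullback.lift (MonoidalClosed.curry l) (MonoidalClosed.curry k) (by
    have h1 := MonoidalClosed.curry_natural_right l p
    have h2 := MonoidalClosed.curry_pre_app i k
    rw [hlk] at h1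
    exact h1.symm.trans h2.symm)
  have hb1 : b ≫ sq.fst = MonoidalClosed.curry l := sq.isPullback.lift_fst _ _ _
  have hb2 : b ≫ sq.snd = MonoidalClosed.curry k := sq.isPullback.lift_snd _ _ _
  have key : ∃ j' : Fin 2, j' ≠ j ∧ ∀ j'', j'' ≠ j' → j'' = j := by
    clear hk hl; revert j; decide
  obtain ⟨j', hj', hj''⟩ := key
  let f : ∀ (j : Fin 2) (_ : j ≠ j'), Δ[0] ⟶ (ihom X).obj E := fun _ _ => MonoidalClosed.curry a
  have hf : SSet.horn.IsCompatible f := trivial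
  obtain ⟨φ, h1, h2⟩ := hf.exists_lift π b (by
    intro j0 hj0
    obtain rfl := hj'' j0 hj0
    apply sq.hom_ext
    · have e1 := MonoidalClosed.curry_natural_left (SSet.stdSimplex.δ j0) l
      rw [hl, ← hb1, ← MonoidalClosed.curry_pre_app, ← hπ1] at e1
      exact e1
    · have e1 := MonoidalClosed.curry_natural_left (SSet.stdSimplex.δ j0) k
      rw [hk, ← hb2, MonoidalClosed.curry_natural_right, ← hπ2] at e1
      exact e1)
  refine ⟨MonoidalClosed.uncurry φ, ?_, ?_, ?_⟩
  · rw [← MonoidalClosed.uncurry_natural_left, h1 j hj'.symm]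
    exact MonoidalClosed.uncurry_curry a
  · have h3 : φ ≫ (MonoidalClosed.pre i).app E = MonoidalClosed.curry l := by
      rw [← hb1, ← h2, Category.assoc, hπ1]
      rfl
    rw [← MonoidalClosed.uncurry_pre_app, h3, MonoidalClosed.uncurry_curry]
  · have h3 : φ ≫ (ihom X).map p = MonoidalClosed.curry k := by
      rw [← hb2, ← h2, Category.assoc, hπ2]
      rfl
    rw [← MonoidalClosed.uncurry_natural_right, h3, MonoidalClosed.uncurry_curry]

/-- Homotopy extension and lifting from the start of a homotopy. -/
theorem exists_lift_homotopy₀ {A X E F : SSet.{u}} (i : A ⟶ X) [Mono i] (p : E ⟶ F) [Fibration p]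
    (a : X ⟶ E) (k : X ⊗ Δ[1] ⟶ F) (l : A ⊗ Δ[1] ⟶ E)
    (hk : SSet.ι₀ ≫ k = a ≫ p) (hl : SSet.ι₀ ≫ l = i ≫ a) (hlk : l ≫ p = i ▷ _ ≫ k) :
    ∃ L : X ⊗ Δ[1] ⟶ E, SSet.ι₀ ≫ L = a ∧ i ▷ _ ≫ L = l ∧ L ≫ p = k := by
  rw [ι₀_eq, Category.assoc] at hk hl
  obtain ⟨L, h1, h2⟩ := exists_lift_homotopy i p 1 (CartesianMonoidalCategory.fst _ _ ≫ a) k l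
    (by
      rw [Category.assoc, ← hk, ← Category.assoc (CartesianMonoidalCategory.fst X Δ[0]),
        fst_lift_from, Category.id_comp])
    (by
      rw [whiskerRight_fst_assoc, ← hl, ← Category.assoc (CartesianMonoidalCategory.fst A Δ[0]),
        fst_lift_from, Category.id_comp]) hlk
  exact ⟨L, by rw [ι₀_eq, Category.assoc, h1]; simp, h2⟩

/-- Homotopy lifting, the case of the empty subobject. -/
theorem exists_lift_homotopy_end {X E F : SSet.{u}} (p : E ⟶ F) [Fibration p]
    (a : X ⟶ E) (k : X ⊗ Δ[1] ⟶ F) (hk : SSet.ι₀ ≫ k = a ≫ p) :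
    ∃ L : X ⊗ Δ[1] ⟶ E, SSet.ι₀ ≫ L = a ∧ L ≫ p = k := by
  let l : ((⊥ : X.Subcomplex) : SSet.{u}) ⊗ Δ[1] ⟶ E :=
    CartesianMonoidalCategory.fst _ _ ≫ SSet.Subcomplex.isInitialBot.to _
  have key : ∀ {Z : SSet.{u}} (f g : ((⊥ : X.Subcomplex) : SSet.{u}) ⊗ Δ[1] ⟶ Z), f = g := by
    intro Z f g
    ext _ ⟨⟨x, hx⟩, _⟩
    exact hx.elim
  obtain ⟨L, h1, -, h2⟩ := exists_lift_homotopy₀ (⊥ : X.Subcomplex).ι p a k l hk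
    (SSet.Subcomplex.isInitialBot.hom_ext _ _) (key _ _)
  exact ⟨L, h1, h2⟩

/-- A Kan fibration between Kan complexes which is a homotopy equivalence is a fibrewise
deformation retraction onto a section. -/
theorem exists_section_of_homotopyEquivalence {E F : SSet.{u}} [E.KanComplex] [F.KanComplex]
    (p : E ⟶ F) [Fibration p] (s : F ⟶ E) (h1 : Homotopic (s ≫ p) (𝟙 F))
    (h2 : Homotopic (p ≫ s) (𝟙 E)) :
    ∃ (s : F ⟶ E) (h : E ⊗ Δ[1] ⟶ E), s ≫ p = 𝟙 F ∧ SSet.ι₀ ≫ h = 𝟙 E ∧ SSet.ι₁ ≫ h = p ≫ s ∧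
      h ≫ p = CartesianMonoidalCategory.fst _ _ ≫ p := by
  obtain ⟨k, hk0, hk1⟩ := h1
  obtain ⟨k', hk'0, hk'1⟩ := exists_lift_homotopy_end p s k hk0
  -- Correct `s` to a strict section.
  let s' := SSet.ι₁ ≫ k'
  have hs' : s' ≫ p = 𝟙 F := by
    simp only [s', Category.assoc, hk'1, hk1]
  have h3 : Homotopic (𝟙 E) (p ≫ s') :=
    h2.symm.trans (Homotopic.precomp p ⟨k', hk'0, rfl⟩)
  obtain ⟨H, hH0, hH1⟩ := h3
  have e0 : (SSet.stdSimplex.δ 0 : (Δ[1] : SSet.{u}) ⟶ Δ[2]) ≫ SSet.stdSimplex.σ 0 = 𝟙 _ :=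
    CosimplicialObject.δ_comp_σ_self (X := SSet.stdSimplex.{u}) (n := 1) (i := 0)
  have e1 : (SSet.stdSimplex.δ 1 : (Δ[1] : SSet.{u}) ⟶ Δ[2]) ≫ SSet.stdSimplex.σ 0 = 𝟙 _ :=
    CosimplicialObject.δ_comp_σ_succ (X := SSet.stdSimplex.{u}) (n := 1) (i := 0)
  have e2 : (SSet.stdSimplex.δ 2 : (Δ[1] : SSet.{u}) ⟶ Δ[2]) ≫ SSet.stdSimplex.σ 0 =
      (SSet.stdSimplex.σ 0 : (Δ[1] : SSet.{u}) ⟶ Δ[0]) ≫ SSet.stdSimplex.δ 1 :=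
    CosimplicialObject.δ_comp_σ_of_gt (X := SSet.stdSimplex.{u}) (n := 0) (i := 1) (j := 0)
      (by simp)
  have e3 : E ◁ (SSet.stdSimplex.σ 0 : (Δ[1] : SSet.{u}) ⟶ Δ[0]) =
      CartesianMonoidalCategory.fst _ _ ≫
        CartesianMonoidalCategory.lift (𝟙 E) (SSet.stdSimplex.isTerminalObj₀.from E) := by
    ext : 1
    · simp
    · exact SSet.stdSimplex.isTerminalObj₀.hom_ext _ _
  have e4 : E ◁ ((SSet.stdSimplex.δ 2 : (Δ[1] : SSet.{u}) ⟶ Δ[2]) ≫ SSet.stdSimplex.σ 0) =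
      fst _ _ ≫ SSet.ι₀ := by
    rw [e2, whiskerLeft_comp, e3, ι₀_eq]
    exact Category.assoc _ _ _
  -- Compose `H` with the inverse of its image under `p ≫ s'` to make it a homotopy over `F`.
  obtain ⟨h, a0, a1, a2⟩ := exists_fill p H (H ≫ p ≫ s')
    (by rw [← Category.assoc SSet.ι₁ H, hH1, Category.assoc, ← Category.assoc s', hs',
      Category.id_comp])
    (E ◁ SSet.stdSimplex.σ 0 ≫ H ≫ p)
    (by
      rw [← whiskerLeft_comp_assoc, e1, whiskerLeft_id, Category.id_comp])
    (by
      rw [← whiskerLeft_comp_assoc, e0, whiskerLeft_id, Category.id_comp, Category.assoc,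
        Category.assoc, hs', Category.comp_id])
  refine ⟨s', h, hs', a0.trans hH0, ?_, ?_⟩
  · rw [a1, ← Category.assoc, hH0, Category.id_comp]
  · rw [a2, ← whiskerLeft_comp_assoc, e4, Category.assoc, ← Category.assoc SSet.ι₀ H p, hH0,
      Category.id_comp]

/-! ### Trivial cofibrations -/

/-- Maps into Kan complexes extend strictly along monic weak equivalences. -/
theorem IsWeakEquivalence.exists_extension {A B K : SSet.{u}} {i : A ⟶ B} [Mono i]
    (hi : IsWeakEquivalence i) [K.KanComplex] (f : A ⟶ K) : ∃ g : B ⟶ K, i ≫ g = f := by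
  obtain ⟨v, h, h0, h1⟩ := ((isWeakEquivalence_iff _).1 hi K inferInstance).1 f
  obtain ⟨L, -, hL, -⟩ := exists_lift_homotopy₀ i (terminal.from K) v (terminal.from _) h
    (by simp) h0 (by simp)
  refine ⟨SSet.ι₁ ≫ L, ?_⟩
  rw [← SSet.ι₁_comp_assoc, hL, h1]

/-- Restriction along a monic weak equivalence is a homotopy equivalence of mapping spaces into
a Kan complex, by the Yoneda lemma in the homotopy category. -/
theorem IsWeakEquivalence.exists_homotopyInverse_pre {A B : SSet.{u}} {i : A ⟶ B}
    (hi : IsWeakEquivalence i) (K : SSet.{u}) [K.KanComplex] :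
    ∃ s : (ihom A).obj K ⟶ (ihom B).obj K,
      Homotopic (s ≫ (MonoidalClosed.pre i).app K) (𝟙 _) ∧
      Homotopic ((MonoidalClosed.pre i).app K ≫ s) (𝟙 _) := by
  have key := fun Z => (isWeakEquivalence_iff _).1 (hi.whiskerRight Z) K inferInstance
  obtain ⟨v, hv⟩ := (key ((ihom A).obj K)).1 (MonoidalClosed.uncurry (𝟙 _))
  have h1 : Homotopic (MonoidalClosed.curry v ≫ (MonoidalClosed.pre i).app K) (𝟙 _) := by
    rw [MonoidalClosed.curry_pre_app]
    have := (homotopic_curry_iff _ _).2 hv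
    rwa [MonoidalClosed.curry_uncurry] at this
  refine ⟨MonoidalClosed.curry v, h1, ?_⟩
  have h2 := (key ((ihom B).obj K)).2
    (MonoidalClosed.uncurry ((MonoidalClosed.pre i).app K ≫ MonoidalClosed.curry v))
    (MonoidalClosed.uncurry (𝟙 _)) (by
      rw [← MonoidalClosed.uncurry_pre_app, ← MonoidalClosed.uncurry_pre_app,
        ← homotopic_curry_iff, MonoidalClosed.curry_uncurry, MonoidalClosed.curry_uncurry,
        Category.id_comp, Category.assoc]
      simpa using h1.precomp ((MonoidalClosed.pre i).app K))
  rw [← homotopic_curry_iff, MonoidalClosed.curry_uncurry, MonoidalClosed.curry_uncurry] at h2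
  exact h2

/-- Two maps into a Kan complex which agree on the source of a monic weak equivalence are homotopic
relative to it: restriction is a deformation retraction of mapping spaces, along its fibres. -/
theorem IsWeakEquivalence.exists_homotopy_rel {A B K : SSet.{u}} {i : A ⟶ B} [Mono i]
    (hi : IsWeakEquivalence i) [K.KanComplex] (f g : B ⟶ K) (hfg : i ≫ f = i ≫ g) :
    ∃ h : B ⊗ Δ[1] ⟶ K, SSet.ι₀ ≫ h = f ∧ SSet.ι₁ ≫ h = g ∧
      i ▷ _ ≫ h = fst _ _ ≫ i ≫ f := by
  obtain ⟨s, hs1, hs2⟩ := hi.exists_homotopyInverse_pre K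
  obtain ⟨s, h, hs, h0, h1, h2⟩ :=
    exists_section_of_homotopyEquivalence ((MonoidalClosed.pre i).app K) s hs1 hs2
  let f' := MonoidalClosed.curry (fst B (𝟙_ _) ≫ f)
  let g' := MonoidalClosed.curry (fst B (𝟙_ _) ≫ g)
  have hf' : f' ≫ (MonoidalClosed.pre i).app K = MonoidalClosed.curry (fst _ _ ≫ i ≫ f) := by
    simp only [f', MonoidalClosed.curry_pre_app, whiskerRight_fst_assoc]
  have hg' : g' ≫ (MonoidalClosed.pre i).app K = MonoidalClosed.curry (fst _ _ ≫ i ≫ f) := by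
    simp only [g', MonoidalClosed.curry_pre_app, whiskerRight_fst_assoc, hfg]
  -- Both `f'` and `g'` are joined, fibrewise, to the value of the section on their common image.
  obtain ⟨H, H0, H1, H2⟩ := exists_fill ((MonoidalClosed.pre i).app K) (f' ▷ _ ≫ h) (g' ▷ _ ≫ h)
    (by
      rw [SSet.ι₁_comp_assoc, SSet.ι₁_comp_assoc, h1, ← Category.assoc f', ← Category.assoc g',
        hf', hg'])
    (fst _ _ ≫ MonoidalClosed.curry (fst _ _ ≫ i ≫ f))
    (by rw [Category.assoc, h2, whiskerRight_fst_assoc, hf', whiskerLeft_fst_assoc])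
    (by rw [Category.assoc, h2, whiskerRight_fst_assoc, hg', whiskerLeft_fst_assoc])
  rw [SSet.ι₀_comp_assoc, h0, Category.comp_id] at H0 H1
  have r0 : (SSet.ι₀ : B ⟶ _) ≫ B ◁ (λ_ Δ[1]).inv = (ρ_ B).inv ≫ B ◁ SSet.ι₀ := rfl
  have r1 : (SSet.ι₁ : B ⟶ _) ≫ B ◁ (λ_ Δ[1]).inv = (ρ_ B).inv ≫ B ◁ SSet.ι₁ := rfl
  refine ⟨B ◁ (λ_ _).inv ≫ MonoidalClosed.uncurry H, ?_, ?_, ?_⟩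
  · rw [← Category.assoc, r0, Category.assoc, ← MonoidalClosed.uncurry_natural_left, H0,
      MonoidalClosed.uncurry_curry, rightUnitor_inv_fst_assoc]
  · rw [← Category.assoc, r1, Category.assoc, ← MonoidalClosed.uncurry_natural_left, H1,
      MonoidalClosed.uncurry_curry, rightUnitor_inv_fst_assoc]
  · rw [← whisker_exchange_assoc, ← MonoidalClosed.uncurry_pre_app, H2, whiskerLeft_fst_assoc,
      ← MonoidalClosed.curry_natural_left, MonoidalClosed.uncurry_curry, whiskerLeft_fst_assoc,
      whiskerLeft_fst_assoc]

/-- Kan fibrations between Kan complexes. -/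
def kanFibrations : MorphismProperty SSet.{u} :=
  fun E F p => Fibration p ∧ E.KanComplex ∧ F.KanComplex

/-- Maps with the left lifting property against Kan fibrations between Kan complexes. Among the
monomorphisms these are exactly the weak equivalences. -/
def trivialCofibrations : MorphismProperty SSet.{u} := kanFibrations.llp

/-- A monic weak equivalence lifts against Kan fibrations between Kan complexes: extend the top map,
correct the extension by a relative homotopy in the base, and lift that homotopy. -/
theorem IsWeakEquivalence.trivialCofibrations {A B : SSet.{u}} {i : A ⟶ B} [Mono i]
    (hi : IsWeakEquivalence i) : trivialCofibrations i := by
  rintro E F p ⟨hp, hE, hF⟩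
  constructor
  intro a b sq
  obtain ⟨w, hw⟩ := hi.exists_extension a
  obtain ⟨h, h0, h1, h2⟩ := hi.exists_homotopy_rel (w ≫ p) b
    (by rw [← Category.assoc, hw, sq.w])
  obtain ⟨L, L0, L1, L2⟩ := exists_lift_homotopy₀ i p w h (fst _ _ ≫ a) h0
    (by rw [hw]; simp) (by rw [h2, ← Category.assoc i, hw, Category.assoc])
  refine ⟨⟨⟨SSet.ι₁ ≫ L, ?_, ?_⟩⟩⟩
  · rw [← SSet.ι₁_comp_assoc, L1]
    simp
  · rw [Category.assoc, L2, h1]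

/-- The pullback-power of a Kan fibration between Kan complexes by a monomorphism. -/
theorem kanFibrations_pullbackObjObjπ {X Y E F : SSet.{u}} {i : X ⟶ Y} {p : E ⟶ F} [Mono i]
    (hp : kanFibrations p) (sq : MonoidalClosed.internalHom.PullbackObjObj i p) :
    kanFibrations sq.π := by
  obtain ⟨hp, hE, hF⟩ := hp
  have h1 : (fibrations SSet.{u}) ((ihom X).map p) :=
    (HomotopicalAlgebra.fibration_iff _).1 inferInstance
  have h2 : (fibrations SSet.{u}) sq.snd := by
    rw [fibrations_eq] at h1 ⊢
    exact MorphismProperty.of_isPullback sq.isPullback h1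
  have h3 : Fibration sq.snd := (HomotopicalAlgebra.fibration_iff _).2 h2
  have h4 : ((MonoidalClosed.internalHom.obj (op Y)).obj F).KanComplex :=
    inferInstanceAs ((ihom Y).obj F).KanComplex
  exact ⟨SSet.fibration_pullbackObjObjπ sq, inferInstanceAs ((ihom Y).obj E).KanComplex,
    isFibrant_of_fibration sq.snd⟩

/-- Pushout-products of a monomorphism with a trivial cofibration. -/
theorem trivialCofibrations_pushoutObjObjι {X₁ X₂ Y₁ Y₂ : SSet.{u}} {i : X₁ ⟶ Y₁} {j : X₂ ⟶ Y₂}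
    (sq : (curriedTensor _).PushoutObjObj i j) [Mono i] (hj : trivialCofibrations j) :
    trivialCofibrations sq.ι := by
  intro E B p hp
  let sq' := Functor.PullbackObjObj.ofHasPullback MonoidalClosed.internalHom i p
  rw [MonoidalClosed.internalHomAdjunction₂.hasLiftingProperty_iff _ sq']
  exact hj _ (kanFibrations_pullbackObjObjπ hp sq')

theorem trivialCofibrations_pushoutObjObjι' {X₁ X₂ Y₁ Y₂ : SSet.{u}} {i : X₁ ⟶ Y₁} {j : X₂ ⟶ Y₂}
    (sq : (curriedTensor _).PushoutObjObj i j) [Mono j] (hi : trivialCofibrations i) :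
    trivialCofibrations sq.ι := by
  intro E B p hp
  rw [HasLiftingProperty.iff_of_arrow_iso_left
    (show Arrow.mk sq.ι ≅ Arrow.mk sq.flipTensor.ι from Arrow.isoMk (Iso.refl _) (β_ _ _))]
  exact trivialCofibrations_pushoutObjObjι sq.flipTensor hi _ hp

theorem kanComplex_terminal : (⊤_ SSet.{u}).KanComplex := by
  have : IsIso (terminal.from (⊤_ SSet.{u})) :=
    isIso_of_isTerminal terminalIsTerminal terminalIsTerminal _
  infer_instance

theorem kanFibrations_terminal_from (K : SSet.{u}) [hK : K.KanComplex] :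
    kanFibrations (terminal.from K) :=
  ⟨inferInstance, hK, kanComplex_terminal⟩

/-- A simplex of the boundary of `Δ[1]` is constant. -/
theorem boundary_one_apply {m : SimplexCategoryᵒᵖ} {t : (Δ[1] : SSet.{u}).obj m}
    (ht : t ∈ (∂Δ[1] : SSet.Subcomplex _).obj m) (j j' : Fin (m.unop.len + 1)) :
    (SSet.stdSimplex.objEquiv t).toOrderHom j = (SSet.stdSimplex.objEquiv t).toOrderHom j' := by
  by_contra h
  refine ht fun y => ?_
  have : y = (SSet.stdSimplex.objEquiv t).toOrderHom j ∨
      y = (SSet.stdSimplex.objEquiv t).toOrderHom j' := by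
    generalize (SSet.stdSimplex.objEquiv t).toOrderHom j = a at h
    generalize (SSet.stdSimplex.objEquiv t).toOrderHom j' = b at h
    change Fin 2 at a b y
    omega
  obtain h | h := this
  · exact ⟨j, h.symm⟩
  · exact ⟨j', h.symm⟩

/-- The map out of `B ⊗ ∂Δ[1]` given by a pair of maps out of `B`. -/
def boundaryDesc {B K : SSet.{u}} (v v' : B ⟶ K) :
    B ⊗ ((∂Δ[1] : SSet.Subcomplex _) : SSet.{u}) ⟶ K where
  app m := ↾fun x => if (SSet.stdSimplex.objEquiv x.2.1).toOrderHom 0 = 0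
    then v.app m x.1 else v'.app m x.1
  naturality m m' s := by
    refine ConcreteCategory.hom_ext _ _ fun x => ?_
    have h : (SSet.stdSimplex.objEquiv ((Δ[1] : SSet.{u}).map s x.2.1)).toOrderHom 0 =
      (SSet.stdSimplex.objEquiv x.2.1).toOrderHom 0 := boundary_one_apply x.2.2 _ _
    change (if (SSet.stdSimplex.objEquiv ((Δ[1] : SSet.{u}).map s x.2.1)).toOrderHom 0 = 0
      then v.app m' (B.map s x.1) else v'.app m' (B.map s x.1)) =
      K.map s (if (SSet.stdSimplex.objEquiv x.2.1).toOrderHom 0 = 0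
        then v.app m x.1 else v'.app m x.1)
    rw [h]
    split_ifs
    · exact ConcreteCategory.congr_hom (v.naturality s) x.1
    · exact ConcreteCategory.congr_hom (v'.naturality s) x.1

/-- The lifting property against `K ⟶ *` gives surjectivity on homotopy classes. Injectivity is the
same for the pushout-product with the boundary of `Δ[1]`. -/
theorem isWeakEquivalence_of_trivialCofibrations {A B : SSet.{u}} {i : A ⟶ B}
    (hi : trivialCofibrations i) : IsWeakEquivalence i := by
  rw [isWeakEquivalence_iff]
  intro K hK
  have hK' : kanFibrations (terminal.from K) := kanFibrations_terminal_from K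
  constructor
  · intro a
    have := hi _ hK'
    have sq : CommSq a i (terminal.from K) (terminal.from B) := ⟨by simp⟩
    exact ⟨sq.lift, by rw [sq.fac_left]; exact .refl _⟩
  · rintro v v' ⟨k, h0, h1⟩
    let po := Functor.PushoutObjObj.ofHasPushout (curriedTensor SSet) i (∂Δ[1] : SSet.Subcomplex _).ι
    have := trivialCofibrations_pushoutObjObjι' po hi _ hK'
    let a : po.pt ⟶ K := po.isPushout.desc (boundaryDesc v v') k (by
      refine NatTrans.ext (funext fun m => ConcreteCategory.hom_ext _ _ fun x => ?_)
      obtain ⟨x, t⟩ := x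
      change (if (SSet.stdSimplex.objEquiv t.1).toOrderHom 0 = 0
        then v.app m (i.app m x) else v'.app m (i.app m x)) = k.app m (x, t.1)
      split_ifs with h
      · refine (ConcreteCategory.congr_hom (NatTrans.congr_app h0 m) x).symm.trans ?_
        refine congrArg (k.app m) (Prod.ext rfl ?_)
        refine SSet.stdSimplex.objEquiv.injective ?_
        ext j : 3
        rw [boundary_one_apply t.2 j 0, h]
        rfl
      · refine (ConcreteCategory.congr_hom (NatTrans.congr_app h1 m) x).symm.trans ?_
        refine congrArg (k.app m) (Prod.ext rfl ?_)
        refine SSet.stdSimplex.objEquiv.injective ?_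
        ext j : 3
        rw [boundary_one_apply t.2 j 0]
        refine Eq.symm (?_ : _ = (1 : Fin 2))
        generalize (SSet.stdSimplex.objEquiv t.1).toOrderHom 0 = c at h
        change Fin 2 at c
        change ¬ (c = (0 : Fin 2)) at h
        omega)
    have sq : CommSq a po.ι (terminal.from K) (terminal.from _) := ⟨by simp⟩
    have e : B ◁ (∂Δ[1] : SSet.Subcomplex _).ι ≫ sq.lift = boundaryDesc v v' := by
      have h1 : po.inl ≫ po.ι = B ◁ (∂Δ[1] : SSet.Subcomplex _).ι := po.inl_ι
      rw [← h1, Category.assoc, sq.fac_left]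
      exact po.isPushout.inl_desc _ _ _
    have hb : ∀ (j : Fin 2) (m : SimplexCategoryᵒᵖ),
        SSet.stdSimplex.const 1 j m ∈ (∂Δ[1] : SSet.Subcomplex.{u} _).obj m := by
      intro j m hs
      obtain ⟨_, h0⟩ := hs 0
      obtain ⟨_, h1⟩ := hs 1
      exact absurd (h0.symm.trans h1 : (0 : Fin 2) = 1) (by decide)
    refine ⟨sq.lift, ?_, ?_⟩
    · refine NatTrans.ext (funext fun m => ConcreteCategory.hom_ext _ _ fun x => ?_)
      exact ConcreteCategory.congr_hom (NatTrans.congr_app e m)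
        (show B.obj m × ((∂Δ[1] : SSet.Subcomplex.{u} _) : SSet.{u}).obj m from
          ⟨x, ⟨_, hb 0 m⟩⟩)
    · refine NatTrans.ext (funext fun m => ConcreteCategory.hom_ext _ _ fun x => ?_)
      exact ConcreteCategory.congr_hom (NatTrans.congr_app e m)
        (show B.obj m × ((∂Δ[1] : SSet.Subcomplex.{u} _) : SSet.{u}).obj m from
          ⟨x, ⟨_, hb 1 m⟩⟩)

end

section

open HomotopicalAlgebra CartesianMonoidalCategory SSet.modelCategoryQuillen

/-! ### The realization lemma for monomorphisms -/

/-- If `g : Y ⟶ X` is injective away from the preimage of a subcomplex `S`, then `S ⊔ range g` is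
obtained from `S` by attaching `Y` along that preimage. -/
theorem isPushout_sup_range {X Y : SSet.{u}} (g : Y ⟶ X) (S : X.Subcomplex)
    (hg : ∀ (m : SimplexCategoryᵒᵖ) (y y' : Y.obj m), y ∉ (S.preimage g).obj m →
      y' ∉ (S.preimage g).obj m → g.app m y = g.app m y' → y = y') :
    IsPushout (S.fromPreimage g) (S.preimage g).ι
      (SSet.Subcomplex.homOfLE (le_sup_left : S ≤ S ⊔ SSet.Subcomplex.range g))
      (SSet.Subcomplex.lift (B := S ⊔ SSet.Subcomplex.range g) g le_sup_right) where
  w := rfl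
  isColimit' := ⟨evaluationJointlyReflectsColimits _ (fun m ↦ by
    refine (isColimitMapCoconePushoutCoconeEquiv _ _).2 (IsPushout.isColimit ?_)
    refine Types.isPushout_of_isPullback_of_mono' ?_ ?_ ?_
    · rw [Types.isPullback_iff]
      refine ⟨rfl, fun x y h => Subtype.ext h.2, fun x y h => ?_⟩
      have h' : x.1 = g.app m y := congrArg Subtype.val h
      exact ⟨⟨y, show g.app m y ∈ S.obj m from h' ▸ x.2⟩, Subtype.ext h'.symm, rfl⟩
    · refine Set.eq_univ_of_forall fun x => ?_
      obtain ⟨x, hx | ⟨y, rfl⟩⟩ := x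
      · exact Or.inl ⟨⟨x, hx⟩, rfl⟩
      · exact Or.inr ⟨y, rfl⟩
    · intro y y' hy hy' h
      refine hg m y y' (fun hy0 => hy ⟨⟨y, hy0⟩, rfl⟩) (fun hy0 => hy' ⟨⟨y', hy0⟩, rfl⟩)
        (congrArg Subtype.val h))⟩

theorem trivialCofibrations_sup_range {X Y : SSet.{u}} (g : Y ⟶ X) (S T : X.Subcomplex)
    (hT : T = S ⊔ SSet.Subcomplex.range g) (hST : S ≤ T)
    (hg : ∀ (m : SimplexCategoryᵒᵖ) (y y' : Y.obj m), y ∉ (S.preimage g).obj m →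
      y' ∉ (S.preimage g).obj m → g.app m y = g.app m y' → y = y')
    (h : trivialCofibrations (S.preimage g).ι) :
    trivialCofibrations (SSet.Subcomplex.homOfLE hST) := by
  subst hT
  exact MorphismProperty.of_isPushout (P := kanFibrations.llp) (isPushout_sup_range g S hg) h

theorem trivialCofibrations_homOfLE_of_eq {X : SSet.{u}} {S T : X.Subcomplex} (h : S = T)
    (hST : S ≤ T) : trivialCofibrations (SSet.Subcomplex.homOfLE hST) := by
  subst h
  exact MorphismProperty.id_mem kanFibrations.llp _

theorem trivialCofibrations_of_comp_left {X Y Z : SSet.{u}} {f : X ⟶ Y} {g : Y ⟶ Z} [Mono g]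
    (hf : trivialCofibrations f) (hfg : trivialCofibrations (f ≫ g)) : trivialCofibrations g :=
  ((isWeakEquivalence_of_trivialCofibrations hf).of_comp_left
    (isWeakEquivalence_of_trivialCofibrations hfg)).trivialCofibrations

section Realization

variable (B : SimplexCategoryᵒᵖ ⥤ SSet.{u}) (A : ∀ n, (B.obj n).Subcomplex)

/-- For a sub-bisimplicial set `A` of `B`, the subcomplex of `B n` generated by `A n` and by the
images of the first `k` degeneracies `B (n - 1) ⟶ B n`. -/
def partialLatching (n k : ℕ) : (B.obj (op ⦋n⦌)).Subcomplex :=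
  match n with
  | 0 => A (op ⦋0⦌)
  | n + 1 => A (op ⦋n + 1⦌) ⊔ ⨆ (i : Fin (n + 1)) (_ : i.val < k),
      SSet.Subcomplex.range (B.map (SimplexCategory.σ i).op)

theorem mem_partialLatching_succ {n k : ℕ} {m : SimplexCategoryᵒᵖ}
    (x : (B.obj (op ⦋n + 1⦌)).obj m) :
    x ∈ (partialLatching B A (n + 1) k).obj m ↔ x ∈ (A _).obj m ∨ ∃ i : Fin (n + 1), i.val < k ∧
      ∃ z, (B.map (SimplexCategory.σ i).op).app m z = x := by
  simp [partialLatching]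

theorem le_partialLatching (n k : ℕ) : A (op ⦋n⦌) ≤ partialLatching B A n k := by
  cases n with
  | zero => exact le_rfl
  | succ n => exact le_sup_left

theorem partialLatching_succ_succ (n : ℕ) (k : Fin (n + 1)) :
    partialLatching B A (n + 1) (k + 1) =
      partialLatching B A (n + 1) k ⊔
        SSet.Subcomplex.range (B.map (SimplexCategory.σ k).op) := by
  ext m x
  refine (mem_partialLatching_succ B A x).trans (Iff.trans ?_
    (or_congr (mem_partialLatching_succ B A x).symm Iff.rfl))
  rw [or_assoc]
  refine or_congr Iff.rfl ⟨?_, ?_⟩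
  · rintro ⟨i, hi, z, hz⟩
    obtain h | h := Nat.lt_succ_iff_lt_or_eq.1 hi
    · exact Or.inl ⟨i, h, z, hz⟩
    · obtain rfl := Fin.ext h
      exact Or.inr ⟨z, hz⟩
  · rintro (⟨i, hi, z, hz⟩ | ⟨z, hz⟩)
    · exact ⟨i, by omega, z, hz⟩
    · exact ⟨k, by omega, z, hz⟩

theorem partialLatching_of_le (n k : ℕ) (h : n + 1 ≤ k) :
    partialLatching B A (n + 1) (k + 1) = partialLatching B A (n + 1) k := by
  ext m x
  rw [mem_partialLatching_succ, mem_partialLatching_succ]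
  refine or_congr Iff.rfl (exists_congr fun i => and_congr_left fun _ => ?_)
  omega

theorem partialLatching_zero (n : ℕ) : partialLatching B A n 0 = A (op ⦋n⦌) := by
  cases n with
  | zero => rfl
  | succ n =>
    ext m x
    rw [mem_partialLatching_succ]
    simp

variable {B A}

theorem map_comp_app {n n' n'' : SimplexCategory} (θ : n' ⟶ n) (τ : n'' ⟶ n')
    {m : SimplexCategoryᵒᵖ} (x : (B.obj (op n)).obj m) :
    (B.map τ.op).app m ((B.map θ.op).app m x) = (B.map (τ ≫ θ).op).app m x := by
  rw [op_comp, B.map_comp]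
  rfl

theorem map_id_app {n : SimplexCategory} {m : SimplexCategoryᵒᵖ} (x : (B.obj (op n)).obj m) :
    (B.map (𝟙 n).op).app m x = x := by
  rw [op_id, B.map_id]
  rfl

variable (B A) in
/-- The family of subcomplexes `A` is stable under the outer simplicial operators of `B`, i.e. it
is a sub-bisimplicial set. -/
def IsSubBisimplicial : Prop :=
  ∀ ⦃n n' : SimplexCategoryᵒᵖ⦄ (θ : n ⟶ n'), A n ≤ (A n').preimage (B.map θ)

/-- The degeneracy `s_k` is attached to the subcomplex generated by the earlier ones along the same
subcomplex one degree lower, by the simplicial identities. -/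
theorem preimage_partialLatching (hA : IsSubBisimplicial B A) (n : ℕ) (k : Fin (n + 1)) :
    (partialLatching B A (n + 1) k).preimage (B.map (SimplexCategory.σ k).op) =
      partialLatching B A n k := by
  ext m x
  refine (mem_partialLatching_succ B A _).trans ⟨?_, fun hx => ?_⟩
  · rintro (hx | ⟨i, hi, z, hz⟩)
    · refine le_partialLatching B A n k _ ?_
      have : (B.map (SimplexCategory.δ k.castSucc).op).app m
          ((B.map (SimplexCategory.σ k).op).app m x) ∈ (A (op ⦋n⦌)).obj m :=
        hA (SimplexCategory.δ k.castSucc).op _ hx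
      rwa [map_comp_app, SimplexCategory.δ_comp_σ_self, map_id_app] at this
    · have := congrArg ((B.map (SimplexCategory.δ k.succ).op).app m) hz
      rw [map_comp_app, map_comp_app, SimplexCategory.δ_comp_σ_succ, map_id_app] at this
      cases n with
      | zero => omega
      | succ n =>
        have hi' : i.val < n + 1 := by omega
        obtain ⟨j, rfl⟩ : ∃ j : Fin (n + 1), i = j.castSucc := ⟨⟨i, hi'⟩, rfl⟩
        rw [SimplexCategory.δ_comp_σ_of_gt (by exact hi), ← map_comp_app] at this
        exact (mem_partialLatching_succ B A _).2 (Or.inr ⟨j, hi, _, this⟩)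
  · cases n with
    | zero => exact Or.inl (hA (SimplexCategory.σ k).op _ hx)
    | succ n =>
      obtain hx | ⟨i, hi, z, rfl⟩ := (mem_partialLatching_succ B A _).1 hx
      · exact Or.inl (hA (SimplexCategory.σ k).op _ hx)
      · obtain ⟨j, rfl⟩ : ∃ j : Fin (n + 1), k = j.succ :=
          Fin.exists_succ_eq.2 (by rintro rfl; simp at hi) |>.imp fun _ h => h.symm
        refine Or.inr ⟨i.castSucc, hi, (B.map (SimplexCategory.σ j).op).app m z, ?_⟩
        rw [map_comp_app, map_comp_app, SimplexCategory.σ_comp_σ]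
        simp at hi
        exact Fin.le_def.2 (by omega)

/-- If the inclusions `A n ⟶ B n` are trivial cofibrations, so are those of the relative latching
objects: `A n` reaches the subcomplex by attaching degeneracies one at a time, along inclusions known
to be trivial cofibrations in lower degree. -/
theorem trivialCofibrations_partialLatching (hA : IsSubBisimplicial B A)
    (h : ∀ n, trivialCofibrations (A n).ι) (n k : ℕ) :
    trivialCofibrations (partialLatching B A n k).ι := by
  induction n generalizing k with
  | zero => exact h _
  | succ n ih =>
    have key : trivialCofibrations
        (SSet.Subcomplex.homOfLE (le_partialLatching B A (n + 1) k)) := by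
      induction k with
      | zero => exact trivialCofibrations_homOfLE_of_eq (partialLatching_zero B A _).symm _
      | succ k ih2 =>
        by_cases hk : k < n + 1
        · have hs := partialLatching_succ_succ B A n ⟨k, hk⟩
          have hle : partialLatching B A (n + 1) k ≤ partialLatching B A (n + 1) (k + 1) := by
            rw [hs]
            exact le_sup_left
          refine MorphismProperty.comp_mem kanFibrations.llp _ (SSet.Subcomplex.homOfLE hle) ih2
            (trivialCofibrations_sup_range _ _ _ hs hle ?_ ?_)
          · intro m y y' _ _ hy
            have := congrArg ((B.map (SimplexCategory.δ (Fin.castSucc ⟨k, hk⟩)).op).app m) hy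
            rwa [map_comp_app, map_comp_app, SimplexCategory.δ_comp_σ_self, map_id_app,
              map_id_app] at this
          · rw [preimage_partialLatching hA n ⟨k, hk⟩]
            exact ih k
        · have hs := partialLatching_of_le B A n k (by omega)
          exact MorphismProperty.comp_mem kanFibrations.llp _
            (SSet.Subcomplex.homOfLE hs.ge) ih2 (trivialCofibrations_homOfLE_of_eq hs.symm _)
    exact trivialCofibrations_of_comp_left key (h _)

end Realization

end

section

open HomotopicalAlgebra CartesianMonoidalCategory SSet.modelCategoryQuillen

/-! ### The skeletal filtration of the diagonal -/

/-- Trivial cofibrations are closed under composition along an exhaustive sequence of subcomplexes. -/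
theorem trivialCofibrations_iSup {X : SSet.{u}} (S : ℕ →o X.Subcomplex) (hS : ⨆ n, S n = ⊤)
    (h : ∀ n, trivialCofibrations (SSet.Subcomplex.homOfLE (S.monotone (Nat.le_succ n)))) :
    trivialCofibrations (S 0).ι :=
  MorphismProperty.transfiniteCompositionsOfShape_le kanFibrations.llp ℕ _
    ⟨{  F := S.monotone.functor ⋙ SSet.Subcomplex.toSSetFunctor
        isoBot := Iso.refl _
        incl := { app := fun _ => SSet.Subcomplex.ι _ }
        isColimit := IsColimit.ofIsoColimit (isColimitOfPreserves SSet.Subcomplex.toSSetFunctor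
          (CompleteLattice.colimitCocone S.monotone.functor).isColimit)
          (Cocone.ext (SSet.Subcomplex.eqToIso hS ≪≫ SSet.Subcomplex.topIso X))
        fac := Category.id_comp _
        map_mem := fun n _ => h n }⟩

section Skeleton

variable (B : SimplexCategoryᵒᵖ ⥤ SSet.{u}) (A : ∀ n, (B.obj n).Subcomplex)

/-- The relative `n`-skeleton: the subcomplex of the diagonal of `B` of the simplices which lie
in the sub-bisimplicial set `A` or are degenerations, in the outer direction, of simplices of
outer degree `< n`. -/
def diagonalSkeleton (hA : IsSubBisimplicial B A) (n : ℕ) : (diagonal B).Subcomplex where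
  obj m := {x | x ∈ (A m).obj m ∨ ∃ k : ℕ, k < n ∧ ∃ (θ : m.unop ⟶ ⦋k⦌)
    (y : (B.obj (op ⦋k⦌)).obj m), (B.map θ.op).app m y = x}
  map {m m'} s := by
    rintro x (hx | ⟨k, hk, θ, y, rfl⟩)
    · exact Or.inl ((A m').map s (hA s _ hx))
    · refine Or.inr ⟨k, hk, s.unop ≫ θ, (B.obj _).map s y, ?_⟩
      have h1 := ConcreteCategory.congr_hom ((B.map (s.unop ≫ θ).op).naturality s) y
      refine h1.trans (congrArg ((B.obj m').map s) ?_)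
      exact (map_comp_app θ s.unop y).symm

/-- The map attaching the simplices of outer degree `n` of a bisimplicial set to its diagonal. -/
def cellMap (n : ℕ) : Δ[n] ⊗ B.obj (op ⦋n⦌) ⟶ diagonal B where
  app m := ↾fun z => (B.map (SSet.stdSimplex.objEquiv z.1).op).app m z.2
  naturality m m' s := by
    refine ConcreteCategory.hom_ext _ _ fun z => ?_
    have h1 := ConcreteCategory.congr_hom
      ((B.map (s.unop ≫ SSet.stdSimplex.objEquiv z.1).op).naturality s) z.2
    refine h1.trans (congrArg ((B.obj m').map s) ?_)
    exact (map_comp_app (SSet.stdSimplex.objEquiv z.1) s.unop z.2).symm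

variable {B A}

theorem mem_boundary_iff {n : ℕ} {m : SimplexCategoryᵒᵖ} (t : (Δ[n] : SSet.{u}).obj m) :
    t ∈ (∂Δ[n] : SSet.Subcomplex.{u} _).obj m ↔ ¬ Epi (SSet.stdSimplex.objEquiv t) := by
  rw [SimplexCategory.epi_iff_surjective]
  rfl

theorem mem_partialLatching_of_degenerate {n k : ℕ} (hk : k < n) (θ : (⦋n⦌ : SimplexCategory) ⟶ ⦋k⦌)
    {m : SimplexCategoryᵒᵖ} (y : (B.obj (op ⦋k⦌)).obj m) :
    (B.map θ.op).app m y ∈ (partialLatching B A n n).obj m := by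
  cases n with
  | zero => omega
  | succ n =>
    have h : (B.map θ.op).app m y ∈ SSet.degenerate (B.flip.obj m) (n + 1) := ⟨k, hk, θ, y, rfl⟩
    rw [SSet.degenerate_eq_iUnion_range_σ, Set.mem_iUnion] at h
    obtain ⟨i, z, hz⟩ := h
    exact (mem_partialLatching_succ B A _).2 (Or.inr ⟨i, i.2, z, hz⟩)

theorem mem_nonDegenerate_of_notMem {n : ℕ} {m : SimplexCategoryᵒᵖ}
    {y : (B.obj (op ⦋n⦌)).obj m} (hy : y ∉ (partialLatching B A n n).obj m) :
    y ∈ SSet.nonDegenerate (B.flip.obj m) n := by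
  rintro ⟨k, hk, θ, z, rfl⟩
  exact hy (mem_partialLatching_of_degenerate hk θ z)

theorem mem_unionProd_boundary_iff {n : ℕ} {Y : SSet.{u}} (T : Y.Subcomplex)
    {m : SimplexCategoryᵒᵖ} (t : (Δ[n] : SSet.{u}).obj m) (y : Y.obj m) :
    (show (Δ[n] ⊗ Y : SSet.{u}).obj m from (t, y)) ∈ (∂Δ[n].unionProd T).obj m ↔
      y ∈ T.obj m ∨ ¬ Epi (SSet.stdSimplex.objEquiv t) :=
  (SSet.Subcomplex.mem_unionProd_iff _ _ _).trans (or_congr Iff.rfl (mem_boundary_iff t))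

/-- The cells of outer degree `n` are attached to the skeleton along the pushout-product of
`∂Δ[n] ⟶ Δ[n]` and the relative latching inclusion. -/
theorem preimage_diagonalSkeleton (hA : IsSubBisimplicial B A) (n : ℕ) :
    (diagonalSkeleton B A hA n).preimage (cellMap B n) =
      ∂Δ[n].unionProd (partialLatching B A n n) := by
  ext m z
  obtain ⟨t, y⟩ := z
  refine Iff.trans ?_ (mem_unionProd_boundary_iff _ t y).symm
  generalize ht : SSet.stdSimplex.objEquiv t = t'
  have hc : (cellMap B n).app m (show (Δ[n] ⊗ B.obj (op ⦋n⦌) : SSet.{u}).obj m from (t, y)) =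
      (B.map t'.op).app m y := by
    rw [← ht]
    rfl
  change (cellMap B n).app m (show (Δ[n] ⊗ B.obj (op ⦋n⦌) : SSet.{u}).obj m from (t, y)) ∈
    (diagonalSkeleton B A hA n).obj m ↔ _
  rw [hc]
  clear hc ht t
  constructor
  · intro h
    by_cases ht : Epi t'
    · refine Or.inl ?_
      obtain ⟨⟨s, hs⟩⟩ := isSplitEpi_of_epi t'
      have hy : y = (B.map s.op).app m ((B.map t'.op).app m y) := by
        rw [map_comp_app, hs, map_id_app]
      rw [hy]
      obtain h | ⟨k, hk, θ, z, h⟩ := h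
      · exact le_partialLatching B A n n _ (hA s.op _ h)
      · rw [← h, map_comp_app]
        exact mem_partialLatching_of_degenerate hk _ _
    · exact Or.inr ht
  · rintro (h | h)
    · cases n with
      | zero => exact Or.inl (hA t'.op _ h)
      | succ n =>
        obtain h | ⟨i, -, z, rfl⟩ := (mem_partialLatching_succ B A y).1 h
        · exact Or.inl (hA t'.op _ h)
        · exact Or.inr ⟨n, by omega, t' ≫ SimplexCategory.σ i, z, (map_comp_app _ _ z).symm⟩
    · rw [SimplexCategory.epi_iff_surjective] at h
      cases n with
      | zero => exact (h fun x => ⟨0, Subsingleton.elim (α := Fin 1) _ _⟩).elim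
      | succ n =>
        obtain ⟨i, τ, rfl⟩ := SimplexCategory.eq_comp_δ_of_not_surjective t' h
        exact Or.inr ⟨n, by omega, τ, (B.map (SimplexCategory.δ i).op).app m y,
          map_comp_app _ _ y⟩

/-- Away from its attaching subobject, `cellMap` is injective, by the uniqueness of the presentation
of a simplex as a degeneration of a nondegenerate one. -/
theorem cellMap_injective {n : ℕ} {m : SimplexCategoryᵒᵖ}
    {z z' : (Δ[n] ⊗ B.obj (op ⦋n⦌) : SSet.{u}).obj m}
    (hz : z ∉ (∂Δ[n].unionProd (partialLatching B A n n)).obj m)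
    (hz' : z' ∉ (∂Δ[n].unionProd (partialLatching B A n n)).obj m)
    (h : (cellMap B n).app m z = (cellMap B n).app m z') : z = z' := by
  obtain ⟨t, y⟩ := z
  obtain ⟨t', y'⟩ := z'
  obtain ⟨h1, h2⟩ := not_or.1 fun h => hz ((mem_unionProd_boundary_iff _ t y).2 h)
  obtain ⟨h1', -⟩ := not_or.1 fun h => hz' ((mem_unionProd_boundary_iff _ t' y').2 h)
  rw [not_not] at h2
  have hy := SSet.unique_nonDegenerate_simplex (B.flip.obj m) (n := m.unop.len) _
    (SSet.stdSimplex.objEquiv t) ⟨y, mem_nonDegenerate_of_notMem h1⟩ rfl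
    (SSet.stdSimplex.objEquiv t') ⟨y', mem_nonDegenerate_of_notMem h1'⟩ h
  have ht := SSet.unique_nonDegenerate_map (B.flip.obj m) (n := m.unop.len) _
    (SSet.stdSimplex.objEquiv t) ⟨y, mem_nonDegenerate_of_notMem h1⟩ rfl
    (SSet.stdSimplex.objEquiv t') ⟨y', mem_nonDegenerate_of_notMem h1'⟩ h
  exact Prod.ext (SSet.stdSimplex.objEquiv.injective ht) (congrArg Subtype.val hy)

theorem diagonalSkeleton_succ (hA : IsSubBisimplicial B A) (n : ℕ) :
    diagonalSkeleton B A hA (n + 1) =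
      diagonalSkeleton B A hA n ⊔ SSet.Subcomplex.range (cellMap B n) := by
  ext m x
  constructor
  · rintro (hx | ⟨k, hk, θ, y, hy⟩)
    · exact Or.inl (Or.inl hx)
    · obtain h | rfl := Nat.lt_succ_iff_lt_or_eq.1 hk
      · exact Or.inl (Or.inr ⟨k, h, θ, y, hy⟩)
      · refine Or.inr ⟨⟨SSet.stdSimplex.objEquiv.symm θ, y⟩, ?_⟩
        refine Eq.trans ?_ hy
        change (B.map (SSet.stdSimplex.objEquiv _).op).app m y = _
        rw [Equiv.apply_symm_apply]
  · rintro ((hx | ⟨k, hk, θ, y, hy⟩) | ⟨z, hz⟩)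
    · exact Or.inl hx
    · exact Or.inr ⟨k, by omega, θ, y, hy⟩
    · exact Or.inr ⟨n, by omega, SSet.stdSimplex.objEquiv z.1, z.2, hz⟩

/-- The realization lemma for the inclusion of a sub-bisimplicial set; its diagonal is the
`0`-skeleton of the relative filtration. -/
theorem trivialCofibrations_diagonalSkeleton_zero (hA : IsSubBisimplicial B A)
    (h : ∀ n, trivialCofibrations (A n).ι) :
    trivialCofibrations (diagonalSkeleton B A hA 0).ι := by
  have hle (n : ℕ) : diagonalSkeleton B A hA n ≤ diagonalSkeleton B A hA (n + 1) :=
    le_sup_left.trans_eq (diagonalSkeleton_succ hA n).symm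
  refine trivialCofibrations_iSup ⟨diagonalSkeleton B A hA, monotone_nat_of_le_succ hle⟩ ?_ ?_
  · refine top_unique fun m x _ => ?_
    simp only [Subfunctor.iSup_obj, Set.mem_iUnion]
    exact ⟨m.unop.len + 1, Or.inr ⟨m.unop.len, by omega, 𝟙 _, x, map_id_app x⟩⟩
  · intro n
    refine trivialCofibrations_sup_range (cellMap B n) _ _ (diagonalSkeleton_succ hA n) _ ?_ ?_
    · intro m z z' hz hz' hzz
      rw [preimage_diagonalSkeleton] at hz hz'
      exact cellMap_injective hz hz' hzz
    · rw [preimage_diagonalSkeleton]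
      exact trivialCofibrations_pushoutObjObjι (SSet.Subcomplex.unionProd.pushoutObjObj _ _)
        (trivialCofibrations_partialLatching hA h n n)

end Skeleton

end

section

open HomotopicalAlgebra CartesianMonoidalCategory SSet.modelCategoryQuillen

/-! ### The realization lemma -/

section RealizationLemma

variable {A B B' : SimplexCategoryᵒᵖ ⥤ SSet.{u}}

/-- The map of diagonals given by a map of bisimplicial sets. -/
def diagonalMap (φ : A ⟶ B) : diagonal A ⟶ diagonal B where
  app m := (φ.app m).app m
  naturality m m' s := by
    refine ConcreteCategory.hom_ext _ _ fun x => ?_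
    have h1 := ConcreteCategory.congr_hom ((φ.app m').naturality s) ((A.map s).app m x)
    have h2 := ConcreteCategory.congr_hom (NatTrans.congr_app (φ.naturality s) m) x
    exact h1.trans (congrArg ((B.obj m').map s) h2)

theorem diagonalMap_id : diagonalMap (𝟙 A) = 𝟙 (diagonal A) := rfl

/-- Homotopies in each outer degree, natural in it, give a homotopy of maps of diagonals. -/
theorem homotopic_diagonalMap {φ ψ : A ⟶ B} (h : ∀ m, A.obj m ⊗ Δ[1] ⟶ B.obj m)
    (hn : ∀ ⦃m m' : SimplexCategoryᵒᵖ⦄ (s : m ⟶ m'), A.map s ▷ Δ[1] ≫ h m' = h m ≫ B.map s)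
    (h0 : ∀ m, SSet.ι₀ ≫ h m = φ.app m) (h1 : ∀ m, SSet.ι₁ ≫ h m = ψ.app m) :
    Homotopic (diagonalMap φ) (diagonalMap ψ) := by
  let H : diagonal A ⊗ Δ[1] ⟶ diagonal B :=
    { app := fun m => (h m).app m
      naturality := fun m m' s => by
        refine ConcreteCategory.hom_ext _ _ fun x => ?_
        have e1 := ConcreteCategory.congr_hom ((h m').naturality s)
          (show (A.obj m').obj m × (Δ[1] : SSet.{u}).obj m from ⟨(A.map s).app m x.1, x.2⟩)
        have e2 := ConcreteCategory.congr_hom (NatTrans.congr_app (hn s) m) x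
        exact e1.trans (congrArg ((B.obj m').map s) e2) }
  exact ⟨H, NatTrans.ext (funext fun m => NatTrans.congr_app (h0 m) m),
    NatTrans.ext (funext fun m => NatTrans.congr_app (h1 m) m)⟩

theorem isSubBisimplicial_range (φ : A ⟶ B) :
    IsSubBisimplicial B fun n => SSet.Subcomplex.range (φ.app n) := by
  rintro n n' θ m - ⟨x, rfl⟩
  exact ⟨(A.map θ).app m x, ConcreteCategory.congr_hom (NatTrans.congr_app (φ.naturality θ) m) x⟩

theorem IsWeakEquivalence.range_ι {X Y : SSet.{u}} {f : X ⟶ Y} [Mono f]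
    (hf : IsWeakEquivalence f) : IsWeakEquivalence (SSet.Subcomplex.range f).ι := by
  have : IsIso (SSet.Subcomplex.toRange f) := inferInstance
  refine (IsWeakEquivalence.of_isIso (SSet.Subcomplex.toRange f)).of_comp_left ?_
  rwa [SSet.Subcomplex.toRange_ι]

/-- The realization lemma for degreewise monomorphisms. -/
theorem IsWeakEquivalence.diagonalMap_of_mono {φ : A ⟶ B} [∀ n, Mono (φ.app n)]
    (h : ∀ n, IsWeakEquivalence (φ.app n)) : IsWeakEquivalence (diagonalMap φ) := by
  have h1 := trivialCofibrations_diagonalSkeleton_zero (isSubBisimplicial_range φ)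
    fun n => (h n).range_ι.trivialCofibrations
  have hs : diagonalSkeleton B _ (isSubBisimplicial_range φ) 0 =
      SSet.Subcomplex.range (diagonalMap φ) := by
    ext m x
    constructor
    · rintro (⟨y, hy⟩ | ⟨k, hk, -⟩)
      · exact ⟨y, hy⟩
      · omega
    · rintro ⟨y, hy⟩
      exact Or.inl ⟨y, hy⟩
  rw [hs] at h1
  have : Mono (diagonalMap φ) := by
    have (m : SimplexCategoryᵒᵖ) : Mono ((diagonalMap φ).app m) :=
      inferInstanceAs (Mono ((φ.app m).app m))
    exact NatTrans.mono_of_mono_app _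
  rw [← SSet.Subcomplex.toRange_ι (diagonalMap φ)]
  exact (IsWeakEquivalence.of_isIso _).comp (isWeakEquivalence_of_trivialCofibrations h1)

/-- A contractible simplicial set containing a given one, functorially: the cofree simplicial set
on the sets of simplices with a point `none` added. -/
def cofreeCone (Y : SSet.{u}) : SSet.{u} where
  obj n := ∀ k : SimplexCategory, (k ⟶ n.unop) → Option (Y.obj (op k))
  map s := ↾fun g k θ => g k (θ ≫ s.unop)
  map_id n := by
    refine ConcreteCategory.hom_ext _ _ fun g => funext fun k => funext fun θ => ?_
    exact congrArg (g k) (Category.comp_id θ)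
  map_comp s t := by
    refine ConcreteCategory.hom_ext _ _ fun g => funext fun k => funext fun θ => ?_
    exact congrArg (g k) (Category.assoc θ _ _).symm

/-- Functoriality of `cofreeCone`; the point `none` is preserved. -/
def cofreeConeMap {Y Z : SSet.{u}} (f : Y ⟶ Z) : cofreeCone Y ⟶ cofreeCone Z where
  app n := ↾fun g k θ => (g k θ).map (f.app (op k))

theorem cofreeConeMap_id (Y : SSet.{u}) : cofreeConeMap (𝟙 Y) = 𝟙 _ := by
  refine NatTrans.ext (funext fun m => ConcreteCategory.hom_ext _ _ fun x => ?_)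
  exact funext fun k => funext fun θ => Option.map_id_apply

theorem cofreeConeMap_comp {Y Z W : SSet.{u}} (f : Y ⟶ Z) (g : Z ⟶ W) :
    cofreeConeMap (f ≫ g) = cofreeConeMap f ≫ cofreeConeMap g := by
  refine NatTrans.ext (funext fun m => ConcreteCategory.hom_ext _ _ fun x => ?_)
  exact funext fun k => funext fun θ =>
    (Option.map_map (g.app (op k)) (f.app (op k)) (show Option (Y.obj (op k)) from x k θ)).symm

/-- The inclusion of `Y` in `cofreeCone Y`. -/
def toCofreeCone (Y : SSet.{u}) : Y ⟶ cofreeCone Y where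
  app n := ↾fun y k θ => some (Y.map θ.op y)
  naturality n n' s := by
    refine ConcreteCategory.hom_ext _ _ fun y => funext fun k => funext fun θ => ?_
    exact congrArg some (ConcreteCategory.congr_hom (Y.map_comp s θ.op) y).symm

theorem toCofreeCone_naturality {Y Z : SSet.{u}} (f : Y ⟶ Z) :
    f ≫ toCofreeCone Z = toCofreeCone Y ≫ cofreeConeMap f := by
  refine NatTrans.ext (funext fun m => ConcreteCategory.hom_ext _ _ fun x => ?_)
  exact funext fun k => funext fun θ => congrArg some
      (ConcreteCategory.congr_hom (f.naturality θ.op) x).symm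

instance (Y : SSet.{u}) : Mono (toCofreeCone Y) := by
  have (n : SimplexCategoryᵒᵖ) : Mono ((toCofreeCone Y).app n) := by
    refine (mono_iff_injective _).2 fun y y' h => ?_
    have h' : Y.map (𝟙 _) y = Y.map (𝟙 _) y' :=
      Option.some_injective _ (congrFun (congrFun h n.unop) (𝟙 _))
    rwa [Y.map_id] at h'
  exact NatTrans.mono_of_mono_app _

open Classical in
/-- The contraction of `cofreeCone Y` onto the point `none`. -/
def cofreeConeContraction (Y : SSet.{u}) : cofreeCone Y ⊗ Δ[1] ⟶ cofreeCone Y where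
  app n := ↾fun x k θ =>
    if ∀ i, (SSet.stdSimplex.objEquiv x.2).toOrderHom (θ.toOrderHom i) = 0 then x.1 k θ else none

variable (A B) in
/-- The columnwise product of `B` with the contractible objects containing `A`. -/
def prodCofreeCone : SimplexCategoryᵒᵖ ⥤ SSet.{u} where
  obj n := B.obj n ⊗ cofreeCone (A.obj n)
  map s := B.map s ⊗ₘ cofreeConeMap (A.map s)
  map_id n := by rw [B.map_id, A.map_id, cofreeConeMap_id, id_tensorHom_id]
  map_comp s t := by rw [B.map_comp, A.map_comp, cofreeConeMap_comp, tensorHom_comp_tensorHom]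

/-- The projection of `prodCofreeCone A B` to `B`. -/
def prodCofreeConeFst : prodCofreeCone A B ⟶ B where
  app n := CartesianMonoidalCategory.fst _ _

/-- The section of the projection given by the points `none`. -/
def prodCofreeConeSection : B ⟶ prodCofreeCone A B where
  app n := CartesianMonoidalCategory.lift (𝟙 _) { app := fun m => ↾fun _ _ _ => none }

/-- The factorization of `φ` through a degreewise monomorphism. -/
def toProdCofreeCone (φ : A ⟶ B) : A ⟶ prodCofreeCone A B where
  app n := CartesianMonoidalCategory.lift (φ.app n) (toCofreeCone _)
  naturality n n' s := by
    have h : A.map s ≫ CartesianMonoidalCategory.lift (φ.app n') (toCofreeCone _) =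
        CartesianMonoidalCategory.lift (φ.app n) (toCofreeCone _) ≫
          (B.map s ⊗ₘ cofreeConeMap (A.map s)) := by
      rw [CartesianMonoidalCategory.lift_map, CartesianMonoidalCategory.comp_lift, φ.naturality,
        toCofreeCone_naturality]
    exact h

instance (φ : A ⟶ B) (n : SimplexCategoryᵒᵖ) : Mono ((toProdCofreeCone φ).app n) :=
  mono_of_mono_fac (h := toCofreeCone _)
    (CartesianMonoidalCategory.lift_snd (φ.app n) (toCofreeCone (A.obj n)))

variable (A B) in
/-- The contraction of `prodCofreeCone A B` onto `B`, in outer degree `n`. -/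
def prodCofreeConeContraction (n : SimplexCategoryᵒᵖ) :
    (prodCofreeCone A B).obj n ⊗ Δ[1] ⟶ (prodCofreeCone A B).obj n :=
  (α_ _ _ _).hom ≫ B.obj n ◁ cofreeConeContraction (A.obj n)

theorem prodCofreeConeContraction_naturality ⦃n n' : SimplexCategoryᵒᵖ⦄ (s : n ⟶ n') :
    (prodCofreeCone A B).map s ▷ Δ[1] ≫ prodCofreeConeContraction A B n' =
      prodCofreeConeContraction A B n ≫ (prodCofreeCone A B).map s := by
  refine NatTrans.ext (funext fun m => ConcreteCategory.hom_ext _ _ fun x => ?_)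
  refine Prod.ext rfl (funext fun k => funext fun θ => ?_)
  exact (apply_ite (Option.map ((A.map s).app (op k))) _ (x.1.2 k θ) none).symm

theorem ι₀_prodCofreeConeContraction (n : SimplexCategoryᵒᵖ) :
    SSet.ι₀ ≫ prodCofreeConeContraction A B n = (𝟙 (prodCofreeCone A B) :).app n := by
  refine NatTrans.ext (funext fun m => ConcreteCategory.hom_ext _ _ fun x => ?_)
  exact Prod.ext rfl (funext fun k => funext fun θ => if_pos fun i => rfl)

theorem ι₁_prodCofreeConeContraction (n : SimplexCategoryᵒᵖ) :
    SSet.ι₁ ≫ prodCofreeConeContraction A B n =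
      (prodCofreeConeFst ≫ prodCofreeConeSection : prodCofreeCone A B ⟶ _).app n := by
  refine NatTrans.ext (funext fun m => ConcreteCategory.hom_ext _ _ fun x => ?_)
  exact Prod.ext rfl (funext fun k => funext fun θ =>
    if_neg fun h => one_ne_zero (α := Fin 2) (h 0))

theorem isWeakEquivalence_diagonalMap_prodCofreeConeFst :
    IsWeakEquivalence (diagonalMap (prodCofreeConeFst : prodCofreeCone A B ⟶ B)) :=
  IsWeakEquivalence.of_homotopyInverse _ (diagonalMap prodCofreeConeSection)
    (.symm _ _ (.rel _ _ (homotopic_diagonalMap (prodCofreeConeContraction A B)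
      prodCofreeConeContraction_naturality ι₀_prodCofreeConeContraction
      ι₁_prodCofreeConeContraction))) (.refl _)

theorem isWeakEquivalence_prodCofreeConeFst_app (n : SimplexCategoryᵒᵖ) :
    IsWeakEquivalence ((prodCofreeConeFst : prodCofreeCone A B ⟶ B).app n) :=
  IsWeakEquivalence.of_homotopyInverse _ (prodCofreeConeSection.app n)
    (.symm _ _ (.rel _ _ ⟨prodCofreeConeContraction A B n, ι₀_prodCofreeConeContraction n,
      ι₁_prodCofreeConeContraction n⟩)) (.refl _)

/-- The realization lemma: a map of bisimplicial sets which is a weak equivalence in each outer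
degree induces a weak equivalence of diagonals. -/
theorem IsWeakEquivalence.diagonalMap {φ : A ⟶ B} (h : ∀ n, IsWeakEquivalence (φ.app n)) :
    IsWeakEquivalence (diagonalMap φ) := by
  have h1 : IsWeakEquivalence (AlgTheory.diagonalMap (toProdCofreeCone φ)) :=
    .diagonalMap_of_mono fun n =>
      (isWeakEquivalence_prodCofreeConeFst_app n).of_comp_right (h n)
  exact h1.comp isWeakEquivalence_diagonalMap_prodCofreeConeFst

/-- The diagonal does not depend on the order of the two simplicial directions. -/
def toDiagonalFlip (B : SimplexCategoryᵒᵖ ⥤ SSet.{u}) : diagonal B ⟶ diagonal B.flip where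
  app _ := 𝟙 _
  naturality _ _ s := ((B.map s).naturality s).symm

instance (B : SimplexCategoryᵒᵖ ⥤ SSet.{u}) : IsIso (toDiagonalFlip B) := by
  have (m : SimplexCategoryᵒᵖ) : IsIso ((toDiagonalFlip B).app m) := IsIso.id _
  exact NatIso.isIso_of_isIso_app _

/-- The realization lemma for a map which is a weak equivalence in each inner degree. -/
theorem IsWeakEquivalence.diagonalMap_of_flip {φ : A ⟶ B}
    (h : ∀ n, IsWeakEquivalence (((flipFunctor _ _ _).map φ).app n)) :
    IsWeakEquivalence (AlgTheory.diagonalMap φ) := by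
  have h1 := (IsWeakEquivalence.of_isIso (toDiagonalFlip A)).comp (IsWeakEquivalence.diagonalMap h)
  exact (IsWeakEquivalence.of_isIso (toDiagonalFlip B)).of_comp_right h1

end RealizationLemma

end

/-! ### Finite products -/

/-- The product of a family of simplicial sets, with the expected sets of simplices. -/
def piSSet {k : ℕ} (X : Fin k → SSet.{u}) : SSet.{u} where
  obj m := ∀ i, (X i).obj m
  map s := ↾fun x i => (X i).map s (x i)
  map_id m := by
    refine ConcreteCategory.hom_ext _ _ fun x => funext fun i => ?_
    exact ConcreteCategory.congr_hom ((X i).map_id m) (x i)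
  map_comp s t := by
    refine ConcreteCategory.hom_ext _ _ fun x => funext fun i => ?_
    exact ConcreteCategory.congr_hom ((X i).map_comp s t) (x i)

/-- The projections of a product of simplicial sets. -/
def piProj {k : ℕ} (X : Fin k → SSet.{u}) (i : Fin k) : piSSet X ⟶ X i where
  app m := ↾fun x => x i

/-- The map into a product given by its components. -/
def piLift {k : ℕ} {X : Fin k → SSet.{u}} {Y : SSet.{u}} (f : ∀ i, Y ⟶ X i) : Y ⟶ piSSet X where
  app m := ↾fun y i => (f i).app m y
  naturality m m' s := by
    refine ConcreteCategory.hom_ext _ _ fun x => funext fun i => ?_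
    exact ConcreteCategory.congr_hom ((f i).naturality s) x

/-- `piSSet X` is the product of the `X i`. -/
def piSSetIsLimit {k : ℕ} (X : Fin k → SSet.{u}) :
    IsLimit (Fan.mk (piSSet X) (piProj X)) :=
  Fan.IsLimit.mk _ (fun f => piLift f.proj) (fun _ _ => rfl) fun _ _ hf =>
    NatTrans.ext (funext fun m => ConcreteCategory.hom_ext _ _ fun x => funext fun i =>
      ConcreteCategory.congr_hom (NatTrans.congr_app (hf i) m) x)

theorem piLift_comp_piSSetIso {k : ℕ} {X : Fin k → SSet.{u}} {Y : SSet.{u}} (f : ∀ i, Y ⟶ X i) :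
    piLift f ≫ ((piSSetIsLimit X).conePointUniqueUpToIso (limit.isLimit _)).hom = Pi.lift f := by
  refine Pi.hom_ext _ _ fun i => ?_
  have h := (piSSetIsLimit X).conePointUniqueUpToIso_hom_comp (limit.isLimit _) ⟨i⟩
  have h' : ((piSSetIsLimit X).conePointUniqueUpToIso (limit.isLimit _)).hom ≫ Pi.π X i =
    piProj X i := h
  rw [Category.assoc, h', Pi.lift_π]
  rfl

theorem isWeakEquivalence_piLift_iff {k : ℕ} {X : Fin k → SSet.{u}} {Y : SSet.{u}}
    (f : ∀ i, Y ⟶ X i) : IsWeakEquivalence (piLift f) ↔ IsWeakEquivalence (Pi.lift f) := by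
  rw [← piLift_comp_piSSetIso]
  exact ⟨fun h => h.comp (.of_isIso _), fun h => (IsWeakEquivalence.of_isIso _).of_comp_right h⟩

theorem isIso_piLift_iff {k : ℕ} {X : Fin k → SSet.{u}} {Y : SSet.{u}}
    (f : ∀ i, Y ⟶ X i) : IsIso (Pi.lift f) ↔
      ∀ m, Function.Bijective fun (y : Y.obj m) i => (f i).app m y := by
  rw [← piLift_comp_piSSetIso, isIso_comp_right_iff, NatTrans.isIso_iff_isIso_app]
  exact forall_congr' fun m => isIso_iff_bijective _

section Level

variable {C D : Type u} [EnrichedCategory SSet.{u} C] [EnrichedCategory SSet.{u} D]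

/-- The (degenerate) `m`-simplex given by a morphism of a simplicial category. -/
def lev {a b : C} (p : Mor a b) (m : SimplexCategoryᵒᵖ) : toLevel m a ⟶ toLevel m b :=
  p.app m PUnit.unit

theorem levelChange_map_lev {a b : C} (p : Mor a b) {m m' : SimplexCategoryᵒᵖ} (s : m ⟶ m') :
    (levelChange C s).map (lev p m) = lev p m' :=
  (ConcreteCategory.congr_hom (p.naturality s) PUnit.unit).symm

/-- A cone is a product if and only if it is one for the `m`-simplices of the mapping spaces, for
all `m`. -/
theorem isProduct_iff {n : ℕ} {a : C} {b : Fin n → C} (p : ∀ i, Mor a (b i)) :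
    IsProduct p ↔ ∀ (c : C) (m : SimplexCategoryᵒᵖ), Function.Bijective
      fun (g : toLevel m c ⟶ toLevel m a) i => g ≫ lev (p i) m :=
  forall_congr' fun _ => isIso_piLift_iff _

theorem IsProduct.hom_ext {n : ℕ} {a : C} {b : Fin n → C} {p : ∀ i, Mor a (b i)}
    (hp : IsProduct p) {m : SimplexCategoryᵒᵖ} {c : Level C m} {g h : c ⟶ toLevel m a}
    (w : ∀ i, g ≫ lev (p i) m = h ≫ lev (p i) m) : g = h :=
  ((isProduct_iff p).1 hp c m).1 (funext w)

/-- The `m`-simplex of maps into a product given by its components. -/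
def IsProduct.lift {n : ℕ} {a : C} {b : Fin n → C} {p : ∀ i, Mor a (b i)}
    (hp : IsProduct p) {m : SimplexCategoryᵒᵖ} {c : Level C m} (g : ∀ i, c ⟶ toLevel m (b i)) :
    c ⟶ toLevel m a :=
  (((isProduct_iff p).1 hp c m).2 g).choose

theorem IsProduct.lift_lev {n : ℕ} {a : C} {b : Fin n → C} {p : ∀ i, Mor a (b i)}
    (hp : IsProduct p) {m : SimplexCategoryᵒᵖ} {c : Level C m} (g : ∀ i, c ⟶ toLevel m (b i))
    (i : Fin n) : hp.lift g ≫ lev (p i) m = g i :=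
  congrFun (((isProduct_iff p).1 hp c m).2 g).choose_spec i

theorem IsProduct.levelChange_map_lift {n : ℕ} {a : C} {b : Fin n → C} {p : ∀ i, Mor a (b i)}
    (hp : IsProduct p) {m m' : SimplexCategoryᵒᵖ} (s : m ⟶ m') {c : Level C m}
    (g : ∀ i, c ⟶ toLevel m (b i)) :
    (levelChange C s).map (hp.lift g) =
      hp.lift (c := (levelChange C s).obj c) (fun i => (levelChange C s).map (g i)) := by
  refine hp.hom_ext fun i => Eq.trans ?_ (hp.lift_lev _ i).symm
  refine (congrArg (fun z => (show (levelChange C s).obj c ⟶ toLevel m' a from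
    (levelChange C s).map (hp.lift g)) ≫ z) (levelChange_map_lev (p i) s).symm).trans ?_
  exact ((levelChange C s).map_comp (hp.lift g) (lev (p i) m)).symm.trans
    (congrArg (levelChange C s).map (hp.lift_lev g i))

theorem levelFunctor_map_levelChange (F : EnrichedFunctor SSet.{u} C D) {m m' : SimplexCategoryᵒᵖ}
    (s : m ⟶ m') {a b : Level C m} (g : a ⟶ b) :
    (levelFunctor F m').map ((levelChange C s).map g) =
      (levelChange D s).map ((levelFunctor F m).map g) :=
  ConcreteCategory.congr_hom ((F.map a b).naturality s) g

end Level

/-! ### Homotopies of bar constructions -/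

section BarHomotopy

variable {E E' E'' : Type u} [Category.{u} E] [Category.{u} E'] [Category.{u} E'']
  {X : E ⥤ Type u} {Y : Eᵒᵖ ⥤ Type u} {X' : E' ⥤ Type u} {Y' : E'ᵒᵖ ⥤ Type u}
  {X'' : E'' ⥤ Type u} {Y'' : E''ᵒᵖ ⥤ Type u}

theorem barMap_congr {L L' : E ⥤ E'} {η : X ⟶ L ⋙ X'} {η' : X ⟶ L' ⋙ X'}
    {ε : Y ⟶ L.op ⋙ Y'} {ε' : Y ⟶ L'.op ⋙ Y'} (h : L = L')
    (hη : ∀ c x, η.app c x ≍ η'.app c x) (hε : ∀ c y, ε.app c y ≍ ε'.app c y) :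
    barMap L η ε = barMap L' η' ε' := by
  subst h
  obtain rfl : η = η' := NatTrans.ext (funext fun c => ConcreteCategory.hom_ext _ _ fun x =>
    eq_of_heq (hη c x))
  obtain rfl : ε = ε' := NatTrans.ext (funext fun c => ConcreteCategory.hom_ext _ _ fun x =>
    eq_of_heq (hε c x))
  rfl

theorem barMap_comp (L : E ⥤ E') (η : X ⟶ L ⋙ X') (ε : Y ⟶ L.op ⋙ Y') (L' : E' ⥤ E'')
    (η' : X' ⟶ L' ⋙ X'') (ε' : Y' ⟶ L'.op ⋙ Y'') :
    barMap L η ε ≫ barMap L' η' ε' =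
      barMap (L ⋙ L') (η ≫ Functor.whiskerLeft L η') (ε ≫ Functor.whiskerLeft L.op ε') := rfl

theorem barMap_id : barMap (𝟭 E) (𝟙 X) (𝟙 Y) = 𝟙 (barSSet X Y) := rfl

/-- The natural transformation `δ`, seen as a functor out of a cylinder category. -/
def cylinderFunctor {L₀ L₁ : E ⥤ E'} (δ : L₀ ⟶ L₁) : E × Fin 2 ⥤ E' :=
  Functor.uncurry.obj (ComposableArrows.mk₁ δ).flip

variable (X Y) in
/-- The comparison of the cylinder on a bar construction with the bar construction over the cylinder
category: a simplex of `Δ[1]` is a chain in `Fin 2`. -/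
def barCylinder : barSSet X Y ⊗ Δ[1] ⟶
    barSSet (CategoryTheory.Prod.fst E (Fin 2) ⋙ X) ((CategoryTheory.Prod.fst E (Fin 2)).op ⋙ Y) where
  app n := ↾fun z =>
    { chain := z.1.chain.prod' (SSet.stdSimplex.objEquiv z.2).toOrderHom.monotone.functor
      x := z.1.x
      y := z.1.y }

theorem cylinderFunctor_map_zero {L₀ L₁ : E ⥤ E'} (δ : L₀ ⟶ L₁) {c c' : E} (g : c ⟶ c') :
    (cylinderFunctor δ).map (X := (c, (0 : Fin 2))) (Y := (c', 0)) (g, 𝟙 _) = L₀.map g := by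
  refine Eq.trans ?_ (Category.comp_id _)
  rfl

theorem cylinderFunctor_map_one {L₀ L₁ : E ⥤ E'} (δ : L₀ ⟶ L₁) {c c' : E} (g : c ⟶ c') :
    (cylinderFunctor δ).map (X := (c, (1 : Fin 2))) (Y := (c', 1)) (g, 𝟙 _) = L₁.map g := by
  refine Eq.trans ?_ (Category.comp_id _)
  rfl

/-- The map from the bottom of the cylinder. -/
def cylinderBot {L₀ L₁ : E ⥤ E'} (δ : L₀ ⟶ L₁) (c : E × Fin 2) :
    L₀.obj c.1 ⟶ (cylinderFunctor δ).obj c :=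
  ((ComposableArrows.mk₁ δ).map (X := 0) (homOfLE (Fin.zero_le c.2))).app c.1

/-- The map to the top of the cylinder. -/
def cylinderTop {L₀ L₁ : E ⥤ E'} (δ : L₀ ⟶ L₁) (c : E × Fin 2) :
    (cylinderFunctor δ).obj c ⟶ L₁.obj c.1 :=
  ((ComposableArrows.mk₁ δ).map (Y := 1) (homOfLE (Fin.le_last c.2))).app c.1

theorem cylinderBot_naturality {L₀ L₁ : E ⥤ E'} (δ : L₀ ⟶ L₁) {c c' : E × Fin 2} (g : c ⟶ c') :
    L₀.map g.1 ≫ cylinderBot δ c' = cylinderBot δ c ≫ (cylinderFunctor δ).map g := by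
  have h1 := ((ComposableArrows.mk₁ δ).map (X := 0) (homOfLE (Fin.zero_le c.2))).naturality g.1
  have h2 := NatTrans.congr_app ((ComposableArrows.mk₁ δ).map_comp (X := 0)
    (homOfLE (Fin.zero_le c.2)) g.2) c'.1
  change L₀.map g.1 ≫ _ = _ ≫ _ ≫ _
  refine (congrArg (fun z => L₀.map g.1 ≫ z) h2).trans ?_
  exact (Category.assoc _ _ _).symm.trans
    ((congrArg (fun z => z ≫ _) h1).trans (Category.assoc _ _ _))

theorem cylinderTop_naturality {L₀ L₁ : E ⥤ E'} (δ : L₀ ⟶ L₁) {c c' : E × Fin 2} (g : c ⟶ c') :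
    (cylinderFunctor δ).map g ≫ cylinderTop δ c' = cylinderTop δ c ≫ L₁.map g.1 := by
  have h1 := ((ComposableArrows.mk₁ δ).map (Y := 1) (homOfLE (Fin.le_last c.2))).naturality g.1
  have h2 := NatTrans.congr_app ((ComposableArrows.mk₁ δ).map_comp (Z := 1) g.2
    (homOfLE (Fin.le_last c'.2))) c'.1
  change (_ ≫ _) ≫ _ = _ ≫ L₁.map g.1
  refine (Category.assoc _ _ _).trans (Eq.trans ?_ h1)
  exact (congrArg (fun z => _ ≫ z) h2).symm

/-- The homotopy of maps of bar constructions given by a natural transformation. -/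
def barHomotopy {L₀ L₁ : E ⥤ E'} (δ : L₀ ⟶ L₁) (η : X ⟶ L₀ ⋙ X') (ε : Y ⟶ L₁.op ⋙ Y') :
    barSSet X Y ⊗ Δ[1] ⟶ barSSet X' Y' :=
  barCylinder X Y ≫ barMap (cylinderFunctor δ)
    { app := fun c => η.app c.1 ≫ X'.map (cylinderBot δ c)
      naturality := fun c c' g => by
        have h1 := η.naturality g.1
        change X.map g.1 ≫ η.app c'.1 ≫ _ = (η.app c.1 ≫ _) ≫ X'.map ((cylinderFunctor δ).map g)
        rw [← Category.assoc, h1, Category.assoc, Category.assoc]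
        congr 1
        change X'.map (L₀.map g.1) ≫ _ = _
        rw [← X'.map_comp, ← X'.map_comp, cylinderBot_naturality] }
    { app := fun c => ε.app (op c.unop.1) ≫ Y'.map (cylinderTop δ c.unop).op
      naturality := fun c c' g => by
        have h1 := ε.naturality g.unop.1.op
        change Y.map g.unop.1.op ≫ ε.app _ ≫ _ =
          (ε.app _ ≫ _) ≫ Y'.map ((cylinderFunctor δ).map g.unop).op
        rw [← Category.assoc, h1, Category.assoc, Category.assoc]
        congr 1
        change Y'.map (L₁.map g.unop.1).op ≫ _ = _
        rw [← Y'.map_comp, ← Y'.map_comp, ← op_comp, ← op_comp, cylinderTop_naturality] }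

theorem ι₀_barHomotopy {L₀ L₁ : E ⥤ E'} (δ : L₀ ⟶ L₁) (η : X ⟶ L₀ ⋙ X') (ε : Y ⟶ L₁.op ⋙ Y') :
    SSet.ι₀ ≫ barHomotopy δ η ε = barMap L₀ η (ε ≫ Functor.whiskerRight (NatTrans.op δ) Y') := by
  refine NatTrans.ext (funext fun m => ConcreteCategory.hom_ext _ _ fun s => ?_)
  refine BarSimplex.eq_of (Functor.hext (fun _ => rfl) fun a b g => heq_of_eq
    (cylinderFunctor_map_zero δ _)) (heq_of_eq ?_) HEq.rfl
  exact ConcreteCategory.congr_hom (X'.map_id _) (η.app _ s.x)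

theorem ι₁_barHomotopy {L₀ L₁ : E ⥤ E'} (δ : L₀ ⟶ L₁) (η : X ⟶ L₀ ⋙ X') (ε : Y ⟶ L₁.op ⋙ Y') :
    SSet.ι₁ ≫ barHomotopy δ η ε = barMap L₁ (η ≫ Functor.whiskerRight δ X') ε := by
  refine NatTrans.ext (funext fun m => ConcreteCategory.hom_ext _ _ fun s => ?_)
  refine BarSimplex.eq_of (Functor.hext (fun _ => rfl) fun a b g => heq_of_eq
    (cylinderFunctor_map_one δ _)) HEq.rfl (heq_of_eq ?_)
  exact ConcreteCategory.congr_hom (Y'.map_id _) (ε.app _ s.y)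

theorem barHomotopy_congr {L₀ L₁ L₀' L₁' : E ⥤ E'} {δ : L₀ ⟶ L₁} {δ' : L₀' ⟶ L₁'}
    {η : X ⟶ L₀ ⋙ X'} {η' : X ⟶ L₀' ⋙ X'} {ε : Y ⟶ L₁.op ⋙ Y'} {ε' : Y ⟶ L₁'.op ⋙ Y'}
    (h₀ : L₀ = L₀') (h₁ : L₁ = L₁') (hδ : ∀ c, δ.app c ≍ δ'.app c)
    (hη : ∀ c x, η.app c x ≍ η'.app c x) (hε : ∀ c y, ε.app c y ≍ ε'.app c y) :
    barHomotopy δ η ε = barHomotopy δ' η' ε' := by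
  subst h₀ h₁
  obtain rfl : δ = δ' := NatTrans.ext (funext fun c => eq_of_heq (hδ c))
  obtain rfl : η = η' := NatTrans.ext (funext fun c => ConcreteCategory.hom_ext _ _ fun x =>
    eq_of_heq (hη c x))
  obtain rfl : ε = ε' := NatTrans.ext (funext fun c => ConcreteCategory.hom_ext _ _ fun x =>
    eq_of_heq (hε c x))
  rfl

theorem cylinderFunctor_whiskerLeft (S : E ⥤ E') {L₀ L₁ : E' ⥤ E''} (δ : L₀ ⟶ L₁) :
    S.prod (𝟭 (Fin 2)) ⋙ cylinderFunctor δ = cylinderFunctor (Functor.whiskerLeft S δ) := by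
  refine Functor.hext ?_ ?_
  · rintro ⟨c, i⟩
    fin_cases i <;> rfl
  · rintro ⟨c, i⟩ ⟨c', i'⟩ ⟨g, h⟩
    have h := leOfHom h
    fin_cases i <;> fin_cases i' <;> first | rfl | simp at h

/-- Compatibility of `barHomotopy` with maps of bar constructions, on the source. -/
theorem barMap_whiskerRight_barHomotopy (S : E ⥤ E') (σ : X ⟶ S ⋙ X') (τ : Y ⟶ S.op ⋙ Y')
    {L₀ L₁ : E' ⥤ E''} (δ : L₀ ⟶ L₁) (η : X' ⟶ L₀ ⋙ X'') (ε : Y' ⟶ L₁.op ⋙ Y'') :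
    barMap S σ τ ▷ Δ[1] ≫ barHomotopy δ η ε =
      barHomotopy (X' := X'') (Y' := Y'') (Functor.whiskerLeft S δ) (σ ≫ Functor.whiskerLeft S η)
        (τ ≫ Functor.whiskerLeft S.op ε) := by
  refine Eq.trans (b := barCylinder X Y ≫
    barMap (X' := CategoryTheory.Prod.fst E' (Fin 2) ⋙ X')
    (Y' := (CategoryTheory.Prod.fst E' (Fin 2)).op ⋙ Y') (S.prod (𝟭 (Fin 2)))
    (Functor.whiskerLeft (CategoryTheory.Prod.fst E (Fin 2)) σ)
    (Functor.whiskerLeft (CategoryTheory.Prod.fst E (Fin 2)).op τ) ≫ barMap (cylinderFunctor δ) _ _)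
    rfl (congrArg (fun z => barCylinder X Y ≫ z) ?_)
  refine (barMap_comp _ _ _ _ _ _).trans
    (barMap_congr (cylinderFunctor_whiskerLeft S δ) ?_ ?_)
  · rintro ⟨c, i⟩ x
    fin_cases i <;> rfl
  · rintro ⟨c, i⟩ x
    fin_cases i <;> rfl

theorem cylinderFunctor_whiskerRight {L₀ L₁ : E ⥤ E'} (δ : L₀ ⟶ L₁) (S : E' ⥤ E'') :
    cylinderFunctor δ ⋙ S = cylinderFunctor (Functor.whiskerRight δ S) := by
  refine Functor.hext ?_ ?_
  · rintro ⟨c, i⟩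
    fin_cases i <;> rfl
  · rintro ⟨c, i⟩ ⟨c', i'⟩ ⟨g, h⟩
    have h := leOfHom h
    fin_cases i <;> fin_cases i'
    · refine heq_of_eq ((S.map_comp (L₀.map g) (𝟙 _)).trans ?_)
      exact congrArg (fun z => S.map (L₀.map g) ≫ z) (S.map_id _)
    · exact heq_of_eq (S.map_comp (L₀.map g) (δ.app c'))
    · simp at h
    · refine heq_of_eq ((S.map_comp (L₁.map g) (𝟙 _)).trans ?_)
      exact congrArg (fun z => S.map (L₁.map g) ≫ z) (S.map_id _)

/-- Compatibility of `barHomotopy` with maps of bar constructions, on the target. -/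
theorem barHomotopy_comp_barMap {L₀ L₁ : E ⥤ E'} (δ : L₀ ⟶ L₁) (η : X ⟶ L₀ ⋙ X')
    (ε : Y ⟶ L₁.op ⋙ Y') (S : E' ⥤ E'') (σ : X' ⟶ S ⋙ X'') (τ : Y' ⟶ S.op ⋙ Y'') :
    barHomotopy δ η ε ≫ barMap S σ τ =
      barHomotopy (X' := X'') (Y' := Y'') (Functor.whiskerRight δ S) (η ≫ Functor.whiskerLeft L₀ σ)
        (ε ≫ Functor.whiskerLeft L₁.op τ) := by
  refine Eq.trans (b := barCylinder X Y ≫ barMap (cylinderFunctor δ) _ _ ≫ barMap S σ τ)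
    rfl (congrArg (fun z => barCylinder X Y ≫ z) ?_)
  refine (barMap_comp _ _ _ _ _ _).trans
    (barMap_congr (cylinderFunctor_whiskerRight δ S) ?_ ?_)
  · rintro ⟨c, i⟩ x
    fin_cases i
    · exact heq_of_eq ((congrArg (σ.app (L₀.obj c))
        (ConcreteCategory.congr_hom (X'.map_id (L₀.obj c)) (η.app c x))).trans
        (ConcreteCategory.congr_hom (X''.map_id _) _).symm)
    · exact heq_of_eq (ConcreteCategory.congr_hom (σ.naturality (δ.app c)) (η.app c x))
  · rintro ⟨c, i⟩ x
    fin_cases i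
    · exact heq_of_eq (ConcreteCategory.congr_hom (τ.naturality (δ.app c).op) (ε.app (op c) x))
    · exact heq_of_eq ((congrArg (τ.app (op (L₁.obj c)))
        (ConcreteCategory.congr_hom (Y'.map_id (op (L₁.obj c))) (ε.app (op c) x))).trans
        (ConcreteCategory.congr_hom (Y''.map_id _) _).symm)

end BarHomotopy

/-! ### Bar constructions of families of chains -/

variable {C D : Type u} [EnrichedCategory SSet.{u} C] [EnrichedCategory SSet.{u} D]

variable (C) in
/-- A choice of a product of every family of `k` objects of a simplicial category. -/
structure ChosenProducts (k : ℕ) where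
  /-- the product object -/
  obj : (Fin k → C) → C
  /-- the projections -/
  proj : ∀ c i, Mor (obj c) (c i)
  isProduct : ∀ c, IsProduct (proj c)

namespace ChosenProducts

variable {k : ℕ} (W : ChosenProducts C k)

/-- The product functor `C_m^k ⥤ C_m`. -/
def functor (m : SimplexCategoryᵒᵖ) : (Fin k → Level C m) ⥤ Level C m where
  obj c := W.obj c
  map {c c'} g := (W.isProduct c').lift (c := toLevel m (W.obj c))
    (fun i => lev (W.proj c i) m ≫ g i)
  map_id c := (W.isProduct c).hom_ext fun i => ((W.isProduct c).lift_lev _ i).trans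
    ((Category.comp_id _).trans (Category.id_comp _).symm)
  map_comp {c c' c''} g h := (W.isProduct c'').hom_ext fun i => by
    refine ((W.isProduct c'').lift_lev _ i).trans (Eq.symm ?_)
    refine (Category.assoc _ _ _).trans ?_
    refine (congrArg (fun z => _ ≫ z) ((W.isProduct c'').lift_lev _ i)).trans ?_
    refine (Category.assoc _ _ _).symm.trans ?_
    refine (congrArg (fun z => z ≫ h i) ((W.isProduct c').lift_lev _ i)).trans ?_
    exact Category.assoc _ _ _

/-- The projections as natural transformations. -/
def functorProj (m : SimplexCategoryᵒᵖ) (i : Fin k) : W.functor m ⟶ Pi.eval _ i where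
  app c := lev (W.proj c i) m
  naturality _ c' _ := (W.isProduct c').lift_lev _ i

theorem hom_ext {m : SimplexCategoryᵒᵖ} {c : Level C m} {c' : Fin k → Level C m}
    {g h : c ⟶ (W.functor m).obj c'}
    (w : ∀ i, g ≫ (W.functorProj m i).app c' = h ≫ (W.functorProj m i).app c') : g = h :=
  (W.isProduct c').hom_ext w

/-- The constant family functor. -/
abbrev constFamily (C : Type u) [EnrichedCategory SSet.{u} C] (k : ℕ) (m : SimplexCategoryᵒᵖ) :
    Level C m ⥤ (Fin k → Level C m) :=
  Functor.pi' fun _ => 𝟭 _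

/-- The diagonals `c ⟶ c × ⋯ × c`. -/
def diag (m : SimplexCategoryᵒᵖ) : 𝟭 (Level C m) ⟶ constFamily C k m ⋙ W.functor m where
  app c := (W.isProduct fun _ => c).lift fun _ => 𝟙 _
  naturality c c' g := W.hom_ext fun i => by
    refine (Category.assoc _ _ _).trans ?_
    refine (congrArg (fun z => g ≫ z) ((W.isProduct fun _ => c').lift_lev _ i)).trans ?_
    refine Eq.trans ?_ (Category.assoc _ _ _).symm
    refine Eq.trans ?_ (congrArg (fun z => _ ≫ z) ((W.functorProj m i).naturality
      ((constFamily C k m).map g)).symm)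
    refine Eq.trans ?_ (Category.assoc _ _ _)
    refine Eq.trans ?_ (congrArg (fun z => z ≫ g) ((W.isProduct fun _ => c).lift_lev _ i).symm)
    exact (Category.comp_id _).trans (Category.id_comp _).symm

theorem diag_proj (m : SimplexCategoryᵒᵖ) (c : Level C m) (i : Fin k) :
    (W.diag m).app c ≫ (W.functorProj m i).app (fun _ => c) = 𝟙 c :=
  (W.isProduct fun _ => c).lift_lev _ i

/-- The families of projections. -/
def counit (m : SimplexCategoryᵒᵖ) : W.functor m ⋙ constFamily C k m ⟶ 𝟭 _ where
  app c := fun i => (W.functorProj m i).app c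
  naturality _ _ g := funext fun i => (W.functorProj m i).naturality g

/-- A triangle identity for the adjunction between constant families and products. -/
theorem diag_map_counit (m : SimplexCategoryᵒᵖ) (c : Fin k → Level C m) :
    (W.diag m).app ((W.functor m).obj c) ≫ (W.functor m).map ((W.counit m).app c) = 𝟙 _ :=
  W.hom_ext fun i => by
    refine (Category.assoc _ _ _).trans ?_
    refine (congrArg (fun z => _ ≫ z) ((W.functorProj m i).naturality
      ((W.counit m).app c))).trans ?_
    refine (Category.assoc _ _ _).symm.trans ?_
    exact congrArg (fun z => z ≫ (W.functorProj m i).app c) (W.diag_proj m _ i)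

variable (C k) in
/-- The simplicial operators on families. -/
abbrev familyChange {m m' : SimplexCategoryᵒᵖ} (s : m ⟶ m') :
    (Fin k → Level C m) ⥤ (Fin k → Level C m') :=
  Functor.pi fun _ => levelChange C s

theorem functor_map_levelChange {m m' : SimplexCategoryᵒᵖ} (s : m ⟶ m') {c c' : Fin k → Level C m}
    (g : c ⟶ c') : (levelChange C s).map ((W.functor m).map g) =
      (W.functor m').map ((familyChange C k s).map g) := by
  refine ((W.isProduct c').levelChange_map_lift s _).trans ?_
  refine congrArg (W.isProduct c').lift (funext fun i => ?_)
  refine ((levelChange C s).map_comp _ _).trans ?_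
  exact congrArg (fun z => z ≫ _) (levelChange_map_lev (W.proj c i) s)

theorem levelChange_map_diag {m m' : SimplexCategoryᵒᵖ} (s : m ⟶ m') (c : Level C m) :
    (levelChange C s).map ((W.diag m).app c) = (W.diag m').app ((levelChange C s).obj c) := by
  refine ((W.isProduct _).levelChange_map_lift s _).trans ?_
  refine congrArg (W.isProduct (fun _ => c)).lift (funext fun i => ?_)
  exact (levelChange C s).map_id c

end ChosenProducts

/-- The simplicial operators of the values of `X`, as natural transformations. -/
def levelModuleChange (X : EnrichedFunctor SSet.{u} C SSet.{u}) {m m' : SimplexCategoryᵒᵖ}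
    (s : m ⟶ m') : levelModule X m ⟶ levelChange C s ⋙ levelModule X m' where
  app c := (X.obj c).map s
  naturality a b g := by
    ext x
    have h1 := Functor.HomObj.naturality ((X.map a b).app m g) s (𝟙 m)
    have h2 := Functor.HomObj.congr_app
      (ConcreteCategory.congr_hom ((X.map a b).naturality s) g) m' (𝟙 m')
    have h3 := ConcreteCategory.congr_hom h1 x
    refine Eq.symm (Eq.trans (Eq.trans (ConcreteCategory.congr_hom h2 _) ?_) h3)
    have h4 : s ≫ 𝟙 m' = 𝟙 m ≫ s := by simp
    exact ConcreteCategory.congr_hom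
      (congrArg (Functor.HomObj.app ((X.map a b).app m g) m') h4) _

theorem levelModuleChange_map (X : EnrichedFunctor SSet.{u} C SSet.{u}) {m m' : SimplexCategoryᵒᵖ}
    (s : m ⟶ m') {a b : Level C m} (g : a ⟶ b) (x : (levelModule X m).obj a) :
    (levelModuleChange X s).app b ((levelModule X m).map g x) =
      (levelModule X m').map ((levelChange C s).map g) ((levelModuleChange X s).app a x) :=
  ConcreteCategory.congr_hom ((levelModuleChange X s).naturality g) x

section Family

variable (f : EnrichedFunctor SSet.{u} C D) (X : EnrichedFunctor SSet.{u} C SSet.{u})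
  {k : ℕ} (W : ChosenProducts C k) (b : Fin k → D)

/-- The simplicial operators of `D(f(-), d)`, as natural transformations. -/
def levelCorepChange (d : D) {m m' : SimplexCategoryᵒᵖ} (s : m ⟶ m') :
    levelCorep f d m ⟶ (levelChange C s).op ⋙ levelCorep f d m' where
  app c := ↾fun y => (levelChange D s).map y
  naturality a b g := by
    ext y
    refine ((levelChange D s).map_comp _ _).trans ?_
    exact congrArg (fun z => z ≫ _) (levelFunctor_map_levelChange f s g.unop).symm

/-- The functor sending a family `c` to `∏ i, D(f(c i), b i)_m`. -/
def familyCorep (m : SimplexCategoryᵒᵖ) : (Fin k → Level C m)ᵒᵖ ⥤ Type u where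
  obj c := ∀ i, (levelCorep f (b i) m).obj (op (c.unop i))
  map g := ↾fun y i => (levelCorep f (b i) m).map (g.unop i).op (y i)
  map_id c := by
    refine ConcreteCategory.hom_ext _ _ fun y => funext fun i => ?_
    exact ConcreteCategory.congr_hom ((levelCorep f (b i) m).map_id _) (y i)
  map_comp g h := by
    refine ConcreteCategory.hom_ext _ _ fun y => funext fun i => ?_
    exact ConcreteCategory.congr_hom
      ((levelCorep f (b i) m).map_comp (g.unop i).op (h.unop i).op) (y i)

/-- The simplicial operators of `X` at the products of families. -/
def familyModuleChange {m m' : SimplexCategoryᵒᵖ} (s : m ⟶ m') :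
    W.functor m ⋙ levelModule X m ⟶
      ChosenProducts.familyChange C k s ⋙ W.functor m' ⋙ levelModule X m' where
  app c := (levelModuleChange X s).app ((W.functor m).obj c)
  naturality c c' g := by
    refine ((levelModuleChange X s).naturality ((W.functor m).map g)).trans ?_
    exact congrArg (fun z => _ ≫ (levelModule X m').map z) (W.functor_map_levelChange s g)

/-- The simplicial operators of `familyCorep`. -/
def familyCorepChange {m m' : SimplexCategoryᵒᵖ} (s : m ⟶ m') :
    familyCorep f b m ⟶ (ChosenProducts.familyChange C k s).op ⋙ familyCorep f b m' where
  app c := ↾fun y i => (levelCorepChange f (b i) s).app (op (c.unop i)) (y i)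
  naturality c c' g := by
    refine ConcreteCategory.hom_ext _ _ fun y => funext fun i => ?_
    exact ConcreteCategory.congr_hom ((levelCorepChange f (b i) s).naturality (g.unop i).op) (y i)

/-- The bisimplicial set of tuples of chains in `C_m`, an element of `X` at the product of their
initial objects, and a family of maps from (the images of) their final objects to the `b i`. -/
def familyBar : SimplexCategoryᵒᵖ ⥤ SSet.{u} where
  obj m := barSSet (W.functor m ⋙ levelModule X m) (familyCorep f b m)
  map {m m'} s := barMap (ChosenProducts.familyChange C k s) (familyModuleChange X W s)
    (familyCorepChange f b s)
  map_id m := by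
    refine NatTrans.ext (funext fun n => ConcreteCategory.hom_ext _ _ fun s => ?_)
    refine BarSimplex.eq_of (CategoryTheory.Functor.hext (fun _ => rfl)
      fun a b g => heq_of_eq (funext fun i => ?_)) (heq_of_eq ?_) (heq_of_eq (funext fun i => ?_))
    · exact ConcreteCategory.congr_hom ((EnrichedCategory.Hom (V := SSet.{u}) (C := C)
        (s.chain.obj a i) (s.chain.obj b i)).map_id m) (s.chain.map g i)
    · exact ConcreteCategory.congr_hom ((X.obj (W.obj (s.chain.obj 0))).map_id m) s.x
    · exact ConcreteCategory.congr_hom ((EnrichedCategory.Hom (V := SSet.{u})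
        (f.obj (s.chain.obj (Fin.last _) i)) (b i)).map_id m) (s.y i)
  map_comp t t' := by
    refine NatTrans.ext (funext fun n => ConcreteCategory.hom_ext _ _ fun s => ?_)
    refine BarSimplex.eq_of (CategoryTheory.Functor.hext (fun _ => rfl)
      fun a b g => heq_of_eq (funext fun i => ?_)) (heq_of_eq ?_) (heq_of_eq (funext fun i => ?_))
    · exact ConcreteCategory.congr_hom ((EnrichedCategory.Hom (V := SSet.{u}) (C := C)
        (s.chain.obj a i) (s.chain.obj b i)).map_comp t t') (s.chain.map g i)
    · exact ConcreteCategory.congr_hom ((X.obj (W.obj (s.chain.obj 0))).map_comp t t') s.x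
    · exact ConcreteCategory.congr_hom ((EnrichedCategory.Hom (V := SSet.{u})
        (f.obj (s.chain.obj (Fin.last _) i)) (b i)).map_comp t t') (s.y i)

end Family

/-! ### Repeating and multiplying chains -/

section Family

variable {C D : Type u} [EnrichedCategory SSet.{u} C] [EnrichedCategory SSet.{u} D]
  (f : EnrichedFunctor SSet.{u} C D) (X : EnrichedFunctor SSet.{u} C SSet.{u})
  {k : ℕ} (W : ChosenProducts C k) {a : D} {b : Fin k → D} {p : ∀ i, Mor a (b i)}

theorem bar_map (d : D) {m m' : SimplexCategoryᵒᵖ} (s : m ⟶ m') :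
    (bar f X d).map s =
      barMap (levelChange C s) (levelModuleChange X s) (levelCorepChange f d s) := rfl

theorem familyBar_map {m m' : SimplexCategoryᵒᵖ} (s : m ⟶ m') :
    (familyBar f X W b).map s = barMap (ChosenProducts.familyChange C k s)
      (familyModuleChange X W s) (familyCorepChange f b s) := rfl

/-- The pushforward `X(c) ⟶ X(w(c, …, c))` along the diagonal. -/
def moduleDiag (m : SimplexCategoryᵒᵖ) : levelModule X m ⟶
    ChosenProducts.constFamily C k m ⋙ W.functor m ⋙ levelModule X m where
  app c := (levelModule X m).map ((W.diag m).app c)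
  naturality c c' g := by
    refine ((levelModule X m).map_comp _ _).symm.trans
      (Eq.trans ?_ ((levelModule X m).map_comp _ _))
    exact congrArg (levelModule X m).map ((W.diag m).naturality g)

variable (p) in
/-- Postcomposition with the projections `p i`. -/
def corepProj (m : SimplexCategoryᵒᵖ) : levelCorep f a m ⟶
    (ChosenProducts.constFamily C k m).op ⋙ familyCorep f b m where
  app c := ↾fun y i => y ≫ lev (p i) m
  naturality c c' g := by
    refine ConcreteCategory.hom_ext _ _ fun y => funext fun i => ?_
    exact Category.assoc (obj := Level D m) _ _ _

/-- The map `∏ i, D(f(c i), b i) ⟶ D(f(w(c)), a)` given by the projections of `w(c)` and the universal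
property of `a`. -/
def corepLift (hp : IsProduct p) (m : SimplexCategoryᵒᵖ) : familyCorep f b m ⟶
    (W.functor m).op ⋙ levelCorep f a m where
  app c := ↾fun y => hp.lift fun i =>
    (levelFunctor f m).map ((W.functorProj m i).app c.unop) ≫ y i
  naturality c c' g := by
    refine ConcreteCategory.hom_ext _ _ fun y => hp.hom_ext fun i => ?_
    refine (hp.lift_lev _ i).trans (Eq.symm ?_)
    refine (Category.assoc _ _ _).trans ?_
    refine (congrArg (fun z => _ ≫ z) (hp.lift_lev _ i)).trans ?_
    refine (Category.assoc _ _ _).symm.trans (Eq.trans ?_ (Category.assoc _ _ _))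
    refine congrArg (fun z => z ≫ y i) ?_
    refine ((levelFunctor f m).map_comp _ _).symm.trans
      (Eq.trans ?_ ((levelFunctor f m).map_comp _ _))
    exact congrArg (levelFunctor f m).map ((W.functorProj m i).naturality g.unop)

variable (p) in
/-- The map `(c | x; α; y) ↦ ((c, …, c) | δ_* x; (α, …, α); (p i ∘ y)_i)`. -/
def toFamilyBar : bar f X a ⟶ familyBar f X W b where
  app m := barMap (ChosenProducts.constFamily C k m) (moduleDiag X W m) (corepProj f p m)
  naturality m m' s := by
    rw [bar_map, familyBar_map]
    refine (barMap_comp _ _ _ _ _ _).trans (Eq.trans ?_ (barMap_comp _ _ _ _ _ _).symm)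
    refine barMap_congr rfl (fun c x => heq_of_eq ?_) (fun c y => heq_of_eq (funext fun i => ?_))
    · refine Eq.symm ((levelModuleChange_map X s _ x).trans ?_)
      exact congrArg (fun z => (levelModule X m').map z _) (W.levelChange_map_diag s c)
    · refine Eq.symm (((levelChange D s).map_comp _ _).trans ?_)
      exact congrArg (fun z => _ ≫ z) (levelChange_map_lev (p i) s)

/-- The map multiplying the chains, homotopy inverse to `toFamilyBar`. -/
def ofFamilyBar (hp : IsProduct p) : familyBar f X W b ⟶ bar f X a where
  app m := barMap (W.functor m) (𝟙 _) (corepLift f W hp m)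
  naturality m m' s := by
    rw [bar_map, familyBar_map]
    refine (barMap_comp _ _ _ _ _ _).trans (Eq.trans ?_ (barMap_comp _ _ _ _ _ _).symm)
    refine barMap_congr (Functor.hext (fun _ => rfl) fun c c' g =>
      heq_of_eq (W.functor_map_levelChange s g).symm) (fun c x => HEq.rfl)
      (fun c y => heq_of_eq ?_)
    refine Eq.symm ((hp.levelChange_map_lift s _).trans (congrArg hp.lift (funext fun i => ?_)))
    refine ((levelChange D s).map_comp _ _).trans (congrArg (fun z => z ≫ _) ?_)
    refine (levelFunctor_map_levelChange f s _).symm.trans ?_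
    exact congrArg (levelFunctor f m').map (levelChange_map_lev (W.proj c.unop i) s)

/-- The homotopy from the identity to `toFamilyBar ≫ ofFamilyBar` given by the diagonals. -/
def diagHomotopy (hp : IsProduct p) (m : SimplexCategoryᵒᵖ) :
    (bar f X a).obj m ⊗ Δ[1] ⟶ (bar f X a).obj m :=
  barHomotopy (W.diag m) (𝟙 (levelModule X m))
    (corepProj f p m ≫
      Functor.whiskerLeft (ChosenProducts.constFamily C k m).op (corepLift f W hp m))

theorem homotopic_toFamilyBar_ofFamilyBar (hp : IsProduct p) :
    Homotopic (𝟙 (diagonal (bar f X a)))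
      (diagonalMap (toFamilyBar f X W p ≫ ofFamilyBar f X W hp)) := by
  rw [← diagonalMap_id]
  refine homotopic_diagonalMap (diagHomotopy f X W hp) ?_ ?_ ?_
  · intro m m' s
    rw [bar_map]
    refine (barMap_whiskerRight_barHomotopy _ _ _ _ _ _).trans
      (Eq.trans ?_ (barHomotopy_comp_barMap _ _ _ _ _ _).symm)
    refine barHomotopy_congr rfl (Functor.hext (fun _ => rfl) fun c c' g => heq_of_eq ?_)
      (fun c => heq_of_eq ?_) (fun c x => HEq.rfl) (fun c y => heq_of_eq ?_)
    · exact (W.functor_map_levelChange s ((ChosenProducts.constFamily C k m).map g)).symm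
    · exact (W.levelChange_map_diag s c).symm
    · refine Eq.symm ((hp.levelChange_map_lift s _).trans (congrArg hp.lift (funext fun i => ?_)))
      refine ((levelChange D s).map_comp _ _).trans ?_
      refine congrArg₂ (fun z w => z ≫ w) ?_ ?_
      · refine (levelFunctor_map_levelChange f s _).symm.trans ?_
        exact congrArg (levelFunctor f m').map (levelChange_map_lev (W.proj _ i) s)
      · refine ((levelChange D s).map_comp _ _).trans ?_
        exact congrArg (fun z => _ ≫ z) (levelChange_map_lev (p i) s)
  · intro m
    refine (ι₀_barHomotopy _ _ _).trans ((barMap_congr rfl (fun _ _ => HEq.rfl)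
      fun c y => heq_of_eq ?_).trans barMap_id)
    refine hp.hom_ext fun i => ?_
    refine (Category.assoc _ _ _).trans ?_
    refine (congrArg (fun z => _ ≫ z) (hp.lift_lev _ i)).trans ?_
    refine (Category.assoc _ _ _).symm.trans ?_
    refine (congrArg (fun z => z ≫ _) (((levelFunctor f m).map_comp _ _).symm.trans
      ((congrArg (levelFunctor f m).map (W.diag_proj m c.unop i)).trans
        ((levelFunctor f m).map_id _)))).trans ?_
    exact Category.id_comp _
  · intro m
    exact (ι₁_barHomotopy _ _ _).trans (barMap_congr rfl (fun _ _ => HEq.rfl) fun _ _ => HEq.rfl)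

/-- The homotopy from `ofFamilyBar ≫ toFamilyBar` to the identity given by the projections. -/
def counitHomotopy (m : SimplexCategoryᵒᵖ) :
    (familyBar f X W b).obj m ⊗ Δ[1] ⟶ (familyBar f X W b).obj m :=
  barHomotopy (W.counit m) (Functor.whiskerLeft (W.functor m) (moduleDiag X W m))
    (𝟙 (familyCorep f b m))

theorem homotopic_ofFamilyBar_toFamilyBar (hp : IsProduct p) :
    Homotopic (diagonalMap (ofFamilyBar f X W hp ≫ toFamilyBar f X W p))
      (𝟙 (diagonal (familyBar f X W b))) := by
  rw [← diagonalMap_id]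
  refine homotopic_diagonalMap (counitHomotopy f X W) ?_ ?_ ?_
  · intro m m' s
    rw [familyBar_map]
    refine (barMap_whiskerRight_barHomotopy _ _ _ _ _ _).trans
      (Eq.trans ?_ (barHomotopy_comp_barMap _ _ _ _ _ _).symm)
    refine barHomotopy_congr (Functor.hext (fun _ => rfl) fun c c' g =>
      heq_of_eq (funext fun i => ?_)) rfl (fun c => heq_of_eq (funext fun i => ?_))
      (fun c x => heq_of_eq ?_) (fun c y => HEq.rfl)
    · exact (W.functor_map_levelChange s g).symm
    · exact (levelChange_map_lev (W.proj c i) s).symm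
    · refine Eq.symm ((levelModuleChange_map X s _ x).trans ?_)
      exact congrArg (fun z => (levelModule X m').map z _) (W.levelChange_map_diag s _)
  · intro m
    refine (ι₀_barHomotopy _ _ _).trans (Eq.trans ?_ (barMap_comp _ _ _ _ _ _).symm)
    refine barMap_congr rfl (fun _ _ => HEq.rfl) fun c y => heq_of_eq (funext fun i => ?_)
    exact (hp.lift_lev (c := (levelFunctor f m).obj ((W.functor m).obj c.unop)) (fun i =>
      (levelFunctor f m).map ((W.functorProj m i).app c.unop) ≫ y i) i).symm
  · intro m
    refine (ι₁_barHomotopy _ _ _).trans ((barMap_congr rfl (fun c x => heq_of_eq ?_)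
      fun _ _ => HEq.rfl).trans barMap_id)
    have h := ((levelModule X m).map_comp _ _).symm.trans
      ((congrArg (levelModule X m).map (W.diag_map_counit m c)).trans ((levelModule X m).map_id _))
    exact ConcreteCategory.congr_hom h x

theorem isWeakEquivalence_diagonalMap_toFamilyBar (hp : IsProduct p) :
    IsWeakEquivalence (diagonalMap (toFamilyBar f X W p)) :=
  .of_homotopyInverse _ (diagonalMap (ofFamilyBar f X W hp))
    (.symm _ _ (.rel _ _ (homotopic_toFamilyBar_ofFamilyBar f X W hp)))
    (.rel _ _ (homotopic_ofFamilyBar_toFamilyBar f X W hp))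

end Family

/-! ### Comparison with the product of bar constructions -/

section Family

variable {C D : Type u} [EnrichedCategory SSet.{u} C] [EnrichedCategory SSet.{u} D]
  (f : EnrichedFunctor SSet.{u} C D) (X : EnrichedFunctor SSet.{u} C SSet.{u})
  {k : ℕ} (W : ChosenProducts C k) {a : D} (b : Fin k → D) {p : ∀ i, Mor a (b i)}

/-- The columnwise product of the bar constructions `B(X, C, D(f(-), b i))`. -/
def prodBar : SimplexCategoryᵒᵖ ⥤ SSet.{u} where
  obj m := piSSet fun i => (bar f X (b i)).obj m
  map s := piLift fun i => piProj _ i ≫ (bar f X (b i)).map s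
  map_id m := by
    refine NatTrans.ext (funext fun n => ConcreteCategory.hom_ext _ _ fun s => funext fun i => ?_)
    exact ConcreteCategory.congr_hom (NatTrans.congr_app ((bar f X (b i)).map_id m) n) (s i)
  map_comp t t' := by
    refine NatTrans.ext (funext fun n => ConcreteCategory.hom_ext _ _ fun s => funext fun i => ?_)
    exact ConcreteCategory.congr_hom (NatTrans.congr_app ((bar f X (b i)).map_comp t t') n) (s i)

/-- The component of index `i` of `familyCorep`. -/
def familyCorepEval (m : SimplexCategoryᵒᵖ) (i : Fin k) :
    familyCorep f b m ⟶ (Pi.eval _ i).op ⋙ levelCorep f (b i) m where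
  app c := ↾fun y => y i

/-- The map whose components project the chains and push the element of `X` forward along
the projections. -/
def familyBarToProdBar : familyBar f X W b ⟶ prodBar f X b where
  app m := piLift fun i => barMap (Pi.eval _ i)
    (Functor.whiskerRight (W.functorProj m i) (levelModule X m)) (familyCorepEval f b m i)
  naturality m m' s := by
    refine NatTrans.ext (funext fun n => ConcreteCategory.hom_ext _ _ fun z => funext fun i => ?_)
    refine BarSimplex.eq_of rfl (heq_of_eq ?_) HEq.rfl
    refine Eq.symm ((levelModuleChange_map X s _ z.x).trans ?_)
    exact congrArg (fun g => (levelModule X m').map g _) (levelChange_map_lev (W.proj _ i) s)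

/-- The part of an `n`-simplex of `familyBar` other than the element of `X`, the initial objects of
the chains being the family `c`. -/
structure FamilyTail (n : ℕ) (c : Fin k → C) (m : SimplexCategoryᵒᵖ) : Type u where
  /-- the chains -/
  chain : ComposableArrows (Fin k → Level C m) n
  /-- the maps from the images of their final objects -/
  y : (familyCorep f b m).obj (op (chain.obj (Fin.last n)))
  obj_zero : chain.obj 0 = c

variable {f b} in
theorem FamilyTail.eq_of {n : ℕ} {c : Fin k → C} {m : SimplexCategoryᵒᵖ}
    {r r' : FamilyTail f b n c m} (h : r.chain = r'.chain) (hy : r.y ≍ r'.y) : r = r' := by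
  obtain ⟨F, y, hF⟩ := r
  obtain ⟨F', y', hF'⟩ := r'
  subst h
  cases hy
  rfl

/-- The simplicial set of tails, in the direction of the mapping spaces. -/
def familyTail (n : ℕ) (c : Fin k → C) : SSet.{u} where
  obj m := FamilyTail f b n c m
  map {m m'} s := ↾fun r =>
    ⟨r.chain ⋙ ChosenProducts.familyChange C k s, (familyCorepChange f b s).app _ r.y, r.obj_zero⟩
  map_id m := by
    refine ConcreteCategory.hom_ext _ _ fun r => ?_
    refine FamilyTail.eq_of
      (CategoryTheory.Functor.hext (fun _ => rfl) fun a b g => heq_of_eq (funext fun i => ?_))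
      (heq_of_eq (funext fun i => ?_))
    · exact ConcreteCategory.congr_hom ((EnrichedCategory.Hom (V := SSet.{u}) (C := C)
        (r.chain.obj a i) (r.chain.obj b i)).map_id m) (r.chain.map g i)
    · exact ConcreteCategory.congr_hom ((EnrichedCategory.Hom (V := SSet.{u})
        (f.obj (r.chain.obj (Fin.last _) i)) (b i)).map_id m) (r.y i)
  map_comp t t' := by
    refine ConcreteCategory.hom_ext _ _ fun r => ?_
    refine FamilyTail.eq_of
      (CategoryTheory.Functor.hext (fun _ => rfl) fun a b g => heq_of_eq (funext fun i => ?_))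
      (heq_of_eq (funext fun i => ?_))
    · exact ConcreteCategory.congr_hom ((EnrichedCategory.Hom (V := SSet.{u}) (C := C)
        (r.chain.obj a i) (r.chain.obj b i)).map_comp t t') (r.chain.map g i)
    · exact ConcreteCategory.congr_hom ((EnrichedCategory.Hom (V := SSet.{u})
        (f.obj (r.chain.obj (Fin.last _) i)) (b i)).map_comp t t') (r.y i)

/-- The simplices of `familyBar` with given initial objects `c`. -/
def familyBarIncl (n : SimplexCategoryᵒᵖ) (c : Fin k → C) :
    X.obj (W.obj c) ⊗ familyTail f b n.unop.len c ⟶ (familyBar f X W b).flip.obj n where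
  app m := ↾fun z =>
    { chain := z.2.chain
      x := cast (congrArg (fun c => (X.obj (W.obj c)).obj m) z.2.obj_zero.symm) z.1
      y := z.2.y }
  naturality m m' s := by
    refine ConcreteCategory.hom_ext _ _ ?_
    rintro ⟨x, ⟨F, y, rfl⟩⟩
    rfl

/-- The simplices of `prodBar` with given initial objects `c`. -/
def prodBarIncl (n : SimplexCategoryᵒᵖ) (c : Fin k → C) :
    piSSet (fun i => X.obj (c i)) ⊗ familyTail f b n.unop.len c ⟶
      (prodBar f X b).flip.obj n where
  app m := ↾fun z i =>
    { chain := z.2.chain ⋙ Pi.eval _ i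
      x := cast (congrArg (fun c => (X.obj (c i)).obj m) z.2.obj_zero.symm) (z.1 i)
      y := z.2.y i }
  naturality m m' s := by
    refine ConcreteCategory.hom_ext _ _ ?_
    rintro ⟨x, ⟨F, y, rfl⟩⟩
    rfl

instance (n : SimplexCategoryᵒᵖ) : IsIso (sigmaDesc (familyBarIncl f X W b n)) := by
  rw [NatTrans.isIso_iff_isIso_app]
  intro m
  rw [isIso_iff_bijective, Function.bijective_iff_has_inverse]
  refine ⟨fun s => ⟨s.chain.obj 0, s.x, ⟨s.chain, s.y, rfl⟩⟩, ?_, fun s => rfl⟩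
  rintro ⟨c, x, ⟨F, y, rfl⟩⟩
  rfl

instance (n : SimplexCategoryᵒᵖ) : IsIso (sigmaDesc (prodBarIncl f X b n)) := by
  rw [NatTrans.isIso_iff_isIso_app]
  intro m
  rw [isIso_iff_bijective, Function.bijective_iff_has_inverse]
  refine ⟨fun s => ⟨fun i => (s i).chain.obj 0, fun i => (s i).x,
    ⟨Functor.pi' fun i => (s i).chain, fun i => (s i).y, rfl⟩⟩, ?_, fun s => rfl⟩
  rintro ⟨c, x, ⟨F, y, rfl⟩⟩
  rfl

theorem sigmaMap_comp_prodBarIncl (n : SimplexCategoryᵒᵖ) :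
    sigmaMap (fun c => piLift (fun i => evalMor X (W.proj c i)) ▷ familyTail f b n.unop.len c) ≫
        sigmaDesc (prodBarIncl f X b n) =
      sigmaDesc (familyBarIncl f X W b n) ≫
        ((flipFunctor _ _ _).map (familyBarToProdBar f X W b)).app n := by
  refine NatTrans.ext (funext fun m => ConcreteCategory.hom_ext _ _ ?_)
  rintro ⟨c, x, ⟨F, y, rfl⟩⟩
  rfl

/-- In each bar degree, `familyBarToProdBar` is a coproduct, over the families of initial objects
`c`, of products of the comparison maps of `X` at `c` with simplicial sets. -/
theorem isWeakEquivalence_diagonalMap_familyBarToProdBar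
    (hW : ∀ c, IsWeakEquivalence (piLift fun i => evalMor X (W.proj c i))) :
    IsWeakEquivalence (diagonalMap (familyBarToProdBar f X W b)) := by
  refine .diagonalMap_of_flip fun n =>
    (IsWeakEquivalence.of_isIso (sigmaDesc (familyBarIncl f X W b n))).of_comp_left ?_
  rw [← sigmaMap_comp_prodBarIncl]
  exact (IsWeakEquivalence.sigmaMap fun c => (hW c).whiskerRight _).comp (.of_isIso _)

/-- The diagonal commutes with products. -/
def diagonalProdBar : diagonal (prodBar f X b) ⟶ piSSet fun i => diagonal (bar f X (b i)) where
  app _ := 𝟙 _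
  naturality _ _ _ := rfl

instance : IsIso (diagonalProdBar f X b) := by
  have (m : SimplexCategoryᵒᵖ) : IsIso ((diagonalProdBar f X b).app m) := IsIso.id _
  exact NatIso.isIso_of_isIso_app _

/-- The comparison map of the homotopy left Kan extension factors through the diagonal of
`familyBar`. -/
theorem piLift_evalMor_homotopyLan :
    piLift (fun i => evalMor (homotopyLan f X) (p i)) =
      diagonalMap (toFamilyBar f X W p) ≫ diagonalMap (familyBarToProdBar f X W b) ≫
        diagonalProdBar f X b := by
  refine NatTrans.ext (funext fun m => ConcreteCategory.hom_ext _ _ fun z => funext fun i => ?_)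
  refine BarSimplex.eq_of rfl (heq_of_eq ?_) (heq_of_eq ?_)
  · refine Eq.symm ?_
    have h := ((levelModule X m).map_comp _ _).symm.trans
      ((congrArg (levelModule X m).map (W.diag_proj m (z.chain.obj 0) i)).trans
        ((levelModule X m).map_id _))
    exact ConcreteCategory.congr_hom h z.x
  · exact congrArg (fun g : toLevel m a ⟶ toLevel m (b i) =>
      (show toLevel m (f.obj (z.chain.obj (Fin.last _))) ⟶ toLevel m a from z.y) ≫ g)
      (levelChange_map_lev (p i) (𝟙 m))

/-- The homotopy left Kan extension sends a product cone with codomains `b i` to a product up to weak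
equivalence as soon as `X` does so for some product of each family of as many objects. -/
theorem isWeakEquivalence_evalMor_homotopyLan (hp : IsProduct p)
    (hW : ∀ c, IsWeakEquivalence (piLift fun i => evalMor X (W.proj c i))) :
    IsWeakEquivalence (piLift fun i => evalMor (homotopyLan f X) (p i)) := by
  rw [piLift_evalMor_homotopyLan f X W b]
  have h : IsWeakEquivalence (diagonalProdBar f X b) := .of_isIso _
  exact (isWeakEquivalence_diagonalMap_toFamilyBar f X W hp).comp
    ((isWeakEquivalence_diagonalMap_familyBarToProdBar f X W b hW).comp h)

end Family

section

/-! ### Products of words and weak models -/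

section Morphisms

variable {C : Type u} [EnrichedCategory SSet.{u} C]

/-- Composition of morphisms of a simplicial category. -/
def Mor.comp {a b c : C} (p : Mor a b) (q : Mor b c) : Mor a c :=
  CartesianMonoidalCategory.lift p q ≫ eComp SSet.{u} a b c

theorem lev_comp {a b c : C} (p : Mor a b) (q : Mor b c) (m : SimplexCategoryᵒᵖ) :
    lev (p.comp q) m = lev p m ≫ lev q m := rfl

theorem evalMor_comp (X : EnrichedFunctor SSet.{u} C SSet.{u}) {a b c : C} (p : Mor a b)
    (q : Mor b c) : evalMor X (p.comp q) = evalMor X p ≫ evalMor X q := by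
  refine NatTrans.ext (funext fun m => ?_)
  exact (levelModule X m).map_comp (lev p m) (lev q m)

/-- The morphism given by a compatible family of simplices. -/
def morOfLevels {a b : C} (g : ∀ m, toLevel m a ⟶ toLevel m b)
    (hg : ∀ ⦃m m'⦄ (s : m ⟶ m'), (levelChange C s).map (g m) = g m') : Mor a b where
  app m := ↾fun _ => g m
  naturality _ _ s := ConcreteCategory.hom_ext _ _ fun _ => (hg s).symm

/-- `p` exhibits its source as the product of its target and of the targets of the `q i`. -/
def IsConsProduct {k : ℕ} {e a : C} {t : Fin k → C} (p : Mor e a) (q : ∀ i, Mor e (t i)) : Prop :=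
  ∀ (c : C) (m : SimplexCategoryᵒᵖ), Function.Bijective
    fun g : toLevel m c ⟶ toLevel m e => (g ≫ lev p m, fun i => g ≫ lev (q i) m)

/-- `p` and `q` exhibit their source as the product of their targets. -/
def IsBinaryProduct {e a b : C} (p : Mor e a) (q : Mor e b) : Prop :=
  ∀ (c : C) (m : SimplexCategoryᵒᵖ), Function.Bijective
    fun g : toLevel m c ⟶ toLevel m e => (g ≫ lev p m, g ≫ lev q m)

theorem IsConsProduct.isProduct {k : ℕ} {e : C} {t : Fin (k + 1) → C} {p : Mor e (t 0)}
    {q : ∀ i : Fin k, Mor e (t i.succ)} (h : IsConsProduct p q) :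
    IsProduct (Fin.cases (motive := fun i => Mor e (t i)) p q) := by
  rw [isProduct_iff]
  refine fun c m => ⟨fun g g' hg => (h c m).1 (Prod.ext (congrFun hg 0)
    (funext fun i => congrFun hg i.succ)), fun v => ?_⟩
  obtain ⟨g, hg⟩ := (h c m).2 (v 0, fun i => v i.succ)
  refine ⟨g, funext fun i => ?_⟩
  induction i using Fin.cases with
  | zero => exact congrArg Prod.fst hg
  | succ i => exact congrFun (congrArg Prod.snd hg) i

theorem IsProduct.isBinaryProduct {e a b : C} {p : ∀ i, Mor e ((![a, b] : Fin 2 → C) i)}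
    (h : IsProduct p) : IsBinaryProduct (p 0) (p 1) := by
  rw [isProduct_iff] at h
  refine fun c m => ⟨fun g g' hg => (h c m).1 (funext fun i => ?_), fun v => ?_⟩
  · fin_cases i
    · exact congrArg Prod.fst hg
    · exact congrArg Prod.snd hg
  · obtain ⟨g, hg⟩ := (h c m).2 (Fin.cases v.1 (Fin.cases v.2 (fun i => i.elim0)))
    exact ⟨g, Prod.ext (congrFun hg 0) (congrFun hg 1)⟩

theorem IsBinaryProduct.isConsProduct {k : ℕ} {e a b : C} {p : Mor e a} {q : Mor e b}
    (h : IsBinaryProduct p q) {t : Fin k → C} {r : ∀ i, Mor b (t i)} (hr : IsProduct r) :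
    IsConsProduct p fun i => q.comp (r i) := by
  refine fun c m => ⟨fun g g' hg => ?_, fun v => ?_⟩
  · have h0 : g ≫ lev p m = g' ≫ lev p m := congrArg Prod.fst hg
    refine (h c m).1 (Prod.ext h0 (hr.hom_ext fun i => ?_))
    exact (Category.assoc _ _ _).trans ((congrFun (congrArg Prod.snd hg) i).trans
      (Category.assoc _ _ _).symm)
  · obtain ⟨g, hg⟩ := (h c m).2 (v.1, hr.lift (c := toLevel m c) v.2)
    have h0 : g ≫ lev p m = v.1 := congrArg Prod.fst hg
    refine ⟨g, Prod.ext h0 (funext fun i => ?_)⟩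
    exact (Category.assoc _ _ _).symm.trans
      ((congrArg (fun z => z ≫ lev (r i) m) (congrArg Prod.snd hg)).trans (hr.lift_lev _ i))

/-- Morphisms into a binary product. -/
theorem IsBinaryProduct.exists_mor {e a b : C} {p : Mor e a} {q : Mor e b}
    (h : IsBinaryProduct p q) {c : C} (u : Mor c a) (v : Mor c b) :
    ∃ g : Mor c e, (∀ m, lev g m ≫ lev p m = lev u m) ∧ ∀ m, lev g m ≫ lev q m = lev v m := by
  choose g hg using fun m => (h c m).2 (lev u m, lev v m)
  refine ⟨morOfLevels g fun m m' s => (h c m').1 (Eq.trans (Prod.ext ?_ ?_) (hg m').symm),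
    fun m => congrArg Prod.fst (hg m), fun m => congrArg Prod.snd (hg m)⟩
  · have h1 := (levelChange C s).map_comp (g m) (lev p m)
    rw [levelChange_map_lev] at h1
    exact h1.symm.trans ((congrArg (levelChange C s).map (congrArg Prod.fst (hg m))).trans
      (levelChange_map_lev u s))
  · have h1 := (levelChange C s).map_comp (g m) (lev q m)
    rw [levelChange_map_lev] at h1
    exact h1.symm.trans ((congrArg (levelChange C s).map (congrArg Prod.snd (hg m))).trans
      (levelChange_map_lev v s))

theorem evalMor_eq_of_lev (X : EnrichedFunctor SSet.{u} C SSet.{u}) {a b : C} {p q : Mor a b}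
    (h : ∀ m, lev p m = lev q m) : evalMor X p = evalMor X q :=
  NatTrans.ext (funext fun m => congrArg (levelModule X m).map (h m))

/-- Products can be built by splitting off one factor at a time. -/
theorem IsConsProduct.exists_of_isBinaryProduct {k : ℕ} {e l s a e' : C} {t : Fin k → C}
    {p : Mor e l} {q : ∀ i, Mor e (t i)} (h : IsConsProduct p q) {π₀ : Mor a s} {π₁ : Mor a l}
    (hπ : IsBinaryProduct π₀ π₁) {ρ₀ : Mor e' s} {ρ₁ : Mor e' e} (hρ : IsBinaryProduct ρ₀ ρ₁) :
    ∃ r : Mor e' a, (∀ m, lev r m ≫ lev π₀ m = lev ρ₀ m) ∧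
      (∀ m, lev r m ≫ lev π₁ m = lev (ρ₁.comp p) m) ∧
      IsConsProduct r fun i => ρ₁.comp (q i) := by
  obtain ⟨r, hr₀, hr₁⟩ := hπ.exists_mor ρ₀ (ρ₁.comp p)
  refine ⟨r, hr₀, hr₁, fun c m => ⟨fun g g' hg => ?_, fun v => ?_⟩⟩
  · have hg0 : g ≫ lev r m = g' ≫ lev r m := congrArg Prod.fst hg
    have hg1 (i) : g ≫ lev ρ₁ m ≫ lev (q i) m = g' ≫ lev ρ₁ m ≫ lev (q i) m :=
      congrFun (congrArg Prod.snd hg) i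
    refine (hρ c m).1 (Prod.ext ?_ ((h c m).1 (Prod.ext ?_ (funext fun i => ?_))))
    · change g ≫ lev ρ₀ m = g' ≫ lev ρ₀ m
      rw [← hr₀ m, ← Category.assoc, hg0, Category.assoc]
    · change (g ≫ lev ρ₁ m) ≫ lev p m = (g' ≫ lev ρ₁ m) ≫ lev p m
      rw [Category.assoc, Category.assoc, ← lev_comp, ← hr₁ m, ← Category.assoc, hg0,
        Category.assoc]
    · exact (Category.assoc _ _ _).trans ((hg1 i).trans (Category.assoc _ _ _).symm)
  · obtain ⟨x, hx⟩ := (h c m).2 (v.1 ≫ lev π₁ m, v.2)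
    obtain ⟨g, hg⟩ := (hρ c m).2 (v.1 ≫ lev π₀ m, x)
    have hg0 : g ≫ lev ρ₀ m = v.1 ≫ lev π₀ m := congrArg Prod.fst hg
    have hg1 : g ≫ lev ρ₁ m = x := congrArg Prod.snd hg
    have hx0 : x ≫ lev p m = v.1 ≫ lev π₁ m := congrArg Prod.fst hx
    have hx1 (i) : x ≫ lev (q i) m = v.2 i := congrFun (congrArg Prod.snd hx) i
    refine ⟨g, Prod.ext ((hπ c m).1 (Prod.ext ?_ ?_)) (funext fun i => ?_)⟩
    · change (g ≫ lev r m) ≫ lev π₀ m = _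
      rw [Category.assoc, hr₀, hg0]
    · change (g ≫ lev r m) ≫ lev π₁ m = _
      rw [Category.assoc, hr₁, lev_comp, ← Category.assoc, hg1, hx0]
    · change g ≫ lev (ρ₁.comp (q i)) m = _
      rw [lev_comp, ← Category.assoc, hg1, hx1]

end Morphisms

section ConsProducts

open CartesianMonoidalCategory

/-- Splitting off the first factor of a product. -/
def piCons {k : ℕ} (Y : Fin (k + 1) → SSet.{u}) :
    Y 0 ⊗ piSSet (fun i : Fin k => Y i.succ) ⟶ piSSet Y where
  app m := ↾fun z => Fin.cases z.1 z.2
  naturality m m' s := ConcreteCategory.hom_ext _ _ fun z => funext fun i => by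
    induction i using Fin.cases <;> rfl

instance {k : ℕ} (Y : Fin (k + 1) → SSet.{u}) : IsIso (piCons Y) := by
  rw [NatTrans.isIso_iff_isIso_app]
  intro m
  rw [isIso_iff_bijective, Function.bijective_iff_has_inverse]
  refine ⟨fun z => ⟨z 0, fun i => z i.succ⟩, fun z => rfl, fun z => funext fun i => ?_⟩
  induction i using Fin.cases <;> rfl

theorem piLift_cases {k : ℕ} {Y : Fin (k + 1) → SSet.{u}} {Z : SSet.{u}} (f : ∀ i, Z ⟶ Y i) :
    piLift f = lift (f 0) (piLift fun i => f i.succ) ≫ piCons Y := by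
  refine NatTrans.ext (funext fun m => ConcreteCategory.hom_ext _ _ fun z => funext fun i => ?_)
  induction i using Fin.cases <;> rfl

theorem isWeakEquivalence_piLift_succ_iff {k : ℕ} {Y : Fin (k + 1) → SSet.{u}} {Z : SSet.{u}}
    (f : ∀ i, Z ⟶ Y i) : IsWeakEquivalence (piLift f) ↔
      IsWeakEquivalence (lift (f 0) (piLift fun i => f i.succ)) := by
  rw [piLift_cases]
  exact ⟨fun h => (IsWeakEquivalence.of_isIso _).of_comp_right h, fun h => h.comp (.of_isIso _)⟩

theorem isWeakEquivalence_piLift_zero_iff {k : ℕ} (hk : k = 0) {Z : SSet.{u}}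
    {Y : Fin k → SSet.{u}} (f : ∀ i, Z ⟶ Y i) :
    IsWeakEquivalence (piLift f) ↔ IsWeakEquivalence (toUnit Z) := by
  subst hk
  have : IsIso (toUnit (piSSet Y)) := by
    rw [NatTrans.isIso_iff_isIso_app]
    intro m
    rw [isIso_iff_bijective]
    exact ⟨fun x y _ => funext fun i => i.elim0, fun x => ⟨fun i => i.elim0, rfl⟩⟩
  rw [toUnit_unique (toUnit Z) (piLift f ≫ toUnit (piSSet Y))]
  exact ⟨fun h => h.comp (.of_isIso _), fun h => (IsWeakEquivalence.of_isIso _).of_comp_right h⟩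

theorem IsWeakEquivalence.snd_of_toUnit {Z : SSet.{u}} (h : IsWeakEquivalence (toUnit Z))
    (A : SSet.{u}) : IsWeakEquivalence (snd Z A) := by
  have h1 := (h.whiskerRight A).comp (.of_isIso (λ_ A).hom)
  rwa [show toUnit Z ▷ A ≫ (λ_ A).hom = snd Z A by rw [leftUnitor_hom]; simp] at h1

theorem piLift_evalMor_comp {C : Type u} [EnrichedCategory SSet.{u} C]
    (X : EnrichedFunctor SSet.{u} C SSet.{u}) {k : ℕ} {a b : C} {t : Fin k → C} (p : Mor a b)
    (q : ∀ i, Mor b (t i)) : (piLift fun i => evalMor X (p.comp (q i))) =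
      evalMor X p ≫ piLift fun i => evalMor X (q i) := by
  refine NatTrans.ext (funext fun m => ConcreteCategory.hom_ext _ _ fun z =>
    funext fun i => ?_)
  exact ConcreteCategory.congr_hom (NatTrans.congr_app (evalMor_comp X p (q i)) m) z

/-- If `X` preserves the products `a = s × l`, `e' = s × e` and `e = l × ∏ t` up to weak equivalence,
then it preserves `e' = a × ∏ t` up to weak equivalence. -/
theorem isWeakEquivalence_of_isBinaryProduct {C : Type u} [EnrichedCategory SSet.{u} C]
    (X : EnrichedFunctor SSet.{u} C SSet.{u}) {k : ℕ} {e l s a e' : C} {t : Fin k → C}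
    {p : Mor e l} {q : ∀ i, Mor e (t i)} {π₀ : Mor a s} {π₁ : Mor a l} {ρ₀ : Mor e' s}
    {ρ₁ : Mor e' e} {r : Mor e' a} (hr₀ : ∀ m, lev r m ≫ lev π₀ m = lev ρ₀ m)
    (hr₁ : ∀ m, lev r m ≫ lev π₁ m = lev (ρ₁.comp p) m)
    (h : IsWeakEquivalence (lift (evalMor X p) (piLift fun i => evalMor X (q i))))
    (hπ : IsWeakEquivalence (lift (evalMor X π₀) (evalMor X π₁)))
    (hρ : IsWeakEquivalence (lift (evalMor X ρ₀) (evalMor X ρ₁))) :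
    IsWeakEquivalence (lift (evalMor X r) (piLift fun i => evalMor X (ρ₁.comp (q i)))) := by
  refine (hπ.whiskerRight _).of_comp_right ?_
  have e : lift (evalMor X r) (piLift fun i => evalMor X (ρ₁.comp (q i))) ≫
      lift (evalMor X π₀) (evalMor X π₁) ▷ piSSet (fun i => X.obj (t i)) =
      (lift (evalMor X ρ₀) (evalMor X ρ₁) ≫ X.obj s ◁
        lift (evalMor X p) (piLift fun i => evalMor X (q i))) ≫ (α_ _ _ _).inv := by
    have e₀ : evalMor X r ≫ evalMor X π₀ = evalMor X ρ₀ := by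
      rw [← evalMor_comp]
      exact evalMor_eq_of_lev X hr₀
    have e₁ : evalMor X r ≫ evalMor X π₁ = evalMor X ρ₁ ≫ evalMor X p := by
      rw [← evalMor_comp, ← evalMor_comp]
      exact evalMor_eq_of_lev X hr₁
    rw [lift_whiskerRight, comp_lift, e₀, e₁, piLift_evalMor_comp, lift_whiskerLeft, comp_lift,
      lift_lift_associator_inv]
  rw [e]
  exact (hρ.comp (h.whiskerLeft _)).comp (.of_isIso _)

/-- If `X` preserves `l = ∏ r` and the product obtained from `e = t 0 × l` by splitting `l` up to weak
equivalence, then it preserves `e = t 0 × l` up to weak equivalence. -/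
theorem isWeakEquivalence_lift_of_piLift_cons {C : Type u} [EnrichedCategory SSet.{u} C]
    (X : EnrichedFunctor SSet.{u} C SSet.{u}) {k : ℕ} {e l : C} {t : Fin (k + 1) → C}
    {p : Mor e (t 0)} {q : Mor e l} {r : ∀ i : Fin k, Mor l (t i.succ)}
    (h : IsWeakEquivalence (piLift (X := fun i => X.obj (t i)) fun i : Fin (k + 1) => evalMor X
      (Fin.cases (motive := fun i => Mor e (t i)) p (fun i => q.comp (r i)) i)))
    (hr : IsWeakEquivalence (piLift fun i => evalMor X (r i))) :
    IsWeakEquivalence (lift (evalMor X p) (evalMor X q)) := by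
  have h3 : IsWeakEquivalence (lift (evalMor X p) (piLift fun i => evalMor X (q.comp (r i)))) := by
    rwa [isWeakEquivalence_piLift_succ_iff] at h
  refine (hr.whiskerLeft (X.obj (t 0))).of_comp_right ?_
  rwa [lift_whiskerLeft, ← piLift_evalMor_comp]

end ConsProducts

section Theory

open CartesianMonoidalCategory

variable {S : Type u} (T : SimplicialTheory S)

/-- The empty word is terminal: there is some terminal word `a`, and `a = a ++ []` is a product of `a`
and the empty word. -/
theorem SimplicialTheory.existsUnique_hom_nil (c : T.Obj) (m : SimplexCategoryᵒᵖ) :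
    ∃! _ : toLevel m c ⟶ toLevel m (T.word []), True := by
  obtain ⟨a, p, hp⟩ := T.exists_product 0 (fun i => i.elim0)
  have h := T.append_product a []
  rw [List.append_nil] at h
  obtain ⟨q, hq⟩ := h
  have hq' : IsBinaryProduct (C := T.Obj) (q 0) (q 1) := IsProduct.isBinaryProduct (C := T.Obj) hq
  obtain ⟨x, -⟩ := ((isProduct_iff (C := T.Obj) p).1 hp c m).2 fun i => i.elim0
  have hx (g : toLevel m c ⟶ toLevel m (T.word a)) : g = x :=
    ((isProduct_iff (C := T.Obj) p).1 hp c m).1 (funext fun i => i.elim0)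
  refine ⟨x ≫ lev (C := T.Obj) (q 1) m, trivial, fun u _ => ?_⟩
  obtain ⟨g, hg⟩ := (hq' c m).2 (x, u)
  have h1 : g ≫ lev (C := T.Obj) (q 1) m = u := congrArg Prod.snd hg
  exact h1.symm.trans (congrArg (fun z => z ≫ lev (C := T.Obj) (q 1) m) (hx g))

theorem SimplicialTheory.isProduct_nil {k : ℕ} (hk : k = 0) {t : Fin k → T.Obj}
    (p : ∀ i, Mor (T.word []) (t i)) : IsProduct p := by
  subst hk
  rw [isProduct_iff]
  refine fun c m => ⟨fun g g' _ => (T.existsUnique_hom_nil c m).unique trivial trivial,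
    fun v => ?_⟩
  obtain ⟨g, -⟩ := T.existsUnique_hom_nil c m
  exact ⟨g, funext fun i => i.elim0⟩

theorem SimplicialTheory.exists_mor_nil (c : T.Obj) : Nonempty (Mor c (T.word [])) := by
  choose g _ hg using fun m => T.existsUnique_hom_nil c m
  exact ⟨morOfLevels g fun m m' s => hg m' _ trivial⟩

theorem SimplicialTheory.exists_cons_binaryProduct (s : S) (l : List S) :
    ∃ (p : Mor (T.word (s :: l)) (T.word [s])) (q : Mor (T.word (s :: l)) (T.word l)),
      IsBinaryProduct p q := by
  obtain ⟨p, hp⟩ := T.append_product [s] l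
  exact ⟨p 0, p 1, IsProduct.isBinaryProduct (C := T.Obj) hp⟩

/-- Every word is a product of its letters. -/
theorem SimplicialTheory.exists_letters (l : List S) :
    ∃ p : ∀ i : Fin l.length, Mor (T.word l) (T.word [l.get i]), IsProduct p := by
  induction l with
  | nil => exact ⟨fun i => (Nat.not_lt_zero _ i.2).elim, T.isProduct_nil rfl _⟩
  | cons s l ih =>
    obtain ⟨r, hr⟩ := ih
    obtain ⟨p, q, h⟩ := T.exists_cons_binaryProduct s l
    exact ⟨_, IsConsProduct.isProduct (t := fun i => T.word [(s :: l).get i])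
      (h.isConsProduct hr)⟩

variable {T} {X : EnrichedFunctor SSet.{u} T.Obj SSet.{u}}

/-- Adding a letter: `X(s :: l) ⟶ X([s]) × X(l)` is a weak equivalence. -/
theorem IsWeakModel.exists_cons (hX : IsWeakModel T X) (s : S) (l : List S) :
    ∃ (p : Mor (T.word (s :: l)) (T.word [s])) (q : Mor (T.word (s :: l)) (T.word l)),
      IsBinaryProduct p q ∧ IsWeakEquivalence (lift (evalMor X p) (evalMor X q)) := by
  obtain ⟨p, q, h⟩ := T.exists_cons_binaryProduct s l
  obtain ⟨r, hr⟩ := T.exists_letters l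
  exact ⟨p, q, h, isWeakEquivalence_lift_of_piLift_cons X
    (t := fun i : Fin (l.length + 1) => T.word [(s :: l).get i])
    ((isWeakEquivalence_piLift_iff _).2 (hX (s :: l) _
      (IsConsProduct.isProduct (t := fun i => T.word [(s :: l).get i]) (h.isConsProduct hr))))
    ((isWeakEquivalence_piLift_iff _).2 (hX l r hr))⟩

theorem IsWeakModel.isWeakEquivalence_toUnit (hX : IsWeakModel T X) :
    IsWeakEquivalence (toUnit (X.obj (T.word []))) := by
  obtain ⟨p, hp⟩ := T.exists_letters []
  exact (isWeakEquivalence_piLift_zero_iff rfl _).1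
    ((isWeakEquivalence_piLift_iff _).2 (hX [] p hp))

/-- Adding a letter to the first word of a finite family of words. -/
theorem IsWeakModel.exists_isConsProduct (hX : IsWeakModel T X) {k : ℕ} (t : Fin k → T.Obj)
    (ht : ∃ (e : List S) (q : ∀ i, Mor (T.word e) (t i)), IsProduct q ∧
      IsWeakEquivalence (piLift fun i => evalMor X (q i))) (l : List S) :
    ∃ (e : List S) (p : Mor (T.word e) (T.word l)) (q : ∀ i, Mor (T.word e) (t i)),
      IsConsProduct p q ∧
      IsWeakEquivalence (lift (evalMor X p) (piLift fun i => evalMor X (q i))) := by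
  induction l with
  | nil =>
    obtain ⟨e, q, hq, hq'⟩ := ht
    obtain ⟨p⟩ := T.exists_mor_nil (T.word e)
    refine ⟨e, p, q, fun c m => ⟨fun g g' hg => ?_, fun v => ?_⟩, ?_⟩
    · exact hq.hom_ext fun i => congrFun (congrArg Prod.snd hg) i
    · exact ⟨hq.lift (c := toLevel m c) v.2, Prod.ext
        ((T.existsUnique_hom_nil c m).unique trivial trivial)
        (funext fun i => hq.lift_lev _ i)⟩
    · refine (hX.isWeakEquivalence_toUnit.snd_of_toUnit _).of_comp_right ?_
      rwa [lift_snd]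
  | cons s l ih =>
    obtain ⟨e, p, q, h, h'⟩ := ih
    obtain ⟨π₀, π₁, hπ, hπ'⟩ := hX.exists_cons s l
    obtain ⟨ρ₀, ρ₁, hρ, hρ'⟩ := hX.exists_cons s e
    obtain ⟨r, hr₀, hr₁, hr⟩ := h.exists_of_isBinaryProduct hπ hρ
    exact ⟨_, r, _, hr, isWeakEquivalence_of_isBinaryProduct X hr₀ hr₁ h' hπ' hρ'⟩

/-- Every finite family of words has a product which `X` preserves up to weak equivalence. -/
theorem IsWeakModel.exists_product (hX : IsWeakModel T X) {k : ℕ} (t : Fin k → T.Obj) :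
    ∃ (e : List S) (q : ∀ i, Mor (T.word e) (t i)), IsProduct q ∧
      IsWeakEquivalence (piLift fun i => evalMor X (q i)) := by
  induction k with
  | zero =>
    exact ⟨T.word [], fun i => i.elim0, T.isProduct_nil rfl _,
      (isWeakEquivalence_piLift_zero_iff rfl _).2 hX.isWeakEquivalence_toUnit⟩
  | succ k ih =>
    obtain ⟨e, p, q, h, h'⟩ := hX.exists_isConsProduct (fun i => t i.succ) (ih _) (t 0)
    exact ⟨e, _, h.isProduct, (isWeakEquivalence_piLift_succ_iff _).2 h'⟩

end Theory

end

end AlgTheory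

end

theorem mainTheorem6 {S S' : Type u} (T : AlgTheory.SimplicialTheory S)
    (T' : AlgTheory.SimplicialTheory S') (f : AlgTheory.TheoryHom T T')
    (X : EnrichedFunctor SSet.{u} T.Obj SSet.{u}) (hX : AlgTheory.IsWeakModel T X) :
    AlgTheory.IsWeakModel T' (AlgTheory.homotopyLan f.functor X) := by
  intro a p hp
  choose w q hq hw using fun c : Fin a.length → T.Obj => hX.exists_product c
  exact (AlgTheory.isWeakEquivalence_piLift_iff _).1
    (AlgTheory.isWeakEquivalence_evalMor_homotopyLan f.functor X ⟨w, q, hq⟩ _ hp hw)
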